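/- **Notation.** Fix $\theta\in\{1,-1\}$, integers $n,p,q\ge 0$ and $m=p+q$. *Yangian.* $Y(\mathfrak{gl}_n)$ is the unital associative $\mathbb C$-algebra with generators $T_{ij}^{(r)}$ ($1\le i,j\le n$, $r\ge1$) and the relations $(u-v)[T_{ij}(u),T_{kl}(v)]=T_{kj}(u)T_{il}(v)-T_{kj}(v)T_{il}(u)$, where $T_{ij}(u)=\delta_{ij}+\sum_{r\ge1}T_{ij}^{(r)}u^{-r}$. Tensor products of modules are formed with $\Delta\colon T_{ij}(u)\mapsto\sum_k T_{ik}(u)\otimes T_{kj}(u)$; the empty tensor product is the trivial module $\mathbb C$. *Differential operators.* $\mathcal H$ is the algebra generated by $x_{ai}$ ($1\le a\le m$, $1\le i\le n$) with $x_{ai}x_{bj}=\theta x_{bj}x_{ai}$ (a polynomial algebra if $\theta=1$, a Grassmann algebra if $\theta=-1$). $\mathcal{HD}$ is the algebra generated by $x_{ai},\partial_{ai}$ with $x_{ai}x_{bj}=\theta x_{bj}x_{ai}$, $\partial_{ai}\partial_{bj}=\theta\partial_{bj}\partial_{ai}$, $\partial_{ai}x_{bj}-\theta x_{bj}\partial_{ai}=\delta_{ab}\delta_{ij}$;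 it acts on $\mathcal H$, the $x_{ai}$ by left multiplication and the $\partial_{ai}$ as left derivations. Put $q_{ci}=\partial_{ci}$, $p_{ci}=-\theta x_{ci}$ for $c\le p$, and $q_{ci}=x_{ci}$, $p_{ci}=\partial_{ci}$ for $c>p$. Put $\zeta_n(E_{ab})=\theta\delta_{ab}\frac n2+\sum_k q_{ak}p_{bk}$. *The modules $\mathcal E_\delta(V)$.* Let $E$ be the matrix of generators $E_{ab}$ of $\mathfrak{gl}_m$, $E'$ its transpose and $X(u)=(u+\theta E')^{-1}$, a matrix of formal power series in $u^{-1}$ over $U(\mathfrak{gl}_m)$. For $\delta\in\{1,-1\}^m$ let $\varpi$ be the automorphism of $\mathcal{HD}$ with $x_{ak}\mapsto-\theta\partial_{ak}$, $\partial_{ak}\mapsto x_{ak}$ whenever $\delta_a=-1$, which fixes $x_{ak},\partial_{ak}$ whenever $\delta_a=1$. For a $\mathfrak{gl}_m$-module $V$, let $\mathcal E_\delta(V)=V\otimes\mathcal H$ with the commuting actions $$T_{ij}(u)\mapsto\delta_{ij}+\sum_{a,b=1}^m X_{ab}(u)\otimes\varpi(q_{ai}p_{bj}),\qquad E_{ab}\mapsto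 E_{ab}\otimes1+1\otimes\varpi(\zeta_n(E_{ab}))$$ of $Y(\mathfrak{gl}_n)$ and $\mathfrak{gl}_m$. Let $\mathfrak n$ be the span of the $E_{ba}$ with $a<b$ and $\mathfrak h$ the span of the $E_{aa}$. Then $\mathcal E_\delta(V)_{\mathfrak n}=\mathcal E_\delta(V)/\mathfrak n\cdot\mathcal E_\delta(V)$ carries actions of $Y(\mathfrak{gl}_n)$ and $\mathfrak h$. For $\kappa\in\mathbb C^m$ let $\mathcal E_\delta(V)_{\mathfrak n}^{\kappa}$ be its $Y(\mathfrak{gl}_n)$-submodule of vectors on which each $E_{aa}$ acts as $\kappa_a$. Let $M_\mu$ be the Verma module of $\mathfrak{gl}_m$ of highest weight $\mu$, generated by a vector annihilated by the $E_{ab}$ with $a<b$, on which $E_{aa}$ acts as $\mu_a$. *The modules $\Psi$.* Let $\mathcal H(\mathbb C^n)$ be the algebra $\mathcal H$ for $m=1$, with generators $x_i$ and left derivations $\partial_i$. For $z\in\mathbb C$ let $\Phi_z$ and $\widetilde\Phi_z$ be the $Y(\mathfrak{gl}_n)$-modules with underlying space $\mathcal H(\mathbb C^n)$ and the actions $$T_{ij}(u)\mapsto\delta_{ij}+\frac{x_i\partial_j}{u+\theta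 z}\quad\text{and}\quad T_{ij}(u)\mapsto\delta_{ij}-\theta\,\frac{\partial_i x_j}{u+\theta z},$$ respectively. For an integer $N\ge0$ let $\Psi_z^{+N}\subset\Phi_z$ and $\Psi_z^{-N}\subset\widetilde\Phi_z$ be the submodules of elements of degree $N$. The sign is part of the notation also when $N=0$: $\Psi_z^{+0}$ is the trivial module $\mathbb C$, while on the one-dimensional module $\Psi_z^{-0}$ one has $T_{ij}(u)\mapsto\delta_{ij}\bigl(1-\frac{\theta}{u+\theta z}\bigr)$. *Permutations.* For $\sigma\in\mathfrak S_m$ and $\mu\in\mathbb C^m$ let $\sigma(\mu)_a=\mu_{\sigma^{-1}(a)}$, $\rho=(0,-1,\dots,1-m)$ and $\sigma\circ\mu=\sigma(\mu+\rho)-\rho$. For $\delta\in\{1,-1\}^m$ let $\widehat\delta=(\delta_1,\dots,\delta_p,-\delta_{p+1},\dots,-\delta_{m})$, and let $\sigma(\delta)$ be the sequence with $\widehat{\sigma(\delta)}_a=\widehat\delta_{\sigma^{-1}(a)}$. Let $\delta^+=(1,\dots,1)$. **Proposition 3.4.** Let $\sigma\in\mathfrak S_m$ and let $\mu,\lambda\in\mathbb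 C^m$, where $\mu$ is generic: $\mu_a-\mu_b\notin\mathbb Z$ for all $a\ne b$. Suppose that the numbers $$\nu_a=-\lambda_a+\mu_a-\theta\tfrac n2\quad(a=1,\dots,p),\qquad \nu_a=\lambda_a-\mu_a-\theta\tfrac n2\quad(a=p+1,\dots,m)$$ are non-negative integers. Put $\widetilde\mu_a=\mu_{\sigma^{-1}(a)}$, $\widetilde\nu_a=\nu_{\sigma^{-1}(a)}$, $\widetilde\rho_a=\rho_{\sigma^{-1}(a)}$. Then for $\delta=\sigma(\delta^+)$ the $Y(\mathfrak{gl}_n)$-module $\mathcal E_\delta(M_{\sigma\circ\mu})_{\mathfrak n}^{\sigma\circ\lambda}$ is isomorphic to the tensor product $$\Psi_{\widetilde\mu_1+\widetilde\rho_1}^{-\delta_1\widetilde\nu_1}\otimes\dots\otimes\Psi_{\widetilde\mu_p+\widetilde\rho_p}^{-\delta_p\widetilde\nu_p}\otimes\Psi_{\widetilde\mu_{p+1}+\widetilde\rho_{p+1}}^{\delta_{p+1}\widetilde\nu_{p+1}}\otimes\dots\otimes\Psi_{\widetilde\mu_m+\widetilde\rho_m}^{\delta_m\widetilde\nu_m}.$$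 -/

import Mathlib

open scoped TensorProduct

noncomputable section

namespace RatYangian

/-! ### The Yangian of `gl_n` -/

/-- The free generators `T_ij^(r)`, with the convention `T_ij^(0) = δ_ij`. -/
def freeT (n : ℕ) (i j : Fin n) : ℕ → FreeAlgebra ℂ (Fin n × Fin n × ℕ)
  | 0 => if i = j then 1 else 0
  | r + 1 => FreeAlgebra.ι ℂ (i, j, r)

/-- The coefficient at `u^(-r) v^(-s)` of the defining relation
`(u - v) [T_ij(u), T_kl(v)] = T_kj(u) T_il(v) - T_kj(v) T_il(u)`. -/
inductive YangianRel (n : ℕ) :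
    FreeAlgebra ℂ (Fin n × Fin n × ℕ) → FreeAlgebra ℂ (Fin n × Fin n × ℕ) → Prop
  | mk (i j k l : Fin n) (r s : ℕ) : YangianRel n
      ((freeT n i j (r + 1) * freeT n k l s - freeT n k l s * freeT n i j (r + 1))
        - (freeT n i j r * freeT n k l (s + 1) - freeT n k l (s + 1) * freeT n i j r))
      (freeT n k j r * freeT n i l s - freeT n k j s * freeT n i l r)

/-- The Yangian `Y(gl_n)`: the unital associative complex algebra generated by the `T_ij^(r)`,
`r ≥ 1`, subject to the relations `YangianRel`. -/
def Yangian (n : ℕ) : Type := RingQuot (YangianRel n)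

instance (n : ℕ) : Ring (Yangian n) := inferInstanceAs (Ring (RingQuot (YangianRel n)))
instance (n : ℕ) : Algebra ℂ (Yangian n) :=
  inferInstanceAs (Algebra ℂ (RingQuot (YangianRel n)))

/-- The quotient map from the free algebra. -/
def Yangian.mk (n : ℕ) : FreeAlgebra ℂ (Fin n × Fin n × ℕ) →ₐ[ℂ] Yangian n :=
  RingQuot.mkAlgHom ℂ (YangianRel n)

/-- The coefficient `T_ij^(r)` of `u^(-r)` in the series `T_ij(u)`; in particular
`T_ij^(0) = δ_ij`. -/
def Yangian.T (n : ℕ) (i j : Fin n) (r : ℕ) : Yangian n := Yangian.mk n (freeT n i j r)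

/-- A family of elements `T i j r` of a ring, thought of as the coefficients of `u^(-r)` of
series `T_ij(u) = δ_ij + ⋯`, that satisfies the defining relations of the Yangian. -/
structure IsYangianFamily {n : ℕ} {A : Type*} [Ring A] (T : Fin n → Fin n → ℕ → A) : Prop where
  zero : ∀ i j, T i j 0 = if i = j then 1 else 0
  rel : ∀ i j k l r s,
    (T i j (r + 1) * T k l s - T k l s * T i j (r + 1))
      - (T i j r * T k l (s + 1) - T k l (s + 1) * T i j r)
      = T k j r * T i l s - T k j s * T i l r

theorem Yangian.isYangianFamily (n : ℕ) : IsYangianFamily (Yangian.T n) where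
  zero i j := by simp only [Yangian.T, freeT]; split_ifs <;> simp
  rel i j k l r s := by
    have h : Yangian.mk n _ = Yangian.mk n _ :=
      RingQuot.mkAlgHom_rel ℂ (YangianRel.mk i j k l r s)
    simpa only [map_sub, map_mul, Yangian.T] using h

theorem freeT_lift {n : ℕ} {A : Type*} [Ring A] [Algebra ℂ A] {T : Fin n → Fin n → ℕ → A}
    (hT : IsYangianFamily T) (i j : Fin n) (r : ℕ) :
    FreeAlgebra.lift ℂ (fun x : Fin n × Fin n × ℕ => T x.1 x.2.1 (x.2.2 + 1)) (freeT n i j r)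
      = T i j r := by
  cases r with
  | zero => rw [hT.zero]; simp only [freeT]; split_ifs <;> simp
  | succ r => simp [freeT]

/-- The universal property of `Y(gl_n)`: the homomorphism with `T_ij^(r) ↦ T i j r`. -/
def Yangian.lift {n : ℕ} {A : Type*} [Ring A] [Algebra ℂ A] {T : Fin n → Fin n → ℕ → A}
    (hT : IsYangianFamily T) : Yangian n →ₐ[ℂ] A :=
  RingQuot.liftAlgHom ℂ
    ⟨FreeAlgebra.lift ℂ (fun x : Fin n × Fin n × ℕ => T x.1 x.2.1 (x.2.2 + 1)), by
      rintro _ _ ⟨i, j, k, l, r, s⟩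
      simp only [map_sub, map_mul, freeT_lift hT]
      exact hT.rel i j k l r s⟩

@[simp] theorem Yangian.lift_T {n : ℕ} {A : Type*} [Ring A] [Algebra ℂ A]
    {T : Fin n → Fin n → ℕ → A} (hT : IsYangianFamily T) (i j : Fin n) (r : ℕ) :
    Yangian.lift hT (Yangian.T n i j r) = T i j r := by
  rw [← freeT_lift hT]
  exact RingQuot.liftAlgHom_mkAlgHom_apply ℂ _ _ _

/-- The algebra `Y(gl_n)` is generated by the `T_ij^(r)`. -/
theorem Yangian.mem_of_T {n : ℕ} (S : Subalgebra ℂ (Yangian n))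
    (h : ∀ i j r, Yangian.T n i j r ∈ S) (y : Yangian n) : y ∈ S := by
  obtain ⟨w, rfl⟩ : ∃ w, Yangian.mk n w = y := RingQuot.mkAlgHom_surjective ℂ _ y
  induction w using FreeAlgebra.induction with
  | grade0 r => rw [AlgHom.commutes]; exact S.algebraMap_mem r
  | grade1 x => exact h x.1 x.2.1 (x.2.2 + 1)
  | mul a b ha hb => rw [map_mul]; exact S.mul_mem ha hb
  | add a b ha hb => rw [map_add]; exact S.add_mem ha hb

theorem IsYangianFamily.map {n : ℕ} {A B : Type*} [Ring A] [Ring B] [Algebra ℂ A] [Algebra ℂ B]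
    {T : Fin n → Fin n → ℕ → A} (hT : IsYangianFamily T) (f : A →ₐ[ℂ] B) :
    IsYangianFamily (fun i j r => f (T i j r)) where
  zero i j := by rw [hT.zero]; split_ifs <;> simp
  rel i j k l r s := by
    have h := congrArg f (hT.rel i j k l r s)
    simpa only [map_sub, map_mul] using h

/-! ### Comultiplication and counit -/

/-- The relations of a Yangian family in terms of generating series, where the outer variable is
`u⁻¹` and the inner variable is `v⁻¹`. -/
theorem isYangianFamily_iff_series {n : ℕ} {A : Type*} [Ring A]
    (T : Fin n → Fin n → PowerSeries A) :
    IsYangianFamily (fun i j r => PowerSeries.coeff r (T i j)) ↔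
      (∀ i j, PowerSeries.coeff 0 (T i j) = if i = j then 1 else 0) ∧
      ∀ i j k l,
        (PowerSeries.C PowerSeries.X - PowerSeries.X) *
          (PowerSeries.map PowerSeries.C (T i j) * PowerSeries.C (T k l)
            - PowerSeries.C (T k l) * PowerSeries.map PowerSeries.C (T i j))
        = PowerSeries.X * (PowerSeries.C PowerSeries.X *
          (PowerSeries.map PowerSeries.C (T k j) * PowerSeries.C (T i l)
            - PowerSeries.C (T k j) * PowerSeries.map PowerSeries.C (T i l))) := by
  constructor
  · rintro ⟨h0, h⟩
    refine ⟨h0, fun i j k l => ?_⟩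
    ext r s
    rcases r with _ | r <;> rcases s with _ | s <;>
      simp only [sub_mul, map_sub, PowerSeries.coeff_succ_X_mul, PowerSeries.coeff_C_mul,
        PowerSeries.coeff_mul_C, PowerSeries.coeff_map, PowerSeries.coeff_zero_X_mul]
    · simp
    · have e := h0 i j
      simp only [e]; split_ifs <;> simp
    · have e := h0 k l
      simp only [e]; split_ifs <;> simp
    · have := h i j k l r s
      rw [← this]
  · rintro ⟨h0, h⟩
    refine ⟨h0, fun i j k l r s => ?_⟩
    have := congrArg (fun f => PowerSeries.coeff (s + 1) (PowerSeries.coeff (r + 1) f))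
      (h i j k l)
    simpa only [sub_mul, map_sub, PowerSeries.coeff_succ_X_mul, PowerSeries.coeff_C_mul,
        PowerSeries.coeff_mul_C, PowerSeries.coeff_map, PowerSeries.coeff_zero_X_mul] using this

theorem rtt_mul {n : ℕ} {R : Type*} [Ring R] (U V : R) (Tu Tv Su Sv : Fin n → Fin n → R)
    (hU : ∀ f, Commute U f) (hV : ∀ f, Commute V f)
    (hcu : ∀ i j k l, Commute (Tu i j) (Sv k l)) (hcv : ∀ i j k l, Commute (Tv i j) (Su k l))
    (hT : ∀ i j k l, (V - U) * (Tu i j * Tv k l - Tv k l * Tu i j)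
      = U * (V * (Tu k j * Tv i l - Tv k j * Tu i l)))
    (hS : ∀ i j k l, (V - U) * (Su i j * Sv k l - Sv k l * Su i j)
      = U * (V * (Su k j * Sv i l - Sv k j * Su i l))) (i j k l : Fin n) :
    (V - U) * ((∑ a, Tu i a * Su a j) * (∑ b, Tv k b * Sv b l)
        - (∑ b, Tv k b * Sv b l) * (∑ a, Tu i a * Su a j))
      = U * (V * ((∑ a, Tu k a * Su a j) * (∑ b, Tv i b * Sv b l)
        - (∑ b, Tv k b * Sv b j) * (∑ a, Tu i a * Su a l))) := by
  have e1 : ∀ a b, (V - U) * (Tu i a * Su a j * (Tv k b * Sv b l)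
      - Tv k b * Sv b l * (Tu i a * Su a j))
      = U * (V * (Tu k a * Su a j * (Tv i b * Sv b l) - Tv k b * Sv b j * (Tu i a * Su a l)))
        + (U * (V * (Tv k b * Tu i a * (Su b j * Sv a l)))
          - U * (V * (Tv k a * Tu i b * (Su a j * Sv b l)))) := by
    intro a b
    have h1 : Tu i a * Su a j * (Tv k b * Sv b l) - Tv k b * Sv b l * (Tu i a * Su a j)
        = (Tu i a * Tv k b - Tv k b * Tu i a) * (Su a j * Sv b l)
          + Tv k b * Tu i a * (Su a j * Sv b l - Sv b l * Su a j) := by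
      have c1 : Tu i a * (Tv k b * Su a j) * Sv b l = Tu i a * (Su a j * Tv k b) * Sv b l := by
        rw [(hcv k b a j).eq]
      have c2 : Tv k b * (Tu i a * Sv b l) * Su a j = Tv k b * (Sv b l * Tu i a) * Su a j := by
        rw [(hcu i a b l).eq]
      simp only [mul_assoc, sub_mul, mul_sub] at *
      rw [← c1, ← c2]; abel
    have c3 : (V - U) * (Tv k b * Tu i a) = Tv k b * Tu i a * (V - U) :=
      ((hV _).sub_left (hU _)).eq
    have c4 : Tv k b * Tu i a * (U * (V * (Su b j * Sv a l - Sv b j * Su a l)))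
        = U * (V * (Tv k b * Tu i a * (Su b j * Sv a l - Sv b j * Su a l))) := by
      rw [← mul_assoc, ← (hU _).eq, mul_assoc, ← mul_assoc _ V, ← (hV _).eq, mul_assoc]
    have c5 : Tu k a * Su a j * (Tv i b * Sv b l) = Tu k a * Tv i b * (Su a j * Sv b l) := by
      rw [mul_assoc, ← mul_assoc (Su a j), ← (hcv i b a j).eq]; simp only [mul_assoc]
    have c6 : Tv k b * Sv b j * (Tu i a * Su a l) = Tv k b * Tu i a * (Sv b j * Su a l) := by
      rw [mul_assoc, ← mul_assoc (Sv b j), ← (hcu i a b j).eq]; simp only [mul_assoc]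
    rw [h1, mul_add, ← mul_assoc, hT, ← mul_assoc (V - U), c3, mul_assoc _ (V - U), hS, c4, c5, c6]
    simp only [mul_sub, sub_mul, mul_assoc]; abel
  simp only [Finset.sum_mul_sum]
  rw [Finset.sum_comm (f := fun b a => Tv k b * Sv b l * (Tu i a * Su a j)),
    Finset.sum_comm (f := fun b a => Tv k b * Sv b j * (Tu i a * Su a l))]
  simp only [← Finset.sum_sub_distrib, Finset.mul_sum, e1]
  rw [Finset.sum_congr rfl fun a _ => Finset.sum_add_distrib, Finset.sum_add_distrib]
  simp only [Finset.sum_sub_distrib]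
  rw [Finset.sum_comm (f := fun a b => U * (V * (Tv k b * Tu i a * (Su b j * Sv a l))))]
  simp

theorem IsYangianFamily.mul {n : ℕ} {A : Type*} [Ring A] {T S : Fin n → Fin n → ℕ → A}
    (hT : IsYangianFamily T) (hS : IsYangianFamily S)
    (hc : ∀ i j k l r s, Commute (T i j r) (S k l s)) :
    IsYangianFamily (fun i j r => ∑ k, ∑ x ∈ Finset.HasAntidiagonal.antidiagonal r, T i k x.1 * S k j x.2) := by
  have hT2 := (isYangianFamily_iff_series (fun i j => PowerSeries.mk (T i j))).1
    (by simpa only [PowerSeries.coeff_mk] using hT)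
  have hS2 := (isYangianFamily_iff_series (fun i j => PowerSeries.mk (S i j))).1
    (by simpa only [PowerSeries.coeff_mk] using hS)
  have key := (isYangianFamily_iff_series
    (fun i j => ∑ k, PowerSeries.mk (T i k) * PowerSeries.mk (S k j))).2
  simp only [map_sum, PowerSeries.coeff_mul, PowerSeries.coeff_mk] at key
  refine key ⟨fun i j => ?_, fun i j k l => ?_⟩
  · simp [hT.zero, hS.zero]
  have hX : ∀ f : PowerSeries (PowerSeries A), Commute PowerSeries.X f :=
    fun f => (PowerSeries.commute_X f).symm
  have hCX : ∀ f : PowerSeries (PowerSeries A), Commute (PowerSeries.C PowerSeries.X) f := by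
    intro f; ext r : 1; simp [PowerSeries.X_mul]
  have hcu : ∀ i j k l, Commute (PowerSeries.map PowerSeries.C (PowerSeries.mk (T i j)))
      (PowerSeries.C (PowerSeries.mk (S k l))) := by
    intro i j k l; ext r s; simp [(hc i j k l r s).eq]
  have hcv : ∀ i j k l, Commute (PowerSeries.C (PowerSeries.mk (T i j)))
      (PowerSeries.map PowerSeries.C (PowerSeries.mk (S k l))) := by
    intro i j k l; ext r s; simp [(hc i j k l s r).eq]
  simp only [map_mul]
  exact rtt_mul _ _ (fun i j => PowerSeries.map PowerSeries.C (PowerSeries.mk (T i j)))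
    (fun i j => PowerSeries.C (PowerSeries.mk (T i j)))
    (fun i j => PowerSeries.map PowerSeries.C (PowerSeries.mk (S i j)))
    (fun i j => PowerSeries.C (PowerSeries.mk (S i j))) hX hCX hcu hcv hT2.2 hS2.2 i j k l

theorem Yangian.comul_family (n : ℕ) : IsYangianFamily (fun (i j : Fin n) (r : ℕ) =>
    ∑ k, ∑ x ∈ Finset.HasAntidiagonal.antidiagonal r,
      Yangian.T n i k x.1 ⊗ₜ[ℂ] Yangian.T n k j x.2) := by
  have h := ((Yangian.isYangianFamily n).map
      (Algebra.TensorProduct.includeLeft (R := ℂ) (S := ℂ) (B := Yangian n))).mul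
    ((Yangian.isYangianFamily n).map
      (Algebra.TensorProduct.includeRight (R := ℂ) (A := Yangian n)))
    (fun i j k l r s => by
      simp only [Commute, SemiconjBy, Algebra.TensorProduct.includeLeft_apply,
        Algebra.TensorProduct.includeRight_apply, Algebra.TensorProduct.tmul_mul_tmul,
        mul_one, one_mul])
  simpa only [Algebra.TensorProduct.includeLeft_apply,
    Algebra.TensorProduct.includeRight_apply, Algebra.TensorProduct.tmul_mul_tmul,
    mul_one, one_mul] using h

/-- The comultiplication `Δ : T_ij(u) ↦ ∑_k T_ik(u) ⊗ T_kj(u)`. -/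
def Yangian.comul (n : ℕ) : Yangian n →ₐ[ℂ] Yangian n ⊗[ℂ] Yangian n :=
  Yangian.lift (Yangian.comul_family n)

/-- The counit `ε : T_ij(u) ↦ δ_ij`. -/
def Yangian.counit (n : ℕ) : Yangian n →ₐ[ℂ] ℂ :=
  Yangian.lift (T := fun i j r => if r = 0 then (if i = j then 1 else 0) else 0)
    { zero := by simp
      rel := by
        intro i j k l r s
        rcases r with _ | r <;> rcases s with _ | s <;> simp }

/-! ### Modules over the Yangian -/

/-- A (left) `Y(gl_n)`-module: a complex vector space with an action of `Y(gl_n)`. -/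
structure YangianModule (n : ℕ) where
  carrier : Type
  [addCommGroup : AddCommGroup carrier]
  [module : Module ℂ carrier]
  action : Yangian n →ₐ[ℂ] Module.End ℂ carrier

namespace YangianModule

variable {n : ℕ}

instance : CoeSort (YangianModule n) Type := ⟨YangianModule.carrier⟩

instance (M : YangianModule n) : AddCommGroup M := M.addCommGroup

instance (M : YangianModule n) : Module ℂ M := M.module

/-- `M ≅ N` as `Y(gl_n)`-modules: there is a bijective linear map intertwining the actions. -/
def IsIsomorphic (M N : YangianModule n) : Prop :=
  ∃ e : M ≃ₗ[ℂ] N, ∀ (y : Yangian n) (v : M), e (M.action y v) = N.action y (e v)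

/-- The tensor product of `Y(gl_n)`-modules, with the action through the comultiplication. -/
def tensor (M N : YangianModule n) : YangianModule n where
  carrier := M ⊗[ℂ] N
  action := (Module.endTensorEndAlgHom (R := ℂ) (S := ℂ) (A := ℂ)).comp
    ((Algebra.TensorProduct.map M.action N.action).comp (Yangian.comul n))

/-- The trivial one-dimensional `Y(gl_n)`-module, with the action through the counit. -/
def trivial (n : ℕ) : YangianModule n where
  carrier := ℂ
  action := (Algebra.lsmul ℂ ℂ ℂ).comp (Yangian.counit n)

/-- The ordered tensor product `M_1 ⊗ (M_2 ⊗ (⋯ ⊗ (M_k ⊗ ℂ)))` of a list of modules. -/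
def tensorList (L : List (YangianModule n)) : YangianModule n := L.foldr tensor (trivial n)

/-- A subspace stable under all the `T_ij^(r)` is stable under `Y(gl_n)`. -/
theorem stable_of_T (M : YangianModule n) (S : Submodule ℂ M)
    (h : ∀ i j r, S ≤ S.comap (M.action (Yangian.T n i j r))) (y : Yangian n) :
    S ≤ S.comap (M.action y) := by
  let A : Subalgebra ℂ (Yangian n) :=
    { carrier := {y | S ≤ S.comap (M.action y)}
      mul_mem' := by
        intro a b ha hb v hv
        simp only [map_mul, Submodule.mem_comap, Module.End.mul_apply]
        exact ha (hb hv)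
      add_mem' := by
        intro a b ha hb v hv
        simp only [map_add, Submodule.mem_comap, LinearMap.add_apply]
        exact S.add_mem (ha hv) (hb hv)
      algebraMap_mem' := by
        intro c v hv
        simp only [AlgHom.commutes, Submodule.mem_comap, Module.algebraMap_end_apply]
        exact S.smul_mem c hv }
  exact Yangian.mem_of_T A h y

/-- The submodule with underlying space `S`. -/
def sub (M : YangianModule n) (S : Submodule ℂ M)
    (h : ∀ i j r, S ≤ S.comap (M.action (Yangian.T n i j r))) : YangianModule n where
  carrier := S
  action := AlgHom.ofLinearMap
    { toFun := fun y => (M.action y).restrict (fun v hv => M.stable_of_T S h y hv)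
      map_add' := by intro a b; ext v; simp
      map_smul' := by intro a b; ext v; simp }
    (by ext v; simp) (by intro a b; ext v; simp)

/-- The quotient module by the submodule with underlying space `S`. -/
def quot (M : YangianModule n) (S : Submodule ℂ M)
    (h : ∀ i j r, S ≤ S.comap (M.action (Yangian.T n i j r))) : YangianModule n where
  carrier := M ⧸ S
  action := AlgHom.ofLinearMap
    { toFun := fun y => S.mapQ S (M.action y) (M.stable_of_T S h y)
      map_add' := by intro a b; ext v; simp
      map_smul' := by intro a b; ext v; simp }
    (by ext v; simp) (by intro a b; ext v; simp)

end YangianModule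


/-! ### The algebra `H` and the algebra `HD` of differential operators on it -/

/-- The sign `θ = ±1` as a complex number. -/
abbrev sgn (θ : ℤˣ) : ℂ := ((θ : ℤ) : ℂ)

theorem sgn_mul_self (θ : ℤˣ) : sgn θ * sgn θ = 1 := by
  rcases Int.units_eq_one_or θ with rfl | rfl <;> simp [sgn]

section Weyl

variable {I : Type}

/-- The relations `x_i x_j = θ x_j x_i`. -/
inductive HRel (θ : ℤˣ) (I : Type) : FreeAlgebra ℂ I → FreeAlgebra ℂ I → Prop
  | mk (i j : I) : HRel θ I (FreeAlgebra.ι ℂ i * FreeAlgebra.ι ℂ j)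
      (sgn θ • (FreeAlgebra.ι ℂ j * FreeAlgebra.ι ℂ i))

/-- The algebra generated by `x_i`, `i ∈ I`, subject to `x_i x_j = θ x_j x_i`: the polynomial
algebra in the `x_i` if `θ = 1`, the Grassmann algebra on the `x_i` if `θ = -1`. -/
def HAlg (θ : ℤˣ) (I : Type) : Type := RingQuot (HRel θ I)

instance (θ : ℤˣ) (I : Type) : Ring (HAlg θ I) := inferInstanceAs (Ring (RingQuot (HRel θ I)))
instance (θ : ℤˣ) (I : Type) : Algebra ℂ (HAlg θ I) :=
  inferInstanceAs (Algebra ℂ (RingQuot (HRel θ I)))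

/-- The quotient map from the free algebra. -/
def HAlg.mk (θ : ℤˣ) (I : Type) : FreeAlgebra ℂ I →ₐ[ℂ] HAlg θ I :=
  RingQuot.mkAlgHom ℂ (HRel θ I)

/-- The generator `x_i` of `H`. -/
def HAlg.x (θ : ℤˣ) (i : I) : HAlg θ I :=
  HAlg.mk θ I (FreeAlgebra.ι ℂ i)

theorem HAlg.x_mul_x (θ : ℤˣ) (i j : I) :
    HAlg.x θ i * HAlg.x θ j = sgn θ • (HAlg.x θ j * HAlg.x θ i) := by
  have h : HAlg.mk θ I _ = HAlg.mk θ I _ := RingQuot.mkAlgHom_rel ℂ (HRel.mk (θ := θ) i j)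
  simpa only [map_mul, map_smul, HAlg.x] using h

/-- The universal property of `H`. -/
def HAlg.lift (θ : ℤˣ) {A : Type*} [Ring A] [Algebra ℂ A] (f : I → A)
    (hf : ∀ i j, f i * f j = sgn θ • (f j * f i)) : HAlg θ I →ₐ[ℂ] A :=
  RingQuot.liftAlgHom ℂ ⟨FreeAlgebra.lift ℂ f, by
    rintro _ _ ⟨i, j⟩
    simpa using hf i j⟩

@[simp] theorem HAlg.lift_x (θ : ℤˣ) {A : Type*} [Ring A] [Algebra ℂ A] (f : I → A)
    (hf : ∀ i j, f i * f j = sgn θ • (f j * f i)) (i : I) :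
    HAlg.lift θ f hf (HAlg.x θ i) = f i := by
  refine (RingQuot.liftAlgHom_mkAlgHom_apply ℂ _ _ _).trans ?_
  simp

/-- Induction along the words in the generators. -/
theorem HAlg.induction (θ : ℤˣ) {P : HAlg θ I → Prop} (one : P 1)
    (add : ∀ f g, P f → P g → P (f + g)) (smul : ∀ (c : ℂ) f, P f → P (c • f))
    (x_mul : ∀ i f, P f → P (HAlg.x θ i * f)) (f : HAlg θ I) : P f := by
  suffices h : ∀ (w : FreeAlgebra ℂ I) f, P f → P (HAlg.mk θ I w * f) by
    obtain ⟨w, rfl⟩ : ∃ w, HAlg.mk θ I w = f := RingQuot.mkAlgHom_surjective ℂ _ f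
    simpa using h w 1 one
  intro w
  induction w using FreeAlgebra.induction with
  | grade0 r =>
    intro f hf
    have e : HAlg.mk θ I (algebraMap ℂ _ r) * f = r • f := by
      rw [AlgHom.commutes, Algebra.smul_def]
    exact e ▸ smul r f hf
  | grade1 i => exact fun f hf => x_mul i f hf
  | mul a b ha hb => intro f hf; rw [map_mul, mul_assoc]; exact ha _ (hb _ hf)
  | add a b ha hb => intro f hf; rw [map_add, add_mul]; exact add _ _ (ha _ hf) (hb _ hf)

/-- The operator of left multiplication by `x_i`. -/
def HAlg.mulX (θ : ℤˣ) (i : I) : Module.End ℂ (HAlg θ I) :=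
  LinearMap.mulLeft ℂ (HAlg.x θ i)

variable [DecidableEq I]

/-- Auxiliary: the operator `(f, g) ↦ (x_j f, δ_ij f + θ x_j g)` on `H × H`. -/
def HAlg.derAux (θ : ℤˣ) (i j : I) : Module.End ℂ (HAlg θ I × HAlg θ I) :=
  LinearMap.prod (HAlg.mulX θ j ∘ₗ LinearMap.fst ℂ _ _)
    ((if i = j then (1 : ℂ) else 0) • LinearMap.fst ℂ _ _
      + sgn θ • (HAlg.mulX θ j ∘ₗ LinearMap.snd ℂ _ _))

theorem HAlg.derAux_rel (θ : ℤˣ) (i j k : I) :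
    HAlg.derAux θ i j * HAlg.derAux θ i k
      = sgn θ • (HAlg.derAux θ i k * HAlg.derAux θ i j) := by
  refine LinearMap.ext fun v => ?_
  obtain ⟨f, g⟩ := v
  have h := HAlg.x_mul_x θ j k
  have s := sgn_mul_self θ
  simp only [derAux, mulX, Module.End.mul_apply, LinearMap.prod_apply, Function.prod_apply,
    LinearMap.smul_apply, LinearMap.add_apply, LinearMap.comp_apply, LinearMap.fst_apply,
    LinearMap.snd_apply, LinearMap.mulLeft_apply, Prod.smul_mk, Prod.mk.injEq]
  simp only [mul_add, smul_add, mul_smul_comm, smul_smul, ← mul_assoc, h, s, smul_mul_assoc,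
    one_smul]
  refine ⟨trivial, ?_⟩
  simp only [mul_comm (sgn θ) (ite _ _ _), mul_assoc]
  simp only [mul_comm _ (sgn θ), one_mul]
  abel

/-- The left derivation `∂_i` of `H`: the linear operator with `∂_i 1 = 0` and
`∂_i (x_j f) = δ_ij f + θ x_j ∂_i f`, see `der_one` and `der_x_mul`. -/
def HAlg.der (θ : ℤˣ) (i : I) : Module.End ℂ (HAlg θ I) :=
  LinearMap.snd ℂ _ _ ∘ₗ
    (LinearMap.applyₗ (R := ℂ) ((1, 0) : HAlg θ I × HAlg θ I)) ∘ₗ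
    (HAlg.lift θ (HAlg.derAux θ i) (HAlg.derAux_rel θ i)).toLinearMap

theorem HAlg.derAux_fst (θ : ℤˣ) (i : I) (f : HAlg θ I) :
    (HAlg.lift θ (HAlg.derAux θ i) (HAlg.derAux_rel θ i) f (1, 0)).1 = f := by
  induction f using HAlg.induction with
  | one => simp
  | add f g hf hg => simp [hf, hg]
  | smul c f hf => simp [hf]
  | x_mul j f hf => simp [HAlg.derAux, HAlg.mulX, hf]

theorem HAlg.der_one (θ : ℤˣ) (i : I) : HAlg.der θ i 1 = 0 := by simp [HAlg.der]

theorem HAlg.der_x_mul (θ : ℤˣ) (i j : I) (f : HAlg θ I) :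
    HAlg.der θ i (HAlg.x θ j * f)
      = (if i = j then f else 0) + sgn θ • (HAlg.x θ j * HAlg.der θ i f) := by
  have h := HAlg.derAux_fst θ i f
  simp only [HAlg.der, LinearMap.comp_apply, AlgHom.toLinearMap_apply, map_mul, HAlg.lift_x,
    LinearMap.applyₗ_apply_apply, Module.End.mul_apply, LinearMap.snd_apply]
  generalize HAlg.lift θ (HAlg.derAux θ i) (HAlg.derAux_rel θ i) f (1, 0) = w at *
  subst h
  split_ifs with hij <;> simp [HAlg.derAux, HAlg.mulX, hij]

/-- The subspace of `H` of elements of degree `N`, spanned by the products of `N` generators. -/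
def HAlg.degree (θ : ℤˣ) (I : Type) (N : ℕ) : Submodule ℂ (HAlg θ I) :=
  Submodule.span ℂ (Set.range (HAlg.x θ)) ^ N

/-- The relations of `HD` for families `x_i` and `∂_i` of elements of an algebra. -/
structure IsWeylFamily (θ : ℤˣ) {A : Type*} [Ring A] [Algebra ℂ A] (x d : I → A) : Prop where
  xx : ∀ i j, x i * x j = sgn θ • (x j * x i)
  dd : ∀ i j, d i * d j = sgn θ • (d j * d i)
  dx : ∀ i j, d i * x j = sgn θ • (x j * d i) + if i = j then 1 else 0

/-- The relations between the generators `x_i` (as `Sum.inl i`) and `∂_i` (as `Sum.inr i`). -/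
inductive HDRel (θ : ℤˣ) (I : Type) [DecidableEq I] :
    FreeAlgebra ℂ (I ⊕ I) → FreeAlgebra ℂ (I ⊕ I) → Prop
  | xx (i j : I) : HDRel θ I (FreeAlgebra.ι ℂ (.inl i) * FreeAlgebra.ι ℂ (.inl j))
      (sgn θ • (FreeAlgebra.ι ℂ (.inl j) * FreeAlgebra.ι ℂ (.inl i)))
  | dd (i j : I) : HDRel θ I (FreeAlgebra.ι ℂ (.inr i) * FreeAlgebra.ι ℂ (.inr j))
      (sgn θ • (FreeAlgebra.ι ℂ (.inr j) * FreeAlgebra.ι ℂ (.inr i)))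
  | dx (i j : I) : HDRel θ I (FreeAlgebra.ι ℂ (.inr i) * FreeAlgebra.ι ℂ (.inl j))
      (sgn θ • (FreeAlgebra.ι ℂ (.inl j) * FreeAlgebra.ι ℂ (.inr i)) + if i = j then 1 else 0)

/-- The algebra `HD` generated by `x_i` and `∂_i`, `i ∈ I`, subject to `x_i x_j = θ x_j x_i`,
`∂_i ∂_j = θ ∂_j ∂_i` and `∂_i x_j - θ x_j ∂_i = δ_ij`. -/
def HDAlg (θ : ℤˣ) (I : Type) [DecidableEq I] : Type := RingQuot (HDRel θ I)

instance (θ : ℤˣ) : Ring (HDAlg θ I) := inferInstanceAs (Ring (RingQuot (HDRel θ I)))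
instance (θ : ℤˣ) : Algebra ℂ (HDAlg θ I) :=
  inferInstanceAs (Algebra ℂ (RingQuot (HDRel θ I)))

/-- The quotient map from the free algebra. -/
def HDAlg.mk (θ : ℤˣ) (I : Type) [DecidableEq I] : FreeAlgebra ℂ (I ⊕ I) →ₐ[ℂ] HDAlg θ I :=
  RingQuot.mkAlgHom ℂ (HDRel θ I)

/-- The generator `x_i` of `HD`. -/
def HDAlg.x (θ : ℤˣ) (i : I) : HDAlg θ I :=
  HDAlg.mk θ I (FreeAlgebra.ι ℂ (.inl i))

/-- The generator `∂_i` of `HD`. -/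
def HDAlg.d (θ : ℤˣ) (i : I) : HDAlg θ I :=
  HDAlg.mk θ I (FreeAlgebra.ι ℂ (.inr i))

theorem HDAlg.isWeylFamily (θ : ℤˣ) :
    IsWeylFamily θ (HDAlg.x (I := I) θ) (HDAlg.d (I := I) θ) where
  xx i j := by
    have h : HDAlg.mk θ I _ = HDAlg.mk θ I _ :=
      RingQuot.mkAlgHom_rel ℂ (HDRel.xx (θ := θ) i j)
    simpa only [map_mul, map_smul, HDAlg.x, HDAlg.d] using h
  dd i j := by
    have h : HDAlg.mk θ I _ = HDAlg.mk θ I _ :=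
      RingQuot.mkAlgHom_rel ℂ (HDRel.dd (θ := θ) i j)
    simpa only [map_mul, map_smul, HDAlg.x, HDAlg.d] using h
  dx i j := by
    have h : HDAlg.mk θ I _ = HDAlg.mk θ I _ :=
      RingQuot.mkAlgHom_rel ℂ (HDRel.dx (θ := θ) i j)
    simpa only [map_mul, map_smul, map_add, apply_ite (HDAlg.mk θ I),
      map_one, map_zero, HDAlg.x, HDAlg.d] using h

/-- The universal property of `HD`. -/
def HDAlg.lift {θ : ℤˣ} {A : Type*} [Ring A] [Algebra ℂ A] {x d : I → A}
    (h : IsWeylFamily θ x d) : HDAlg θ I →ₐ[ℂ] A :=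
  RingQuot.liftAlgHom ℂ ⟨FreeAlgebra.lift ℂ (Sum.elim x d), by
    rintro _ _ (⟨i, j⟩ | ⟨i, j⟩ | ⟨i, j⟩)
    · simpa using h.xx i j
    · simpa using h.dd i j
    · simpa [apply_ite (FreeAlgebra.lift ℂ (Sum.elim x d))] using h.dx i j⟩

@[simp] theorem HDAlg.lift_x {θ : ℤˣ} {A : Type*} [Ring A] [Algebra ℂ A] {x d : I → A}
    (h : IsWeylFamily θ x d) (i : I) : HDAlg.lift h (HDAlg.x θ i) = x i := by
  refine (RingQuot.liftAlgHom_mkAlgHom_apply ℂ _ _ _).trans ?_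
  simp

@[simp] theorem HDAlg.lift_d {θ : ℤˣ} {A : Type*} [Ring A] [Algebra ℂ A] {x d : I → A}
    (h : IsWeylFamily θ x d) (i : I) : HDAlg.lift h (HDAlg.d θ i) = d i := by
  refine (RingQuot.liftAlgHom_mkAlgHom_apply ℂ _ _ _).trans ?_
  simp

theorem HAlg.isWeylFamily (θ : ℤˣ) : IsWeylFamily θ (HAlg.mulX (I := I) θ) (HAlg.der θ) where
  xx i j := by
    ext f
    simp only [mulX, Module.End.mul_apply, LinearMap.smul_apply, LinearMap.mulLeft_apply,
      ← mul_assoc, HAlg.x_mul_x θ i j, smul_mul_assoc]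
  dx i j := by
    ext f
    simp only [mulX, Module.End.mul_apply, LinearMap.mulLeft_apply, HAlg.der_x_mul,
      LinearMap.add_apply, LinearMap.smul_apply]
    split_ifs <;> simp [add_comm]
  dd i j := by
    ext f
    simp only [Module.End.mul_apply, LinearMap.smul_apply]
    induction f using HAlg.induction with
    | one => simp [HAlg.der_one]
    | add f g hf hg => simp [hf, hg]
    | smul c f hf => simp only [map_smul, hf, smul_comm c]
    | x_mul k f hf =>
      have s := sgn_mul_self θ
      simp only [HAlg.der_x_mul, map_add, map_smul, hf, smul_add, smul_smul, s, one_smul,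
        apply_ite (HAlg.der θ i), apply_ite (HAlg.der θ j), map_zero, mul_smul_comm,
        smul_ite, smul_zero]
      split_ifs <;> abel

/-- The action of `HD` on `H`: `x_i` acts by left multiplication, `∂_i` as the left derivation. -/
def HDAlg.act (θ : ℤˣ) : HDAlg θ I →ₐ[ℂ] Module.End ℂ (HAlg θ I) :=
  HDAlg.lift (HAlg.isWeylFamily θ)

theorem IsWeylFamily.swap {θ : ℤˣ} {A : Type*} [Ring A] [Algebra ℂ A] {x d : I → A}
    (h : IsWeylFamily θ x d) (P : I → Prop) [DecidablePred P] (s t : ℂ) (hst : s * t = -sgn θ) :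
    IsWeylFamily θ (fun i => if P i then s • d i else x i)
      (fun i => if P i then t • x i else d i) := by
  have e := sgn_mul_self θ
  have xd : ∀ i j, x i * d j = sgn θ • (d j * x i) + -sgn θ • if i = j then 1 else 0 := by
    intro i j
    rw [h.dx j i]
    simp only [smul_add, smul_smul, e, one_smul, eq_comm (a := j), neg_smul, add_neg_cancel_right]
  have hts : t * s = -sgn θ := by rw [mul_comm, hst]
  have ne : ∀ i j, P i → ¬ P j → i ≠ j := fun i j hi hj e => hj (e ▸ hi)
  constructor <;> intro i j <;> by_cases hi : P i <;> by_cases hj : P j <;>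
    simp only [hi, hj, if_true, if_false, smul_mul_assoc, mul_smul_comm, smul_smul]
  · rw [h.dd i j, smul_smul, mul_comm]
  · rw [h.dx i j, if_neg (ne i j hi hj), add_zero, smul_smul, mul_comm]
  · rw [xd i j, if_neg (ne j i hj hi).symm, smul_zero, add_zero, smul_smul, mul_comm]
  · exact h.xx i j
  · rw [h.xx i j, smul_smul, mul_comm]
  · rw [xd i j, if_neg (ne i j hi hj), smul_zero, add_zero, smul_smul, mul_comm]
  · rw [h.dx i j, if_neg (ne j i hj hi).symm, add_zero, smul_smul, mul_comm]
  · exact h.dd i j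
  · rw [hst, hts, xd i j, smul_add, smul_smul, smul_smul]
    simp [e]
  · rw [h.xx i j, if_neg (ne i j hi hj), add_zero, smul_smul, mul_comm]
  · rw [h.dd i j, if_neg (ne j i hj hi).symm, add_zero, smul_smul, mul_comm]
  · exact h.dx i j

theorem IsWeylFamily.map {θ : ℤˣ} {A B : Type*} [Ring A] [Algebra ℂ A] [Ring B] [Algebra ℂ B]
    {x d : I → A} (h : IsWeylFamily θ x d) (f : A →ₐ[ℂ] B) :
    IsWeylFamily θ (fun i => f (x i)) (fun i => f (d i)) where
  xx i j := by rw [← map_mul, h.xx, map_smul, map_mul]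
  dd i j := by rw [← map_mul, h.dd, map_smul, map_mul]
  dx i j := by rw [← map_mul, h.dx, map_add, map_smul, map_mul]; split_ifs <;> simp

section QP

variable {θ : ℤˣ} {A : Type*} [Ring A] [Algebra ℂ A] {q p : I → A}

theorem IsWeylFamily.qp_mul (h : IsWeylFamily θ q p) (α β γ κ : I) :
    q α * p β * (q γ * p κ) = sgn θ • (q γ * p β * (q α * p κ))
      + (if β = γ then q α * p κ else 0) - sgn θ • (if α = β then q γ * p κ else 0) := by
  have e := sgn_mul_self θ
  have h1 : q α * p β * (q γ * p κ) = q α * (p β * q γ) * p κ := by simp only [mul_assoc]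
  have h2 : q γ * p β * (q α * p κ) = q γ * (p β * q α) * p κ := by simp only [mul_assoc]
  have h3 : q α * (q γ * (p β * p κ)) = sgn θ • (q γ * (q α * (p β * p κ))) := by
    rw [← mul_assoc, h.xx α γ, smul_mul_assoc, mul_assoc]
  rw [h1, h2, h.dx β γ, h.dx β α]
  simp only [mul_add, add_mul, mul_smul_comm, smul_mul_assoc, smul_add, smul_smul, e, one_smul,
    mul_ite, ite_mul, mul_one, mul_zero, zero_mul, mul_assoc, h3, eq_comm (a := β) (b := α)]
  abel

theorem IsWeylFamily.qp_mul_rev (h : IsWeylFamily θ q p) (α β γ κ : I) :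
    q γ * p κ * (q α * p β) = sgn θ • (q γ * p β * (q α * p κ))
      + (if κ = α then q γ * p β else 0) - sgn θ • (if α = β then q γ * p κ else 0) := by
  have e := sgn_mul_self θ
  have h1 : q γ * p κ * (q α * p β) = q γ * (p κ * q α) * p β := by simp only [mul_assoc]
  have h2 : q γ * p β * (q α * p κ) = q γ * (p β * q α) * p κ := by simp only [mul_assoc]
  rw [h1, h2, h.dx κ α, h.dx β α]
  simp only [mul_add, add_mul, mul_smul_comm, smul_mul_assoc, smul_add, smul_smul, e, one_smul,
    mul_ite, ite_mul, mul_one, mul_zero, zero_mul, mul_assoc, h.dd κ β,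
    eq_comm (a := β) (b := α)]
  abel

theorem IsWeylFamily.qp_comm (h : IsWeylFamily θ q p) (α β γ κ : I) :
    q α * p β * (q γ * p κ) - q γ * p κ * (q α * p β)
      = (if β = γ then q α * p κ else 0) - (if κ = α then q γ * p β else 0) := by
  rw [h.qp_mul α β γ κ, h.qp_mul_rev α β γ κ]
  abel

end QP

end Weyl


/-! ### The homomorphism from the Yangian to `U(gl_m) ⊗ HD` -/

section GenMatrix

variable {m : ℕ} {A : Type*} [Ring A] [Algebra ℂ A]

/-- The commutation relations of the matrix units of `gl_m`. -/
def IsGlFamily (E : Fin m → Fin m → A) : Prop :=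
  ∀ a b c d, E a b * E c d - E c d * E a b
    = (if b = c then E a d else 0) - (if d = a then E c b else 0)

/-- For a family of matrix units, the matrix `-θ E'`, where `E'` is the transpose of the matrix
with entries `E_ab`. The matrix `X(u) = (u + θ E')⁻¹` is `∑_{r ≥ 0} (-θ E')^r u^(-r-1)`. -/
def genMatrix (θ : ℤˣ) (E : Fin m → Fin m → A) : Matrix (Fin m) (Fin m) A :=
  Matrix.of fun a b => -(sgn θ • E b a)

variable {θ : ℤˣ} {E : Fin m → Fin m → A}

theorem genMatrix_pow_comm (hE : IsGlFamily E) (r : ℕ) (c d a b : Fin m) :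
    E c d * (genMatrix θ E ^ r) a b - (genMatrix θ E ^ r) a b * E c d
      = (if b = d then (genMatrix θ E ^ r) a c else 0)
        - (if a = c then (genMatrix θ E ^ r) d b else 0) := by
  have h1 : ∀ a b, E c d * genMatrix θ E a b - genMatrix θ E a b * E c d
      = (if b = d then genMatrix θ E a c else 0) - (if a = c then genMatrix θ E d b else 0) := by
    intro a b
    have := hE c d b a
    simp only [genMatrix, Matrix.of_apply, mul_neg, neg_mul, mul_smul_comm, smul_mul_assoc]
    rw [sub_neg_eq_add, neg_add_eq_sub, ← smul_sub, ← neg_sub (E c d * E b a), this]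
    simp only [eq_comm (a := d) (b := b)]
    split_ifs
    all_goals simp [smul_sub]
    all_goals abel
  induction r generalizing a b with
  | zero =>
    simp only [pow_zero, Matrix.one_apply, mul_ite, ite_mul, mul_one, one_mul, mul_zero,
      zero_mul, sub_self]
    by_cases h1 : a = c
    · subst h1; simp [eq_comm]
    · by_cases h2 : b = d
      · subst h2; simp [h1]
      · have h3 : ¬ d = b := fun e => h2 e.symm
        simp [h2, h3]
  | succ r ih =>
    have e : ∀ e, E c d * ((genMatrix θ E ^ r) a e * genMatrix θ E e b)
        - (genMatrix θ E ^ r) a e * genMatrix θ E e b * E c d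
        = (E c d * (genMatrix θ E ^ r) a e - (genMatrix θ E ^ r) a e * E c d) * genMatrix θ E e b
          + (genMatrix θ E ^ r) a e * (E c d * genMatrix θ E e b - genMatrix θ E e b * E c d) := by
      intro e
      simp only [mul_sub, sub_mul, mul_assoc]
      abel
    simp only [pow_succ, Matrix.mul_apply, Finset.mul_sum, Finset.sum_mul]
    rw [← Finset.sum_sub_distrib]
    simp only [e, ih, h1, sub_mul, mul_sub, ite_mul, mul_ite, zero_mul, mul_zero,
      Finset.sum_add_distrib, Finset.sum_sub_distrib, Finset.sum_ite_eq',
      Finset.mem_univ, if_true]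
    split_ifs
    all_goals simp
    all_goals abel

theorem genMatrix_pow_rel (hE : IsGlFamily E) (r s : ℕ) (a b c d : Fin m) :
    ((genMatrix θ E ^ (r + 1)) a b * (genMatrix θ E ^ s) c d
        - (genMatrix θ E ^ s) c d * (genMatrix θ E ^ (r + 1)) a b)
      - ((genMatrix θ E ^ r) a b * (genMatrix θ E ^ (s + 1)) c d
        - (genMatrix θ E ^ (s + 1)) c d * (genMatrix θ E ^ r) a b)
      = sgn θ • ((genMatrix θ E ^ r) c b * (genMatrix θ E ^ s) a d
        - (genMatrix θ E ^ s) c b * (genMatrix θ E ^ r) a d) := by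
  have h1 : ∀ s a b c d, genMatrix θ E a b * (genMatrix θ E ^ s) c d
      - (genMatrix θ E ^ s) c d * genMatrix θ E a b
      = sgn θ • ((if b = c then (genMatrix θ E ^ s) a d else 0)
        - (if a = d then (genMatrix θ E ^ s) c b else 0)) := by
    intro s a b c d
    have h : genMatrix θ E a b = -(sgn θ • E b a) := rfl
    rw [h, neg_mul, mul_neg, smul_mul_assoc, mul_smul_comm, sub_neg_eq_add, neg_add_eq_sub,
      ← smul_sub, ← neg_sub (E b a * _), genMatrix_pow_comm hE, neg_sub]
    simp only [eq_comm (a := c), eq_comm (a := d)]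
  induction r generalizing a b c d with
  | zero =>
    have h := h1 s a b c d
    simp only [zero_add, pow_one, pow_zero, Matrix.one_apply]
    rw [h]
    simp only [eq_comm (a := c)]
    split_ifs <;> simp
  | succ r ih =>
    generalize hG : genMatrix θ E = G at *
    have hL : ((G ^ (r + 1 + 1)) a b * (G ^ s) c d - (G ^ s) c d * (G ^ (r + 1 + 1)) a b)
        - ((G ^ (r + 1)) a b * (G ^ (s + 1)) c d - (G ^ (s + 1)) c d * (G ^ (r + 1)) a b)
        = ∑ e, ((((G ^ (r + 1)) a e * (G ^ s) c d - (G ^ s) c d * (G ^ (r + 1)) a e)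
            - ((G ^ r) a e * (G ^ (s + 1)) c d - (G ^ (s + 1)) c d * (G ^ r) a e)) * G e b
          + ((G ^ (r + 1)) a e * (G e b * (G ^ s) c d - (G ^ s) c d * G e b)
            - (G ^ r) a e * (G e b * (G ^ (s + 1)) c d - (G ^ (s + 1)) c d * G e b))) := by
      rw [pow_succ G (r + 1), Matrix.mul_apply]
      nth_rewrite 3 [pow_succ G r]
      nth_rewrite 3 [pow_succ G r]
      rw [Matrix.mul_apply]
      simp only [Finset.sum_mul, Finset.mul_sum, ← Finset.sum_sub_distrib]
      refine Finset.sum_congr rfl fun e _ => ?_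
      simp only [mul_sub, sub_mul, mul_assoc]
      abel
    have hc : ∀ s e a d, (G ^ s) a d * G e b = G e b * (G ^ s) a d
        - sgn θ • ((if b = a then (G ^ s) e d else 0) - (if e = d then (G ^ s) a b else 0)) := by
      intro s e a d
      rw [← h1 s e b a d]; abel
    have hm : ∀ r c d, ∑ e, (G ^ r) c e * G e d = (G ^ (r + 1)) c d := by
      intro r c d
      rw [pow_succ, Matrix.mul_apply]
    have hp : ∀ r s c d, ∑ e, (G ^ r) c e * (G ^ s) e d = (G ^ (r + s)) c d := by
      intro r s c d
      rw [pow_add, Matrix.mul_apply]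
    have hadd : G ^ (s + r) = G ^ (r + s) := by rw [add_comm]
    have hadd2 : G ^ (r + (s + 1)) = G ^ (r + 1 + s) := by congr 1; omega
    have e1 := sgn_mul_self θ
    rw [hL]
    simp only [ih, h1]
    simp only [smul_sub, sub_mul, mul_sub, smul_mul_assoc, mul_smul_comm, mul_assoc, hc,
      mul_ite, mul_zero, Finset.sum_add_distrib, Finset.sum_sub_distrib, ← Finset.smul_sum,
      smul_smul, e1, one_smul, smul_ite, smul_zero, Finset.sum_ite_eq', Finset.mem_univ, if_true,
      Finset.sum_ite_irrel, Finset.sum_const_zero, hp, hadd, hadd2]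
    simp only [← mul_assoc, ← Finset.sum_mul, hm]
    have ih2 := congrArg (fun z => sgn θ • z) (ih a d c b)
    simp only [smul_sub, smul_smul, e1, one_smul] at ih2
    rw [← sub_eq_zero] at ih2 ⊢
    rw [← neg_eq_zero, ← ih2, ← sub_eq_zero]
    split_ifs
    all_goals simp
    all_goals abel


/-- The image of `T_ij(u) = δ_ij + ∑_{a,b} X_ab(u) q_ai p_bj`, coefficient of `u^(-r)`. -/
def bimodT {n : ℕ} (θ : ℤˣ) (E : Fin m → Fin m → A) (q p : Fin m × Fin n → A)
    (i j : Fin n) : ℕ → A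
  | 0 => if i = j then 1 else 0
  | r + 1 => ∑ a, ∑ b, (genMatrix θ E ^ r) a b * (q (a, i) * p (b, j))

theorem commute_genMatrix_pow {z : A} (h : ∀ a b, Commute (E a b) z) (r : ℕ) (a b : Fin m) :
    Commute ((genMatrix θ E ^ r) a b) z := by
  induction r generalizing a b with
  | zero => simp only [pow_zero, Matrix.one_apply]; split_ifs <;> simp
  | succ r ih =>
    rw [pow_succ, Matrix.mul_apply]
    refine Commute.sum_left _ _ _ fun e _ => (ih a e).mul_left ?_
    exact ((h b e).smul_left _).neg_left

theorem bimodT_comm {n : ℕ} (hE : IsGlFamily E) {q p : Fin m × Fin n → A}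
    (h : IsWeylFamily θ q p) (hq : ∀ a b c, Commute (E a b) (q c))
    (hp : ∀ a b c, Commute (E a b) (p c)) (c d : Fin m) (i j : Fin n) (r : ℕ) :
    Commute (E c d + ∑ k, q (c, k) * p (d, k)) (bimodT θ E q p i j r) := by
  cases r with
  | zero => simp only [bimodT]; split_ifs <;> simp
  | succ r =>
    have hx : ∀ r a b α β, Commute ((genMatrix θ E ^ r) a b) (q α * p β) := fun r a b α β =>
      commute_genMatrix_pow (fun a b => (hq a b α).mul_right (hp a b β)) r a b
    have hEx : ∀ a b α β, Commute (E a b) (q α * p β) := fun a b α β =>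
      (hq a b α).mul_right (hp a b β)
    have hqp := h.qp_comm
    simp only [← mul_assoc] at hqp
    generalize hG : genMatrix θ E ^ r = G at *
    have hGE : ∀ c d a b, E c d * G a b - G a b * E c d
      = (if b = d then G a c else 0) - (if a = c then G d b else 0) := by
      intro c d a b; rw [← hG]; exact genMatrix_pow_comm hE r c d a b
    have hxG : ∀ a b α β, Commute (G a b) (q α * p β) := by
      intro a b; rw [← hG]; exact hx r a b
    generalize hF : (fun α β => q α * p β) = F
    have eF : ∀ α β, q α * p β = F α β := fun α β => congrFun (congrFun hF α) β
    simp only [mul_assoc, eF, bimodT, hG] at *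
    have key : ∀ a b, (E c d + ∑ k, F (c, k) (d, k)) * (G a b * F (a, i) (b, j))
        - (G a b * F (a, i) (b, j)) * (E c d + ∑ k, F (c, k) (d, k))
        = (E c d * G a b - G a b * E c d) * F (a, i) (b, j)
          + G a b * ∑ k, (F (c, k) (d, k) * F (a, i) (b, j) - F (a, i) (b, j) * F (c, k) (d, k)) := by
      intro a b
      have h1 : (∑ k, F (c, k) (d, k)) * (G a b * F (a, i) (b, j))
          = G a b * ((∑ k, F (c, k) (d, k)) * F (a, i) (b, j)) := by
        have : Commute (G a b) (∑ k, F (c, k) (d, k)) :=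
          Commute.sum_right _ _ _ fun k _ => hxG a b _ _
        rw [← mul_assoc, ← this.eq, mul_assoc]
      have h2 : F (a, i) (b, j) * E c d = E c d * F (a, i) (b, j) := (hEx c d _ _).eq.symm
      rw [add_mul, mul_add, h1, Finset.sum_sub_distrib, ← Finset.sum_mul, ← Finset.mul_sum,
        mul_assoc (G a b) _ (E c d), h2]
      simp only [mul_sub, sub_mul, mul_assoc]
      abel
    rw [Commute, SemiconjBy, ← sub_eq_zero]
    simp only [Finset.mul_sum, Finset.sum_mul, ← Finset.sum_sub_distrib]
    simp only [key, hGE, hqp, Prod.mk.injEq, ite_and, sub_mul, ite_mul, zero_mul, mul_sub,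
      mul_ite, mul_zero, Finset.sum_sub_distrib, Finset.sum_add_distrib,
      Finset.sum_ite_irrel, Finset.sum_const_zero, Finset.sum_ite_eq, Finset.sum_ite_eq',
      Finset.mem_univ, if_true]
    abel

theorem bimodT_one_comm {n : ℕ} (hE : IsGlFamily E) {q p : Fin m × Fin n → A}
    (h : IsWeylFamily θ q p) (hq : ∀ a b c, Commute (E a b) (q c))
    (hp : ∀ a b c, Commute (E a b) (p c)) (i j k l : Fin n) (s : ℕ) :
    bimodT θ E q p i j 1 * bimodT θ E q p k l s - bimodT θ E q p k l s * bimodT θ E q p i j 1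
      = (if k = j then bimodT θ E q p i l s else 0)
        - (if i = l then bimodT θ E q p k j s else 0) := by
  have h1 : bimodT θ E q p i j 1 = ∑ e, q (e, i) * p (e, j) := by
    simp only [bimodT, pow_zero, Matrix.one_apply, ite_mul, one_mul, zero_mul, Finset.sum_ite_eq,
      Finset.mem_univ, if_true]
  rcases s with _ | s
  · simp only [bimodT]
    split_ifs <;> simp_all
  have hx : ∀ a b α β, Commute ((genMatrix θ E ^ s) a b) (q α * p β) := fun a b α β =>
    commute_genMatrix_pow (fun a b => (hq a b α).mul_right (hp a b β)) s a b
  have hcomm := h.qp_comm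
  have key : ∀ c d, (∑ e, q (e, i) * p (e, j))
        * ((genMatrix θ E ^ s) c d * (q (c, k) * p (d, l)))
      - (genMatrix θ E ^ s) c d * (q (c, k) * p (d, l)) * (∑ e, q (e, i) * p (e, j))
      = (genMatrix θ E ^ s) c d * ∑ e, (q (e, i) * p (e, j) * (q (c, k) * p (d, l))
        - q (c, k) * p (d, l) * (q (e, i) * p (e, j))) := by
    intro c d
    have hc : Commute ((genMatrix θ E ^ s) c d) (∑ e, q (e, i) * p (e, j)) :=
      Commute.sum_right _ _ _ fun e _ => hx c d _ _
    rw [← mul_assoc, ← hc.eq, Finset.sum_sub_distrib, mul_sub, ← Finset.sum_mul,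
      ← Finset.mul_sum, mul_assoc, mul_assoc _ (q (c, k) * p (d, l))]
  rw [h1]
  have h2 : ∀ i j, bimodT θ E q p i j (s + 1)
    = ∑ c, ∑ d, (genMatrix θ E ^ s) c d * (q (c, i) * p (d, j)) := fun _ _ => rfl
  simp only [h2]
  rw [Finset.mul_sum, Finset.sum_mul, ← Finset.sum_sub_distrib]
  simp only [Finset.mul_sum (Finset.univ) _ (∑ e, q (e, i) * p (e, j)),
    Finset.sum_mul (Finset.univ) _ (∑ e, q (e, i) * p (e, j)), ← Finset.sum_sub_distrib, key,
    hcomm]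
  simp only [Prod.mk.injEq, ite_and, Finset.sum_sub_distrib, mul_sub, mul_ite, mul_zero,
    Finset.sum_ite_eq, Finset.sum_ite_eq', Finset.mem_univ, if_true, Finset.sum_ite_irrel,
    Finset.sum_const_zero]
  simp only [eq_comm (a := j) (b := k), eq_comm (a := l) (b := i)]

theorem bimodT_isYangianFamily {n : ℕ} (hE : IsGlFamily E) {q p : Fin m × Fin n → A}
    (h : IsWeylFamily θ q p) (hq : ∀ a b c, Commute (E a b) (q c))
    (hp : ∀ a b c, Commute (E a b) (p c)) : IsYangianFamily (bimodT θ E q p) where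
  zero i j := rfl
  rel := by
    have hx : ∀ r a b α β, (q α * p β) * (genMatrix θ E ^ r) a b
        = (genMatrix θ E ^ r) a b * (q α * p β) := fun r a b α β =>
      (commute_genMatrix_pow (fun a b => (hq a b α).mul_right (hp a b β)) r a b).eq.symm
    have hFF := fun α β γ κ => h.qp_mul α β γ κ
    have hFF2 := fun α β γ κ => h.qp_mul_rev α β γ κ
    have hcomm := h.qp_comm
    have hS := genMatrix_pow_rel (θ := θ) hE
    have h1 : ∀ s (c d a b : Fin m), genMatrix θ E a b * (genMatrix θ E ^ s) c d
      - (genMatrix θ E ^ s) c d * genMatrix θ E a b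
      = sgn θ • ((if b = c then (genMatrix θ E ^ s) a d else 0)
        - (if a = d then (genMatrix θ E ^ s) c b else 0)) := by
      intro s c d a b
      have := hS 0 s a b c d
      simp only [zero_add, pow_one, pow_zero, Matrix.one_apply] at this
      rw [← sub_zero (_ - _)]
      convert this using 2
      · split_ifs <;> simp
      · simp only [eq_comm (a := c)]; split_ifs <;> simp
    generalize hG : genMatrix θ E = G at *
    have hpow : ∀ r s c d, ∑ e, (G ^ r) c e * (G ^ s) e d = (G ^ (r + s)) c d := by
      intro r s c d
      rw [pow_add, Matrix.mul_apply]
    have hT : ∀ (i j : Fin n) r, bimodT θ E q p i j (r + 1)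
        = ∑ a, ∑ b, (G ^ r) a b * (q (a, i) * p (b, j)) := by
      intro i j r; rw [← hG]; rfl
    have swap1 : ∀ f : Fin m → Fin m → Fin m → Fin m → A,
        ∑ a, ∑ b, ∑ c, ∑ d, f a b c d = ∑ c, ∑ d, ∑ a, ∑ b, f a b c d := by
      intro f
      have rot : ∀ g : Fin m → Fin m → Fin m → A,
          ∑ a, ∑ b, ∑ c, g a b c = ∑ b, ∑ c, ∑ a, g a b c := fun g =>
        Finset.sum_comm.trans (Finset.sum_congr rfl fun b _ => Finset.sum_comm)
      exact (Finset.sum_congr rfl fun a _ => rot _).trans (rot _)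
    have swap2 : ∀ f : Fin m → Fin m → Fin m → Fin m → A,
        ∑ a, ∑ b, ∑ c, ∑ d, f a b c d = ∑ c, ∑ b, ∑ a, ∑ d, f a b c d := by
      intro f
      exact Finset.sum_comm.trans
        ((Finset.sum_congr rfl fun b _ => Finset.sum_comm).trans Finset.sum_comm)
    have swap3 : ∀ f : Fin m → Fin m → Fin m → Fin m → A,
        ∑ a, ∑ b, ∑ c, ∑ d, f a b c d = ∑ a, ∑ d, ∑ b, ∑ c, f a b c d := by
      intro f
      exact Finset.sum_congr rfl fun a _ =>
        (Finset.sum_congr rfl fun b _ => Finset.sum_comm).trans Finset.sum_comm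
    have hmul : ∀ (i j k l : Fin n) r s, bimodT θ E q p i j (r + 1) * bimodT θ E q p k l (s + 1)
        = ∑ a, ∑ b, ∑ c, ∑ d, (G ^ r) a b * (G ^ s) c d *
          (q (a, i) * p (b, j) * (q (c, k) * p (d, l))) := by
      intro i j k l r s
      simp only [hT, Finset.sum_mul]
      refine Finset.sum_congr rfl fun a _ => Finset.sum_congr rfl fun b _ => ?_
      simp only [Finset.mul_sum]
      refine Finset.sum_congr rfl fun c _ => Finset.sum_congr rfl fun d _ => ?_
      rw [mul_assoc, ← mul_assoc (q (a, i) * p (b, j)), hx]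
      simp only [mul_assoc]
    have hmul2 : ∀ (i j k l : Fin n) r s,
        bimodT θ E q p k l (s + 1) * bimodT θ E q p i j (r + 1)
        = ∑ a, ∑ b, ∑ c, ∑ d, (G ^ s) c d * (G ^ r) a b *
          (q (c, k) * p (d, l) * (q (a, i) * p (b, j))) := by
      intro i j k l r s
      rw [hmul, swap1]
    have hmul3 : ∀ (i j k l : Fin n) r s,
        bimodT θ E q p k j (r + 1) * bimodT θ E q p i l (s + 1)
        = ∑ a, ∑ b, ∑ c, ∑ d, (G ^ r) c b * (G ^ s) a d *
          (q (c, k) * p (b, j) * (q (a, i) * p (d, l))) := by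
      intro i j k l r s
      rw [hmul, swap2]
    clear hx
    generalize hF : (fun α β => q α * p β) = F at *
    have eF : ∀ α β, q α * p β = F α β := fun α β => congrFun (congrFun hF α) β
    simp only [eF] at *
    have hpt : ∀ (i j k l : Fin n) (r s : ℕ) (a b c d : Fin m),
        ((G ^ (r + 1)) a b * (G ^ s) c d * (F (a, i) (b, j) * F (c, k) (d, l))
          - (G ^ s) c d * (G ^ (r + 1)) a b * (F (c, k) (d, l) * F (a, i) (b, j)))
        - ((G ^ r) a b * (G ^ (s + 1)) c d * (F (a, i) (b, j) * F (c, k) (d, l))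
          - (G ^ (s + 1)) c d * (G ^ r) a b * (F (c, k) (d, l) * F (a, i) (b, j)))
        = ((G ^ r) c b * (G ^ s) a d * (F (c, k) (b, j) * F (a, i) (d, l))
            - (G ^ s) c b * (G ^ r) a d * (F (c, k) (b, j) * F (a, i) (d, l)))
          - ((G ^ r) c b * (G ^ s) a d - (G ^ s) c b * (G ^ r) a d)
              * (if (a, i) = (b, j) then F (c, k) (d, l) else 0)
          + ((G ^ (r + 1)) a b * (G ^ s) c d - (G ^ r) a b * (G ^ (s + 1)) c d)
              * (if (b, j) = (c, k) then F (a, i) (d, l) else 0)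
          - ((G ^ s) c d * (G ^ (r + 1)) a b - (G ^ (s + 1)) c d * (G ^ r) a b)
              * (if (d, l) = (a, i) then F (c, k) (b, j) else 0) := by
      intro i j k l r s a b c d
      have e := sgn_mul_self θ
      have h2 := congrArg (fun z => (sgn θ • z) * (F (c, k) (b, j) * F (a, i) (d, l)
        - (if (a, i) = (b, j) then F (c, k) (d, l) else 0))) (hS r s a b c d)
      simp only [smul_smul, e, one_smul] at h2
      rw [hFF (a, i) (b, j) (c, k) (d, l), hFF2 (a, i) (b, j) (c, k) (d, l),
        ← sub_mul, ← mul_sub, ← h2]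
      simp only [mul_sub, sub_mul, mul_add, smul_sub, smul_mul_assoc, mul_smul_comm]
      abel
    have hw : ∀ (i j k l : Fin n) (r s : ℕ), ∑ a, ∑ b, ∑ c, ∑ d,
        ((G ^ r) c b * (G ^ s) a d - (G ^ s) c b * (G ^ r) a d)
              * (if (a, i) = (b, j) then F (c, k) (d, l) else 0) = 0 := by
      intro i j k l r s
      rw [swap1]
      refine Finset.sum_eq_zero fun c _ => Finset.sum_eq_zero fun d _ => ?_
      simp only [Prod.mk.injEq, ite_and, mul_ite, mul_zero, Finset.sum_ite_eq, Finset.mem_univ,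
        if_true, Finset.sum_ite_irrel, Finset.sum_const_zero, ← Finset.sum_mul,
        Finset.sum_sub_distrib, hpow]
      rw [add_comm s r]
      simp
    have hu : ∀ (i j k l : Fin n) (r s : ℕ), ∑ a, ∑ b, ∑ c, ∑ d,
        ((G ^ (r + 1)) a b * (G ^ s) c d - (G ^ r) a b * (G ^ (s + 1)) c d)
              * (if (b, j) = (c, k) then F (a, i) (d, l) else 0) = 0 := by
      intro i j k l r s
      rw [swap3]
      refine Finset.sum_eq_zero fun a _ => Finset.sum_eq_zero fun d _ => ?_
      simp only [Prod.mk.injEq, ite_and, mul_ite, mul_zero, Finset.sum_ite_eq, Finset.mem_univ,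
        if_true, Finset.sum_ite_irrel, Finset.sum_const_zero, ← Finset.sum_mul,
        Finset.sum_sub_distrib, hpow]
      rw [add_right_comm r 1 s]
      simp [add_assoc]
    have hv : ∀ (i j k l : Fin n) (r s : ℕ), ∑ a, ∑ b, ∑ c, ∑ d,
        ((G ^ s) c d * (G ^ (r + 1)) a b - (G ^ (s + 1)) c d * (G ^ r) a b)
              * (if (d, l) = (a, i) then F (c, k) (b, j) else 0) = 0 := by
      intro i j k l r s
      rw [swap2]
      refine Finset.sum_eq_zero fun c _ => Finset.sum_eq_zero fun b _ => ?_
      simp only [Prod.mk.injEq, ite_and, mul_ite, mul_zero, Finset.sum_ite_eq', Finset.mem_univ,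
        if_true, Finset.sum_ite_irrel, Finset.sum_const_zero, ← Finset.sum_mul,
        Finset.sum_sub_distrib, hpow]
      rw [add_right_comm s 1 r]
      simp [add_assoc]
    have h0 := bimodT_one_comm (θ := θ) hE h hq hp
    intro i j k l r s
    rcases r with _ | r
    · have := h0 i j k l s
      rw [zero_add, this]
      simp only [show ∀ i j, bimodT θ E q p i j 0 = if i = j then 1 else 0 from fun _ _ => rfl]
      simp only [mul_ite, ite_mul, mul_one, one_mul, mul_zero, zero_mul, sub_self, sub_zero]
    rcases s with _ | s
    · have := h0 k l i j (r + 1)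
      rw [zero_add, ← neg_sub (bimodT θ E q p k l 1 * _), this]
      simp only [show ∀ i j, bimodT θ E q p i j 0 = if i = j then 1 else 0 from fun _ _ => rfl]
      simp only [mul_ite, ite_mul, mul_one, one_mul, mul_zero, zero_mul, sub_self, zero_sub,
        neg_sub, eq_comm]
    rw [hmul, hmul2 i j k l (r + 1) s, hmul i j k l r (s + 1), hmul2 i j k l r (s + 1),
      hmul3 i j k l r s, hmul3 i j k l s r]
    simp only [← Finset.sum_sub_distrib, hpt]
    simp only [Finset.sum_sub_distrib, Finset.sum_add_distrib, hw, hu, hv]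
    simp

end GenMatrix

/-- For a Yangian-type evaluation: the coefficients of `T_ij(u) = δ_ij + e_ij / (u - c)`. -/
def evalT {n : ℕ} {A : Type*} [Ring A] [Algebra ℂ A] (c : ℂ) (e : Fin n → Fin n → A)
    (i j : Fin n) : ℕ → A
  | 0 => if i = j then 1 else 0
  | r + 1 => c ^ r • e i j

theorem evalT_isYangianFamily {n : ℕ} {A : Type*} [Ring A] [Algebra ℂ A] (c : ℂ)
    {e : Fin n → Fin n → A} (he : IsGlFamily e) : IsYangianFamily (evalT c e) where
  zero i j := rfl
  rel i j k l r s := by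
    rcases r with _ | r <;> rcases s with _ | s
    · simp only [evalT, pow_zero, one_smul, mul_ite, ite_mul, mul_one, one_mul, mul_zero,
        zero_mul, sub_self, ite_self]
    · have h := congrArg (fun z => c ^ s • z) (he i j k l)
      simp only [smul_sub, smul_ite, smul_zero, eq_comm (a := l), eq_comm (a := j)] at h
      simp only [evalT, pow_zero, one_smul, mul_ite, ite_mul, mul_one, one_mul, mul_zero,
        zero_mul, sub_self, sub_zero, mul_smul_comm, smul_mul_assoc, smul_ite, smul_zero, h]
    · have h := congrArg (fun z => c ^ r • z) (he k l i j)
      simp only [smul_sub, smul_ite, smul_zero, eq_comm (a := l), eq_comm (a := j)] at h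
      simp only [evalT, pow_zero, one_smul, mul_ite, ite_mul, mul_one, one_mul, mul_zero,
        zero_mul, sub_self, zero_sub, mul_smul_comm, smul_mul_assoc, smul_ite, smul_zero]
      rw [← neg_inj, neg_sub, neg_sub, ← h]
      abel
    · have h1 : c ^ (r + 1) * c ^ s = c ^ r * c ^ (s + 1) := by ring
      simp only [evalT, mul_smul_comm, smul_mul_assoc, smul_smul]
      rw [mul_comm (c ^ s) (c ^ (r + 1)), mul_comm (c ^ (s + 1)) (c ^ r), h1, sub_self,
        mul_comm (c ^ s) (c ^ r), sub_self]

/-! ### Modules over `gl_m` -/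

section Gl

attribute [local instance] LieRing.ofAssociativeRing

/-- The universal enveloping algebra of `gl_m`. -/
def Ugl (m : ℕ) : Type := UniversalEnvelopingAlgebra ℂ (Matrix (Fin m) (Fin m) ℂ)

instance (m : ℕ) : Ring (Ugl m) :=
  inferInstanceAs (Ring (UniversalEnvelopingAlgebra ℂ (Matrix (Fin m) (Fin m) ℂ)))
instance (m : ℕ) : Algebra ℂ (Ugl m) :=
  inferInstanceAs (Algebra ℂ (UniversalEnvelopingAlgebra ℂ (Matrix (Fin m) (Fin m) ℂ)))

/-- The matrix unit `E_ab` in `U(gl_m)`. -/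
def Ugl.E {m : ℕ} (a b : Fin m) : Ugl m :=
  UniversalEnvelopingAlgebra.ι ℂ (Matrix.single a b (1 : ℂ))

theorem Ugl.isGlFamily {m : ℕ} : IsGlFamily (Ugl.E (m := m)) := by
  intro a b c d
  have h : ⁅(Matrix.single a b (1 : ℂ)), (Matrix.single c d (1 : ℂ))⁆
      = (if b = c then Matrix.single a d (1 : ℂ) else 0)
        - (if d = a then Matrix.single c b (1 : ℂ) else 0) := by
    rw [Ring.lie_def]
    congr 1
    · split_ifs with h
      · subst h; simp
      · simp [h]
    · split_ifs with h
      · subst h; simp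
      · simp [h]
  have h2 := congrArg (UniversalEnvelopingAlgebra.ι ℂ) h
  rw [LieHom.map_lie, Ring.lie_def, map_sub] at h2
  simp only [Ugl.E]
  refine h2.trans ?_
  simp only [apply_ite (UniversalEnvelopingAlgebra.ι ℂ), map_zero]
  rfl

end Gl

/-- The left ideal of `U(gl_m)` generated by the `E_ab` with `a < b` and the `E_aa - μ_a`. -/
def vermaIdeal {m : ℕ} (μ : Fin m → ℂ) : Submodule (Ugl m) (Ugl m) :=
  Submodule.span (Ugl m) ({z | ∃ a b : Fin m, a < b ∧ z = Ugl.E a b} ∪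
    {z | ∃ a : Fin m, z = Ugl.E a a - algebraMap ℂ (Ugl m) (μ a)})

/-- The Verma module `M_μ` of `gl_m`, with highest weight `μ`. -/
abbrev Verma {m : ℕ} (μ : Fin m → ℂ) : Type := Ugl m ⧸ vermaIdeal μ

/-! ### The functors `E_δ` -/

section Functor

variable (θ : ℤˣ) (p q n : ℕ)

/-- The coordinate `q_ci ∈ HD`: `∂_ci` for `c = 1, …, p` and `x_ci` for `c = p + 1, …, p + q`. -/
def coordQ (c : Fin (p + q) × Fin n) : HDAlg θ (Fin (p + q) × Fin n) :=
  if (c.1 : ℕ) < p then HDAlg.d θ c else HDAlg.x θ c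

/-- The coordinate `p_ci ∈ HD`: `-θ x_ci` for `c = 1, …, p` and `∂_ci` for
`c = p + 1, …, p + q`. -/
def coordP (c : Fin (p + q) × Fin n) : HDAlg θ (Fin (p + q) × Fin n) :=
  if (c.1 : ℕ) < p then -(sgn θ • HDAlg.x θ c) else HDAlg.d θ c

theorem coord_isWeylFamily : IsWeylFamily θ (coordQ θ p q n) (coordP θ p q n) := by
  have h := (HDAlg.isWeylFamily (I := Fin (p + q) × Fin n) θ).swap (fun c => (c.1 : ℕ) < p)
    1 (-sgn θ) (one_mul _)
  simp only [one_smul, neg_smul] at h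
  exact h

/-- The endomorphism `ϖ` of `HD` with `x_ak ↦ -θ ∂_ak` and `∂_ak ↦ x_ak` whenever `δ_a = -1`, and
fixing the `x_ak` and `∂_ak` with `δ_a = 1`. -/
def varpi (δ : Fin (p + q) → ℤˣ) :
    HDAlg θ (Fin (p + q) × Fin n) →ₐ[ℂ] HDAlg θ (Fin (p + q) × Fin n) :=
  HDAlg.lift ((HDAlg.isWeylFamily (I := Fin (p + q) × Fin n) θ).swap (fun c => δ c.1 = -1)
    (-sgn θ) 1 (mul_one _))

/-- The element `ζ_n(E_ab) = θ δ_ab n/2 + ∑_k q_ak p_bk` of `HD`. -/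
def zeta (a b : Fin (p + q)) : HDAlg θ (Fin (p + q) × Fin n) :=
  (if a = b then algebraMap ℂ _ (sgn θ * n / 2) else 0)
    + ∑ k, coordQ θ p q n (a, k) * coordP θ p q n (b, k)

/-- The algebra `U(gl_m) ⊗ HD`, `m = p + q`. -/
abbrev BimodAlg : Type := Ugl (p + q) ⊗[ℂ] HDAlg θ (Fin (p + q) × Fin n)

/-- The element `E_ab ⊗ 1` of `U(gl_m) ⊗ HD`. -/
def leftE (a b : Fin (p + q)) : BimodAlg θ p q n := Ugl.E a b ⊗ₜ[ℂ] 1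

/-- The element `E_ab ⊗ 1 + 1 ⊗ ζ_n(E_ab)` of `U(gl_m) ⊗ HD`. -/
def glElement (a b : Fin (p + q)) : BimodAlg θ p q n :=
  leftE θ p q n a b + 1 ⊗ₜ[ℂ] zeta θ p q n a b

theorem leftE_isGlFamily : IsGlFamily (leftE θ p q n) := by
  intro a b c d
  have h := congrArg (fun z => z ⊗ₜ[ℂ] (1 : HDAlg θ (Fin (p + q) × Fin n)))
    (Ugl.isGlFamily a b c d)
  simp only [leftE, Algebra.TensorProduct.tmul_mul_tmul, mul_one]
  rw [← TensorProduct.sub_tmul, h, TensorProduct.sub_tmul]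
  split_ifs <;> simp

theorem right_isWeylFamily : IsWeylFamily θ
    (fun c => (1 : Ugl (p + q)) ⊗ₜ[ℂ] coordQ θ p q n c)
    (fun c => (1 : Ugl (p + q)) ⊗ₜ[ℂ] coordP θ p q n c) :=
  (coord_isWeylFamily θ p q n).map
    (Algebra.TensorProduct.includeRight (R := ℂ) (A := Ugl (p + q)))

theorem leftE_commute (a b : Fin (p + q)) (y : HDAlg θ (Fin (p + q) × Fin n)) :
    Commute (leftE θ p q n a b) (1 ⊗ₜ[ℂ] y) := by
  simp [leftE, Commute, SemiconjBy]

/-- The homomorphism `α_m : Y(gl_n) → U(gl_m) ⊗ HD`,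
`T_ij(u) ↦ δ_ij + ∑_{a,b} X_ab(u) ⊗ q_ai p_bj`, where `X(u) = (u + θ E')⁻¹`. -/
def alpha : Yangian n →ₐ[ℂ] BimodAlg θ p q n :=
  Yangian.lift (bimodT_isYangianFamily (leftE_isGlFamily θ p q n) (right_isWeylFamily θ p q n)
    (fun a b _ => leftE_commute θ p q n a b _) (fun a b _ => leftE_commute θ p q n a b _))

theorem glElement_eq (a b : Fin (p + q)) : glElement θ p q n a b
    = algebraMap ℂ _ (if a = b then sgn θ * n / 2 else 0) + (leftE θ p q n a b
      + ∑ k, ((1 : Ugl (p + q)) ⊗ₜ[ℂ] coordQ θ p q n (a, k)) * (1 ⊗ₜ[ℂ] coordP θ p q n (b, k))) := by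
  have h : algebraMap ℂ (BimodAlg θ p q n) (if a = b then sgn θ * n / 2 else 0)
      = 1 ⊗ₜ[ℂ] (if a = b then algebraMap ℂ _ (sgn θ * n / 2) else 0) := by
    split_ifs
    · rw [Algebra.TensorProduct.algebraMap_apply, Algebra.algebraMap_eq_smul_one,
        Algebra.algebraMap_eq_smul_one, TensorProduct.smul_tmul]
    · simp
  rw [h]
  simp only [glElement, zeta, Algebra.TensorProduct.tmul_mul_tmul, mul_one, TensorProduct.tmul_add,
    TensorProduct.tmul_sum]
  abel

theorem glElement_commute (a b : Fin (p + q)) (y : Yangian n) :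
    Commute (glElement θ p q n a b) (alpha θ p q n y) := by
  have h := Yangian.mem_of_T
    ((Subalgebra.centralizer ℂ {glElement θ p q n a b}).comap (alpha θ p q n)) (fun i j r => ?_) y
  · exact Subalgebra.mem_centralizer_iff ℂ |>.1 h _ rfl
  · refine Subalgebra.mem_centralizer_iff ℂ |>.2 ?_
    rintro _ rfl
    have e : alpha θ p q n (Yangian.T n i j r) = _ := Yangian.lift_T _ i j r
    change Commute (glElement θ p q n a b) (alpha θ p q n (Yangian.T n i j r))
    rw [e, glElement_eq]
    exact Commute.add_left (Algebra.commutes _ _) (bimodT_comm (leftE_isGlFamily θ p q n)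
      (right_isWeylFamily θ p q n) (fun a b _ => leftE_commute θ p q n a b _)
      (fun a b _ => leftE_commute θ p q n a b _) a b i j r)

theorem glElement_isGlFamily : IsGlFamily (glElement θ p q n) := by
  intro a b c d
  have hE := leftE_isGlFamily θ p q n a b c d
  have hF := fun k l => (coord_isWeylFamily θ p q n).qp_comm (a, k) (b, k) (c, l) (d, l)
  have hz : zeta θ p q n a b * zeta θ p q n c d - zeta θ p q n c d * zeta θ p q n a b
      = (if b = c then zeta θ p q n a d else 0) - (if d = a then zeta θ p q n c b else 0) := by
    have hs : ∀ (s t : ℂ) (x y : HDAlg θ (Fin (p + q) × Fin n)),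
        (algebraMap ℂ _ s + x) * (algebraMap ℂ _ t + y)
          - (algebraMap ℂ _ t + y) * (algebraMap ℂ _ s + x) = x * y - y * x := by
      intro s t x y
      have h1 := Algebra.commutes s y
      have h2 := Algebra.commutes t x
      have h3 := Algebra.commutes s (algebraMap ℂ (HDAlg θ (Fin (p + q) × Fin n)) t)
      rw [mul_add, mul_add, add_mul, add_mul, add_mul, add_mul, h1, h2, h3]
      abel
    have ha : ∀ a b : Fin (p + q), zeta θ p q n a b
        = algebraMap ℂ _ (if a = b then sgn θ * n / 2 else 0)
          + ∑ k, coordQ θ p q n (a, k) * coordP θ p q n (b, k) := by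
      intro a b; rw [zeta]; split_ifs <;> simp
    rw [ha a b, ha c d, hs, Finset.sum_mul_sum, Finset.sum_mul_sum, Finset.sum_comm (s := Finset.univ)
      (f := fun k l => coordQ θ p q n (c, k) * coordP θ p q n (d, k)
        * (coordQ θ p q n (a, l) * coordP θ p q n (b, l)))]
    simp only [← Finset.sum_sub_distrib, hF, Prod.mk.injEq, ite_and]
    simp only [Finset.sum_sub_distrib, Finset.sum_ite_irrel, Finset.sum_ite_eq,
      Finset.sum_ite_eq', Finset.sum_const_zero, Finset.mem_univ, if_true, zeta]
    by_cases h1 : b = c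
    · subst h1
      by_cases h2 : d = a
      · subst h2
        simp only [if_true]
        abel
      · simp only [if_true, if_neg h2, if_neg (Ne.symm h2), zero_add]
    · by_cases h2 : d = a
      · subst h2
        simp only [if_true, if_neg h1, if_neg (Ne.symm h1), zero_add]
      · simp only [if_neg h1, if_neg h2]
  have h2 := congrArg (fun z => (1 : Ugl (p + q)) ⊗ₜ[ℂ] z) hz
  have hr : ∀ y z : HDAlg θ (Fin (p + q) × Fin n), (1 : Ugl (p + q)) ⊗ₜ[ℂ] (y * z)
      = (1 ⊗ₜ[ℂ] y) * (1 ⊗ₜ[ℂ] z) := by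
    intro y z; rw [Algebra.TensorProduct.tmul_mul_tmul, mul_one]
  simp only [TensorProduct.tmul_sub, hr] at h2
  have hc := fun a b y => (leftE_commute θ p q n a b y).eq
  have h3 : glElement θ p q n a b * glElement θ p q n c d
        - glElement θ p q n c d * glElement θ p q n a b
      = (leftE θ p q n a b * leftE θ p q n c d - leftE θ p q n c d * leftE θ p q n a b)
        + ((1 ⊗ₜ[ℂ] zeta θ p q n a b) * (1 ⊗ₜ[ℂ] zeta θ p q n c d)
          - (1 ⊗ₜ[ℂ] zeta θ p q n c d) * (1 ⊗ₜ[ℂ] zeta θ p q n a b)) := by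
    simp only [glElement, mul_add, add_mul, hc]
    abel
  rw [h3, hE, h2]
  simp only [glElement]
  by_cases h4 : b = c <;> by_cases h5 : d = a <;>
    simp only [if_pos, if_neg, h4, h5, not_false_eq_true, TensorProduct.tmul_zero, sub_zero,
      zero_sub, add_zero, add_sub_add_comm, neg_add]

variable (δ : Fin (p + q) → ℤˣ) (V : Type) [AddCommGroup V] [Module ℂ V] [Module (Ugl (p + q)) V]
  [IsScalarTower ℂ (Ugl (p + q)) V]

/-- The action of `U(gl_m) ⊗ HD` on `V ⊗ H`, where the second factor acts through `ϖ`. -/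
def bimodRep : BimodAlg θ p q n →ₐ[ℂ]
    Module.End ℂ (V ⊗[ℂ] HAlg θ (Fin (p + q) × Fin n)) :=
  (Module.endTensorEndAlgHom (R := ℂ) (S := ℂ) (A := ℂ)).comp
    (Algebra.TensorProduct.map (Algebra.lsmul ℂ ℂ V) ((HDAlg.act θ).comp (varpi θ p q n δ)))

/-- The `Y(gl_n)`-module `E_δ(V)`, with underlying space `V ⊗ H`. -/
def functorE : YangianModule n where
  carrier := V ⊗[ℂ] HAlg θ (Fin (p + q) × Fin n)
  action := (bimodRep θ p q n δ V).comp (alpha θ p q n)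

/-- The action of `E_ab ∈ gl_m` on `E_δ(V)`, by `E_ab ⊗ 1 + 1 ⊗ ϖ(ζ_n(E_ab))`. -/
def glAction (a b : Fin (p + q)) : Module.End ℂ (functorE θ p q n δ V) :=
  bimodRep θ p q n δ V (glElement θ p q n a b)

/-- The subspace `𝔫 · E_δ(V)`, where `𝔫` is spanned by the `E_ba` with `a < b`. -/
def nilImage : Submodule ℂ (functorE θ p q n δ V) :=
  ⨆ (a : Fin (p + q)) (b : Fin (p + q)) (_ : a < b), LinearMap.range (glAction θ p q n δ V b a)

theorem nilImage_stable (i j : Fin n) (r : ℕ) : nilImage θ p q n δ V ≤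
    (nilImage θ p q n δ V).comap ((functorE θ p q n δ V).action (Yangian.T n i j r)) := by
  refine iSup_le fun a => iSup_le fun b => iSup_le fun hab => ?_
  rintro _ ⟨v, rfl⟩
  have h := congrArg (bimodRep θ p q n δ V) (glElement_commute θ p q n b a (Yangian.T n i j r)).eq
  rw [map_mul, map_mul] at h
  refine Submodule.mem_iSup_of_mem a (Submodule.mem_iSup_of_mem b (Submodule.mem_iSup_of_mem hab
    ⟨(functorE θ p q n δ V).action (Yangian.T n i j r) v, ?_⟩))
  exact LinearMap.congr_fun h v

theorem nilImage_cartan (c : Fin (p + q)) : nilImage θ p q n δ V ≤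
    (nilImage θ p q n δ V).comap (glAction θ p q n δ V c c) := by
  refine iSup_le fun a => iSup_le fun b => iSup_le fun hab => ?_
  rintro _ ⟨v, rfl⟩
  have h := congrArg (bimodRep θ p q n δ V) (glElement_isGlFamily θ p q n c c b a)
  have hmem : ∀ w, glAction θ p q n δ V b a w ∈ nilImage θ p q n δ V := fun w =>
    Submodule.mem_iSup_of_mem a (Submodule.mem_iSup_of_mem b (Submodule.mem_iSup_of_mem hab
      ⟨w, rfl⟩))
  have h2 : glAction θ p q n δ V c c (glAction θ p q n δ V b a v)
      = glAction θ p q n δ V b a (glAction θ p q n δ V c c v)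
        + ((if c = b then glAction θ p q n δ V b a v else 0)
          - (if a = c then glAction θ p q n δ V b a v else 0)) := by
    rw [← sub_eq_iff_eq_add']
    have := LinearMap.congr_fun h v
    rw [map_sub, map_mul, map_mul, map_sub] at this
    refine this.trans ?_
    refine (LinearMap.sub_apply _ _ _).trans ?_
    congr 1
    · split_ifs with e
      · rw [e]; rfl
      · rw [map_zero]; rfl
    · split_ifs with e
      · rw [e]; rfl
      · rw [map_zero]; rfl
  rw [Submodule.mem_comap, h2]
  refine Submodule.add_mem _ (hmem _) (Submodule.sub_mem _ ?_ ?_) <;> split_ifs <;>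
    first | exact hmem _ | exact Submodule.zero_mem _

/-- The `Y(gl_n)`-module `E_δ(V)_𝔫` of `𝔫`-coinvariants. -/
def coinvariants : YangianModule n :=
  (functorE θ p q n δ V).quot (nilImage θ p q n δ V) (nilImage_stable θ p q n δ V)

/-- The action of `E_cc ∈ 𝔥` on `E_δ(V)_𝔫`. -/
def cartanAction (c : Fin (p + q)) : Module.End ℂ (coinvariants θ p q n δ V) :=
  (nilImage θ p q n δ V).mapQ (nilImage θ p q n δ V) (glAction θ p q n δ V c c)
    (nilImage_cartan θ p q n δ V c)

/-- The subspace of `E_δ(V)_𝔫` of vectors of weight `κ`. -/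
def weightSpace (κ : Fin (p + q) → ℂ) : Submodule ℂ (coinvariants θ p q n δ V) :=
  ⨅ c, Module.End.eigenspace (cartanAction θ p q n δ V c) (κ c)

theorem weightSpace_stable (κ : Fin (p + q) → ℂ) (i j : Fin n) (r : ℕ) :
    weightSpace θ p q n δ V κ ≤ (weightSpace θ p q n δ V κ).comap
      ((coinvariants θ p q n δ V).action (Yangian.T n i j r)) := by
  intro v hv
  simp only [weightSpace, Submodule.mem_comap, Submodule.mem_iInf,
    Module.End.mem_eigenspace_iff] at hv ⊢
  intro c
  rw [← map_smul, ← hv c]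
  obtain ⟨v, rfl⟩ := Submodule.mkQ_surjective _ v
  have h := congrArg (bimodRep θ p q n δ V) (glElement_commute θ p q n c c (Yangian.T n i j r)).eq
  rw [map_mul, map_mul] at h
  exact congrArg (Submodule.mkQ _) (LinearMap.congr_fun h v)

/-- The `Y(gl_n)`-module `E_δ(V)_𝔫^κ`. -/
def weightModule (κ : Fin (p + q) → ℂ) : YangianModule n :=
  (coinvariants θ p q n δ V).sub (weightSpace θ p q n δ V κ) (weightSpace_stable θ p q n δ V κ)

end Functor

/-! ### The modules `Φ_z`, `Φ~_z` and `Ψ_z^{±N}` -/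

section Standard

variable (θ : ℤˣ) (n : ℕ) (z : ℂ)

theorem IsWeylFamily.isGlFamily_dx {θ : ℤˣ} {n : ℕ} {A : Type*} [Ring A] [Algebra ℂ A]
    {x d : Fin n → A} (h : IsWeylFamily θ x d) :
    IsGlFamily (fun i j => -(sgn θ • (d i * x j))) := by
  have h := h.swap (fun _ => True) 1 (-sgn θ) (one_mul _)
  simp only [if_true, one_smul] at h
  intro i j k l
  have e := h.qp_comm i j k l
  simpa only [mul_smul_comm, neg_smul, mul_neg] using e

theorem phi_isGlFamily : IsGlFamily
    (fun i j : Fin n => HAlg.mulX θ i * HAlg.der θ j : Fin n → Fin n → Module.End ℂ _) :=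
  fun i j k l => (HAlg.isWeylFamily (I := Fin n) θ).qp_comm i j k l

theorem phiTilde_isGlFamily : IsGlFamily
    (fun i j : Fin n => -(sgn θ • (HAlg.der θ i * HAlg.mulX θ j)) :
      Fin n → Fin n → Module.End ℂ _) := by
  exact (HAlg.isWeylFamily (I := Fin n) θ).isGlFamily_dx

/-- The `Y(gl_n)`-module `Φ_z`: the space `H(ℂ^n)` with `T_ij(u) ↦ δ_ij + x_i ∂_j / (u + θ z)`. -/
def phi : YangianModule n where
  carrier := HAlg θ (Fin n)
  action := Yangian.lift (evalT_isYangianFamily (-(sgn θ * z)) (phi_isGlFamily θ n))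

/-- The `Y(gl_n)`-module `Φ~_z`: the space `H(ℂ^n)` with
`T_ij(u) ↦ δ_ij - θ ∂_i x_j / (u + θ z)`. -/
def phiTilde : YangianModule n where
  carrier := HAlg θ (Fin n)
  action := Yangian.lift (evalT_isYangianFamily (-(sgn θ * z)) (phiTilde_isGlFamily θ n))

theorem HAlg.x_mul_mem_degree {θ : ℤˣ} {I : Type} (i : I) {N : ℕ} {f : HAlg θ I}
    (hf : f ∈ HAlg.degree θ I N) : HAlg.x θ i * f ∈ HAlg.degree θ I (N + 1) := by
  rw [HAlg.degree, pow_succ']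
  exact Submodule.mul_mem_mul (Submodule.subset_span ⟨i, rfl⟩) hf

theorem HAlg.der_of_degree_zero {θ : ℤˣ} {I : Type} [DecidableEq I] (i : I) {f : HAlg θ I}
    (hf : f ∈ HAlg.degree θ I 0) : HAlg.der θ i f = 0 := by
  rw [HAlg.degree, pow_zero, Submodule.mem_one] at hf
  obtain ⟨c, rfl⟩ := hf
  rw [Algebra.algebraMap_eq_smul_one, map_smul, HAlg.der_one, smul_zero]

theorem HAlg.der_mem_degree {θ : ℤˣ} {I : Type} [DecidableEq I] (i : I) {N : ℕ} {f : HAlg θ I}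
    (hf : f ∈ HAlg.degree θ I (N + 1)) : HAlg.der θ i f ∈ HAlg.degree θ I N := by
  induction N generalizing f with
  | zero =>
    rw [HAlg.degree, zero_add, pow_one] at hf
    induction hf using Submodule.span_induction with
    | mem f hf =>
      obtain ⟨j, rfl⟩ := hf
      have h := HAlg.der_x_mul θ i j 1
      rw [mul_one, HAlg.der_one, mul_zero, smul_zero, add_zero] at h
      rw [h, HAlg.degree, pow_zero]
      split_ifs
      · exact Submodule.one_le.1 le_rfl
      · exact Submodule.zero_mem _
    | zero => rw [map_zero]; exact Submodule.zero_mem _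
    | add f g _ _ hf hg => rw [map_add]; exact Submodule.add_mem _ hf hg
    | smul c f _ hf => rw [map_smul]; exact Submodule.smul_mem _ c hf
  | succ N ih =>
    rw [HAlg.degree, pow_succ'] at hf
    induction hf using Submodule.mul_induction_on' with
    | mem_mul_mem y hy g hg =>
      induction hy using Submodule.span_induction with
      | mem y hy =>
        obtain ⟨j, rfl⟩ := hy
        rw [HAlg.der_x_mul]
        refine Submodule.add_mem _ ?_ (Submodule.smul_mem _ _ (HAlg.x_mul_mem_degree j (ih hg)))
        split_ifs
        · exact hg
        · exact Submodule.zero_mem _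
      | zero => rw [zero_mul, map_zero]; exact Submodule.zero_mem _
      | add f g _ _ hf hg => rw [add_mul, map_add]; exact Submodule.add_mem _ hf hg
      | smul c f _ hf => rw [smul_mul_assoc, map_smul]; exact Submodule.smul_mem _ c hf
    | add f _ g _ hf hg => rw [map_add]; exact Submodule.add_mem _ hf hg

theorem evalT_stable {n : ℕ} {V : Type*} [AddCommGroup V] [Module ℂ V] (c : ℂ)
    {e : Fin n → Fin n → Module.End ℂ V} (S : Submodule ℂ V)
    (h : ∀ i j, ∀ v ∈ S, e i j v ∈ S) (i j : Fin n) (r : ℕ) (v : V) (hv : v ∈ S) :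
    evalT c e i j r v ∈ S := by
  cases r with
  | zero =>
    simp only [evalT]
    split_ifs
    · exact hv
    · exact S.zero_mem
  | succ r => exact S.smul_mem _ (h i j v hv)

theorem phi_stable (N : ℕ) (i j : Fin n) (r : ℕ) : HAlg.degree θ (Fin n) N ≤
    (HAlg.degree θ (Fin n) N).comap ((phi θ n z).action (Yangian.T n i j r)) := by
  intro f hf
  have e : (phi θ n z).action (Yangian.T n i j r) = _ :=
    Yangian.lift_T (evalT_isYangianFamily (-(sgn θ * z)) (phi_isGlFamily θ n)) i j r
  refine (congrArg (fun g => g ∈ HAlg.degree θ (Fin n) N) (LinearMap.congr_fun e f)).mpr ?_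
  refine evalT_stable _ _ (fun i j f hf => ?_) i j r f hf
  cases N with
  | zero =>
    rw [Module.End.mul_apply, HAlg.der_of_degree_zero j hf, map_zero]
    exact Submodule.zero_mem _
  | succ N => exact HAlg.x_mul_mem_degree i (HAlg.der_mem_degree j hf)

theorem phiTilde_stable (N : ℕ) (i j : Fin n) (r : ℕ) : HAlg.degree θ (Fin n) N ≤
    (HAlg.degree θ (Fin n) N).comap ((phiTilde θ n z).action (Yangian.T n i j r)) := by
  intro f hf
  have e : (phiTilde θ n z).action (Yangian.T n i j r) = _ :=
    Yangian.lift_T (evalT_isYangianFamily (-(sgn θ * z)) (phiTilde_isGlFamily θ n)) i j r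
  refine (congrArg (fun g => g ∈ HAlg.degree θ (Fin n) N) (LinearMap.congr_fun e f)).mpr ?_
  refine evalT_stable _ _ (fun i j f hf => ?_) i j r f hf
  exact Submodule.neg_mem _ (Submodule.smul_mem _ _
    (HAlg.der_mem_degree i (HAlg.x_mul_mem_degree j hf)))

/-- The `Y(gl_n)`-module `Ψ_z^{εN}`, where `ε = ±1` and `N ≥ 0`: the submodule of elements of
degree `N` in `Φ_z` if `ε = 1`, and in `Φ~_z` if `ε = -1`. -/
def psi (ε : ℤˣ) (N : ℕ) : YangianModule n :=
  if ε = 1 then (phi θ n z).sub (HAlg.degree θ (Fin n) N) (phi_stable θ n z N)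
  else (phiTilde θ n z).sub (HAlg.degree θ (Fin n) N) (phiTilde_stable θ n z N)

end Standard

/-! ### Weights and signs -/

/-- The weight `ρ = (0, -1, …, 1 - m)`. -/
def rho {m : ℕ} (a : Fin m) : ℂ := -((a : ℕ) : ℂ)

/-- The shifted action `σ ∘ μ = σ(μ + ρ) - ρ`, where `σ(μ)_a = μ_{σ⁻¹(a)}`. -/
def shifted {m : ℕ} (σ : Equiv.Perm (Fin m)) (μ : Fin m → ℂ) (a : Fin m) : ℂ :=
  μ (σ⁻¹ a) + rho (σ⁻¹ a) - rho a

/-- A weight `μ` is generic if `μ_a - μ_b ∉ ℤ` for all `a ≠ b`. -/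
def IsGeneric {m : ℕ} (μ : Fin m → ℂ) : Prop :=
  ∀ a b, a ≠ b → ∀ k : ℤ, μ a - μ b ≠ k

/-- The involution `δ ↦ (δ_1, …, δ_p, -δ_{p+1}, …, -δ_{p+q})`. -/
def barSign {p q : ℕ} (δ : Fin (p + q) → ℤˣ) (a : Fin (p + q)) : ℤˣ :=
  if (a : ℕ) < p then δ a else -δ a

/-- The action of the symmetric group on sequences of signs: the conjugate by `barSign` of the
permutation action `(σ · δ)_a = δ_{σ⁻¹(a)}`. -/
def permSign {p q : ℕ} (σ : Equiv.Perm (Fin (p + q))) (δ : Fin (p + q) → ℤˣ) :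
    Fin (p + q) → ℤˣ :=
  barSign (fun a => barSign δ (σ⁻¹ a))


end RatYangian

end

open RatYangian

/-!
Two observations make the coinvariants of `M_μ ⊗ H` explicit, for every weight `μ` and every
sequence of signs.

The Verma module `M_μ` is free over `U(𝔫)` on its highest weight vector `v`, so that `f ↦ v ⊗ f` is
a bijection from `H` to the coinvariants. Surjectivity holds because `v` generates `M_μ` over `𝔫`
(`Verma.mem_of_lower`). A left inverse comes from a linear map `M_μ → End H` which sends `v` to `1`
and turns the action of `𝔫` on `M_μ` into minus the right multiplication by its action on `H`
(`Verma.exists_linearMap`). Its construction does not need the Poincaré–Birkhoff–Witt theorem: an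
action of `gl_m` on `U(𝔫)` in which `𝔫` acts by left multiplications and `1` is a highest weight
vector of weight `μ` is constructed by induction on words (`TriangularSplitting.induced`), and it
gives a homomorphism `M_μ → U(𝔫)`.

Modulo `𝔫`, the vectors `X_ab(u) v` satisfy a recursion in the power of `u⁻¹`, in which, besides
the column `b` itself, only columns of index below `b` enter the column `b`
(`genMatrix_pow_succ_smul`). Summed against the operators `q_ai p_bj` it shows that `T_ij(u)` acts
on `H` as an entry of the product, in increasing order of `a`, of the matrices with the entries
`δ_ij + q_ai p_aj / (u + θ (μ_a + ρ_a))` (`sum_genMatrix_pow_smul`). After the twist by `ϖ`, the operator `q_ai p_aj` is `x_i ∂_j` or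
`-θ ∂_i x_j` in the row `a`, which is the action on `Φ_z` or `Φ̃_z` with `z = μ_a + ρ_a`.

It remains to see the weight spaces as tensor products. The element `E_aa` acts as the Euler
operator of the row `a` or its negative, up to a constant, so that a weight space is a joint
eigenspace of the Euler operators, and this is the product of the homogeneous components of the
rows (`iInf_eigenspace_euler`). The multiplication identifies the latter with the tensor product of
these components, and as the bilinear operators in one row commute with the variables of the
others, with the tensor product of Yangian modules (`exists_tensorList_embedding`). The statement
for `M_{σ∘μ}` is the instance with the weight `σ∘μ` of `weightModule_isIsomorphic`.
-/

noncomputable section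

namespace RatYangian

/-! ### Triangular decompositions -/

section Triangular

attribute [local instance] LieRing.ofAssociativeRing

variable {R : Type*} [CommRing R] {𝔤 𝔫 : Type*} [LieRing 𝔤] [LieAlgebra R 𝔤] [LieRing 𝔫]
  [LieAlgebra R 𝔫]

/-- A splitting `𝔤 = 𝔫 ⊕ 𝔟` of a Lie algebra into two subalgebras, together with a character of
`𝔟`. The subalgebra `𝔫` is given by the homomorphism `incl` with the retraction `proj`, the
subalgebra `𝔟` is the kernel of `proj`, and the character is the restriction to `𝔟` of the linear
form `char`, whose values outside `𝔟` are irrelevant. -/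
structure TriangularSplitting (R 𝔤 𝔫 : Type*) [CommRing R] [LieRing 𝔤] [LieAlgebra R 𝔤]
    [LieRing 𝔫] [LieAlgebra R 𝔫] where
  incl : 𝔫 →ₗ⁅R⁆ 𝔤
  proj : 𝔤 →ₗ[R] 𝔫
  proj_incl : ∀ y, proj (incl y) = y
  char : 𝔤 →ₗ[R] R
  proj_lie : ∀ e f, proj e = 0 → proj f = 0 → proj ⁅e, f⁆ = 0
  char_lie : ∀ e f, proj e = 0 → proj f = 0 → char ⁅e, f⁆ = 0

namespace TriangularSplitting

variable (S : TriangularSplitting R 𝔤 𝔫)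

/-- The projection of `𝔤` onto `𝔟` along `𝔫`. -/
def borel : 𝔤 →ₗ[R] 𝔤 := LinearMap.id - (S.incl : 𝔫 →ₗ[R] 𝔤) ∘ₗ S.proj

theorem borel_apply (e : 𝔤) : S.borel e = e - S.incl (S.proj e) := rfl

theorem proj_borel (e : 𝔤) : S.proj (S.borel e) = 0 := by
  rw [borel_apply, map_sub, S.proj_incl, sub_self]

theorem borel_borel (e : 𝔤) : S.borel (S.borel e) = S.borel e := by
  rw [borel_apply S (S.borel e), proj_borel, map_zero, sub_zero]

theorem borel_incl (y : 𝔫) : S.borel (S.incl y) = 0 := by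
  rw [borel_apply, S.proj_incl, sub_self]

theorem incl_proj_add_borel (e : 𝔤) : S.incl (S.proj e) + S.borel e = e := by
  rw [borel_apply]; abel

local notation "U" => UniversalEnvelopingAlgebra R 𝔫

/-- The action of `𝔤` on an element `w ∈ U(𝔫)`, when that of `𝔟` is given by `D`. -/
def extend (w : U) (D : 𝔤 →ₗ[R] U) : 𝔤 →ₗ[R] U :=
  LinearMap.mulRight R w ∘ₗ (UniversalEnvelopingAlgebra.ι R : 𝔫 →ₗ⁅R⁆ U) ∘ₗ S.proj
    + D ∘ₗ S.borel

theorem extend_apply (w : U) (D : 𝔤 →ₗ[R] U) (e : 𝔤) :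
    S.extend w D e = UniversalEnvelopingAlgebra.ι R (S.proj e) * w + D (S.borel e) := rfl

theorem extend_incl (w : U) (D : 𝔤 →ₗ[R] U) (y : 𝔫) :
    S.extend w D (S.incl y) = UniversalEnvelopingAlgebra.ι R y * w := by
  rw [extend_apply, S.proj_incl, borel_incl, map_zero, add_zero]

/-- From the action `D` of `𝔟` on `w` to its action `e ↦ y · e w + [e, y] w` on `y w`. -/
def step (y : 𝔫) (w : U) (D : 𝔤 →ₗ[R] U) : 𝔤 →ₗ[R] U :=
  (LinearMap.mulLeft R (UniversalEnvelopingAlgebra.ι R y) ∘ₗ D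
    - S.extend w D ∘ₗ (LieAlgebra.ad R 𝔤 (S.incl y) : 𝔤 →ₗ[R] 𝔤)) ∘ₗ S.borel

theorem step_apply (y : 𝔫) (w : U) (D : 𝔤 →ₗ[R] U) (e : 𝔤) :
    S.step y w D e = UniversalEnvelopingAlgebra.ι R y * D (S.borel e)
      + S.extend w D ⁅S.borel e, S.incl y⁆ := by
  have h : S.step y w D e = UniversalEnvelopingAlgebra.ι R y * D (S.borel e)
      - S.extend w D ⁅S.incl y, S.borel e⁆ := rfl
  rw [h, ← lie_skew, map_neg, sub_neg_eq_add]

/-- The operator `(w, D) ↦ (y w, step y w D)`. -/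
def stepEnd (y : 𝔫) : Module.End R (U × (𝔤 →ₗ[R] U)) where
  toFun v := (UniversalEnvelopingAlgebra.ι R y * v.1, S.step y v.1 v.2)
  map_add' v w := by
    refine Prod.ext (by simp [mul_add]) (LinearMap.ext fun e => ?_)
    simp only [step_apply, extend_apply, LinearMap.add_apply, Prod.snd_add, Prod.fst_add, mul_add]
    abel
  map_smul' c v := by
    refine Prod.ext (by simp) (LinearMap.ext fun e => ?_)
    simp only [step_apply, extend_apply, LinearMap.smul_apply, Prod.smul_snd, Prod.smul_fst,
      mul_smul_comm, smul_add, RingHom.id_apply]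

theorem step_step (y z : 𝔫) (w : U) (D : 𝔤 →ₗ[R] U) (e : 𝔤) :
    S.step ⁅y, z⁆ w D e
      = S.step y (UniversalEnvelopingAlgebra.ι R z * w) (S.step z w D) e
        - S.step z (UniversalEnvelopingAlgebra.ι R y * w) (S.step y w D) e := by
  have hU : ∀ y z : 𝔫, UniversalEnvelopingAlgebra.ι R ⁅y, z⁆ =
      UniversalEnvelopingAlgebra.ι R y * UniversalEnvelopingAlgebra.ι R z
        - UniversalEnvelopingAlgebra.ι R z * UniversalEnvelopingAlgebra.ι R y := fun y z => by
    rw [LieHom.map_lie, Ring.lie_def]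
  -- the action on `y w` of an arbitrary element of `𝔤`
  have h1 : ∀ (y : 𝔫) (g : 𝔤), S.extend (UniversalEnvelopingAlgebra.ι R y * w) (S.step y w D) g
      = UniversalEnvelopingAlgebra.ι R y * S.extend w D g + S.extend w D ⁅g, S.incl y⁆ := by
    intro y g
    have h2 : S.extend w D ⁅g, S.incl y⁆ = UniversalEnvelopingAlgebra.ι R ⁅S.proj g, y⁆ * w
        + S.extend w D ⁅S.borel g, S.incl y⁆ := by
      conv_lhs => rw [← S.incl_proj_add_borel g, add_lie, map_add, ← LieHom.map_lie, extend_incl]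
    rw [extend_apply, step_apply, borel_borel, h2, extend_apply S w D g, hU]
    simp only [mul_add, sub_mul, mul_assoc]
    abel
  have h3 : ⁅S.borel e, S.incl ⁅y, z⁆⁆
      = ⁅⁅S.borel e, S.incl y⁆, S.incl z⁆ - ⁅⁅S.borel e, S.incl z⁆, S.incl y⁆ := by
    rw [LieHom.map_lie, leibniz_lie, ← lie_skew (S.incl y)]
    abel
  simp only [step_apply, borel_borel, h1, h3, map_sub, hU, mul_add, sub_mul, mul_assoc]
  abel

/-- The operators `stepEnd` define an action of `U(𝔫)`. -/
def stepHom : U →ₐ[R] Module.End R (U × (𝔤 →ₗ[R] U)) :=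
  UniversalEnvelopingAlgebra.lift R
    { toFun := S.stepEnd
      map_add' := fun y z => LinearMap.ext fun v => by
        refine Prod.ext (by simp [stepEnd, add_mul]) (LinearMap.ext fun e => ?_)
        simp only [stepEnd, LinearMap.coe_mk, AddHom.coe_mk, step_apply, map_add, add_mul,
          lie_add, LinearMap.add_apply, Prod.snd_add]
        abel
      map_smul' := fun c y => LinearMap.ext fun v => by
        refine Prod.ext (by simp [stepEnd]) (LinearMap.ext fun e => ?_)
        simp only [stepEnd, LinearMap.coe_mk, AddHom.coe_mk, step_apply, map_smul, smul_mul_assoc,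
          lie_smul, LinearMap.smul_apply, Prod.smul_snd, smul_add, RingHom.id_apply]
      map_lie' := fun {y z} => LinearMap.ext fun v => by
        rw [Ring.lie_def]
        refine Prod.ext ?_ (LinearMap.ext fun e => S.step_step y z v.1 v.2 e)
        simp only [stepEnd, LinearMap.coe_mk, AddHom.coe_mk, LinearMap.sub_apply,
          Module.End.mul_apply, Prod.fst_sub, LieHom.map_lie, Ring.lie_def, sub_mul, mul_assoc] }

theorem stepHom_ι (y : 𝔫) : S.stepHom (UniversalEnvelopingAlgebra.ι R y) = S.stepEnd y :=
  UniversalEnvelopingAlgebra.lift_ι_apply R _ y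

/-- The vector of `U(𝔫) × Hom(𝔤, U(𝔫))` that records the element `1` and the action on it by the
character of `𝔟`. -/
def base : U × (𝔤 →ₗ[R] U) := (1, Algebra.linearMap R U ∘ₗ S.char)

/-- Induction on words in `𝔫`. -/
theorem _root_.UniversalEnvelopingAlgebra.induction_ι {P : U → Prop} (one : P 1)
    (add : ∀ f g, P f → P g → P (f + g)) (smul : ∀ (c : R) f, P f → P (c • f))
    (ι_mul : ∀ y f, P f → P (UniversalEnvelopingAlgebra.ι R y * f)) (f : U) : P f := by
  suffices h : ∀ (w : TensorAlgebra R 𝔫) f, P f →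
      P (UniversalEnvelopingAlgebra.mkAlgHom R 𝔫 w * f) by
    obtain ⟨w, rfl⟩ : ∃ w, UniversalEnvelopingAlgebra.mkAlgHom R 𝔫 w = f :=
      RingCon.mk'_surjective _ f
    simpa using h w 1 one
  intro w
  induction w using TensorAlgebra.induction with
  | algebraMap r =>
    intro f hf
    rw [AlgHom.commutes, ← Algebra.smul_def]
    exact smul r f hf
  | ι y => exact fun f hf => ι_mul y f hf
  | mul a b ha hb => intro f hf; rw [map_mul, mul_assoc]; exact ha _ (hb _ hf)
  | add a b ha hb => intro f hf; rw [map_add, add_mul]; exact add _ _ (ha _ hf) (hb _ hf)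

theorem stepHom_fst (w : U) : (S.stepHom w S.base).1 = w := by
  induction w using UniversalEnvelopingAlgebra.induction_ι with
  | one => rw [map_one]; rfl
  | add f g hf hg => rw [map_add, LinearMap.add_apply, Prod.fst_add, hf, hg]
  | smul c f hf => rw [map_smul, LinearMap.smul_apply, Prod.smul_fst, hf]
  | ι_mul y f hf =>
    rw [map_mul, stepHom_ι, Module.End.mul_apply]
    exact congrArg _ hf

/-- The action of an element of `𝔤` on `U(𝔫)`, regarded as the module induced from the character
of `𝔟`. -/
def inducedAct (e : 𝔤) : Module.End R U where
  toFun w := S.extend w (S.stepHom w S.base).2 e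
  map_add' v w := by
    simp only [extend_apply, map_add, LinearMap.add_apply, Prod.snd_add, mul_add]
    abel
  map_smul' c v := by
    simp only [extend_apply, map_smul, LinearMap.smul_apply, Prod.smul_snd, mul_smul_comm,
      smul_add, RingHom.id_apply]

theorem inducedAct_incl (y : 𝔫) (w : U) :
    S.inducedAct (S.incl y) w = UniversalEnvelopingAlgebra.ι R y * w :=
  S.extend_incl _ _ y

theorem inducedAct_one (e : 𝔤) (he : S.proj e = 0) :
    S.inducedAct e 1 = algebraMap R U (S.char e) := by
  have h : S.borel e = e := by rw [borel_apply, he, map_zero, sub_zero]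
  change S.extend 1 (S.stepHom 1 S.base).2 e = _
  rw [extend_apply, he, map_zero, zero_mul, zero_add, map_one, h]
  rfl

theorem inducedAct_ι_mul (e : 𝔤) (y : 𝔫) (w : U) :
    S.inducedAct e (UniversalEnvelopingAlgebra.ι R y * w)
      = UniversalEnvelopingAlgebra.ι R y * S.inducedAct e w
        + S.inducedAct ⁅e, S.incl y⁆ w := by
  have h1 : ∀ e, S.inducedAct (S.borel e) (UniversalEnvelopingAlgebra.ι R y * w)
      = UniversalEnvelopingAlgebra.ι R y * S.inducedAct (S.borel e) w
        + S.inducedAct ⁅S.borel e, S.incl y⁆ w := by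
    intro e
    have h2 : S.inducedAct (S.borel e) (UniversalEnvelopingAlgebra.ι R y * w)
        = S.extend (UniversalEnvelopingAlgebra.ι R y * w)
          (S.stepEnd y (S.stepHom w S.base)).2 (S.borel e) := by
      rw [← stepHom_ι, ← Module.End.mul_apply, ← map_mul]; rfl
    have h3 : S.inducedAct (S.borel e) w = (S.stepHom w S.base).2 (S.borel e) := by
      refine (S.extend_apply _ _ _).trans ?_
      rw [proj_borel, map_zero, zero_mul, zero_add, borel_borel]
    rw [h2, h3, extend_apply, proj_borel, map_zero, zero_mul, zero_add, borel_borel]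
    refine (S.step_apply _ _ _ _).trans ?_
    rw [borel_borel, stepHom_fst]
    rfl
  have hadd : ∀ (e f : 𝔤) w, S.inducedAct (e + f) w = S.inducedAct e w + S.inducedAct f w :=
    fun e f w => map_add (S.extend w (S.stepHom w S.base).2) e f
  rw [← S.incl_proj_add_borel e, hadd, hadd, h1, add_lie, hadd, inducedAct_incl,
    inducedAct_incl, ← LieHom.map_lie, inducedAct_incl, LieHom.map_lie, Ring.lie_def]
  simp only [mul_add, sub_mul, mul_assoc]
  abel

/-- The action of `𝔤` on `U(𝔫)`, regarded as the module induced from the character of `𝔟`. -/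
def induced : 𝔤 →ₗ⁅R⁆ Module.End R U where
  toFun := S.inducedAct
  map_add' e f := LinearMap.ext fun w => map_add (S.extend w (S.stepHom w S.base).2) e f
  map_smul' c e := LinearMap.ext fun w => map_smul (S.extend w (S.stepHom w S.base).2) c e
  map_lie' := by
    intro e f
    have hadd : ∀ (e f : 𝔤) w, S.inducedAct (e + f) w = S.inducedAct e w + S.inducedAct f w :=
      fun e f w => map_add (S.extend w (S.stepHom w S.base).2) e f
    rw [Ring.lie_def]
    refine LinearMap.ext fun w => ?_
    rw [LinearMap.sub_apply, Module.End.mul_apply, Module.End.mul_apply]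
    change S.inducedAct ⁅e, f⁆ w
      = S.inducedAct e (S.inducedAct f w) - S.inducedAct f (S.inducedAct e w)
    induction w using UniversalEnvelopingAlgebra.induction_ι generalizing e f with
    | one =>
      have hl : ∀ (y : 𝔫) (e : 𝔤), S.inducedAct e (S.inducedAct (S.incl y) 1)
          = S.inducedAct (S.incl y) (S.inducedAct e 1) + S.inducedAct ⁅e, S.incl y⁆ 1 := by
        intro y e
        rw [inducedAct_incl, inducedAct_incl, inducedAct_ι_mul]
      have hb : ∀ e f : 𝔤, S.inducedAct ⁅S.borel e, S.borel f⁆ 1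
          = S.inducedAct (S.borel e) (S.inducedAct (S.borel f) 1)
            - S.inducedAct (S.borel f) (S.inducedAct (S.borel e) 1) := by
        intro e f
        have he := S.proj_borel e
        have hf := S.proj_borel f
        rw [inducedAct_one S _ (S.proj_lie _ _ he hf), S.char_lie _ _ he hf, map_zero,
          inducedAct_one S _ he, inducedAct_one S _ hf, Algebra.algebraMap_eq_smul_one,
          Algebra.algebraMap_eq_smul_one, map_smul, map_smul,
          inducedAct_one S _ he, inducedAct_one S _ hf, Algebra.algebraMap_eq_smul_one,
          Algebra.algebraMap_eq_smul_one, smul_smul, smul_smul, mul_comm, sub_self]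
      have hn : ∀ e : 𝔤, S.inducedAct (-e) 1 = -S.inducedAct e 1 :=
        fun e => map_neg (S.extend 1 (S.stepHom 1 S.base).2) e
      rw [← S.incl_proj_add_borel e, ← S.incl_proj_add_borel f]
      simp only [add_lie, lie_add, hadd, map_add, hb]
      rw [hl (S.proj f) (S.incl (S.proj e)), hl (S.proj f) (S.borel e),
        hl (S.proj e) (S.borel f), ← lie_skew (S.incl (S.proj e)) (S.borel f), hn]
      abel
    | add v w hv hw => rw [map_add, map_add, map_add, map_add, map_add, hv, hw]; abel
    | smul c w hw => rw [map_smul, map_smul, map_smul, map_smul, map_smul, hw, smul_sub]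
    | ι_mul y w hw =>
      have hjac : ⁅⁅e, f⁆, S.incl y⁆ = ⁅e, ⁅f, S.incl y⁆⁆ + -⁅f, ⁅e, S.incl y⁆⁆ := by
        rw [lie_lie]; abel
      have hn : ∀ e : 𝔤, S.inducedAct (-e) w = -S.inducedAct e w :=
        fun e => map_neg (S.extend w (S.stepHom w S.base).2) e
      simp only [inducedAct_ι_mul, map_add, hjac, hadd, hn, hw, mul_sub]
      abel

end TriangularSplitting

end Triangular

/-! ### Verma modules are free over the lower triangular matrices -/

section VermaFree

attribute [local instance] LieRing.ofAssociativeRing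

variable {m : ℕ}

/-- The Lie algebra of strictly lower triangular matrices. -/
def lowerNil (m : ℕ) : LieSubalgebra ℂ (Matrix (Fin m) (Fin m) ℂ) where
  carrier := {M | ∀ a b, a ≤ b → M a b = 0}
  add_mem' hM hN a b h := by rw [Matrix.add_apply, hM a b h, hN a b h, add_zero]
  zero_mem' _ _ _ := rfl
  smul_mem' c M hM a b h := by rw [Matrix.smul_apply, hM a b h, smul_zero]
  lie_mem' {M N} hM hN a b h := by
    have key : ∀ M N : Matrix (Fin m) (Fin m) ℂ, (∀ a b, a ≤ b → M a b = 0) →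
        (∀ a b, a ≤ b → N a b = 0) → (M * N) a b = 0 := by
      intro M N hM hN
      rw [Matrix.mul_apply]
      refine Finset.sum_eq_zero fun c _ => ?_
      rcases le_total a c with hc | hc
      · rw [hM a c hc, zero_mul]
      · rw [hN c b (hc.trans h), mul_zero]
    rw [Ring.lie_def, Matrix.sub_apply, key M N hM hN, key N M hN hM, sub_zero]

/-- The strictly lower triangular part of a matrix. -/
def lowerPart (m : ℕ) : Matrix (Fin m) (Fin m) ℂ →ₗ[ℂ] lowerNil m where
  toFun M := ⟨Matrix.of fun a b => if b < a then M a b else 0, fun a b h => if_neg h.not_gt⟩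
  map_add' M N := Subtype.ext <| by ext a b; simp [ite_add_ite]
  map_smul' c M := Subtype.ext <| by ext a b; simp

theorem lowerPart_eq_zero_iff (M : Matrix (Fin m) (Fin m) ℂ) :
    lowerPart m M = 0 ↔ ∀ a b, b < a → M a b = 0 := by
  constructor
  · intro h a b hab
    have := congrFun (congrFun (congrArg Subtype.val h) a) b
    simpa [lowerPart, hab] using this
  · intro h
    refine Subtype.ext ?_
    ext a b
    simp only [lowerPart, LinearMap.coe_mk, AddHom.coe_mk, Matrix.of_apply]
    split_ifs with hab
    · exact h a b hab
    · rfl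

/-- The linear form on matrices whose restriction to the diagonal ones is the weight `μ`. -/
def weightForm (μ : Fin m → ℂ) : Matrix (Fin m) (Fin m) ℂ →ₗ[ℂ] ℂ where
  toFun M := ∑ a, μ a * M a a
  map_add' M N := by simp only [Matrix.add_apply, mul_add, Finset.sum_add_distrib]
  map_smul' c M := by
    simp only [Matrix.smul_apply, smul_eq_mul, mul_left_comm, Finset.mul_sum, RingHom.id_apply]

theorem weightForm_apply (μ : Fin m → ℂ) (M : Matrix (Fin m) (Fin m) ℂ) :
    weightForm μ M = ∑ a, μ a * M a a := rfl

/-- The decomposition of `gl_m` into strictly lower and upper triangular matrices, with the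
character of the latter given by the weight `μ`. -/
def glSplitting (μ : Fin m → ℂ) :
    TriangularSplitting ℂ (Matrix (Fin m) (Fin m) ℂ) (lowerNil m) where
  incl := (lowerNil m).incl
  proj := lowerPart m
  proj_incl y := Subtype.ext <| by
    ext a b
    simp only [lowerPart, LinearMap.coe_mk, AddHom.coe_mk, Matrix.of_apply]
    split_ifs with hab
    · rfl
    · exact (y.2 a b (not_lt.1 hab)).symm
  char := weightForm μ
  proj_lie e f he hf := by
    rw [lowerPart_eq_zero_iff] at *
    have key : ∀ M N : Matrix (Fin m) (Fin m) ℂ, (∀ a b, b < a → M a b = 0) →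
        (∀ a b, b < a → N a b = 0) → ∀ a b, b < a → (M * N) a b = 0 := by
      intro M N hM hN a b h
      rw [Matrix.mul_apply]
      refine Finset.sum_eq_zero fun c _ => ?_
      rcases lt_or_ge c a with hc | hc
      · rw [hM a c hc, zero_mul]
      · rw [hN c b (h.trans_le hc), mul_zero]
    intro a b h
    rw [Ring.lie_def, Matrix.sub_apply, key e f he hf a b h, key f e hf he a b h, sub_zero]
  char_lie e f he hf := by
    rw [lowerPart_eq_zero_iff] at *
    have key : ∀ M N : Matrix (Fin m) (Fin m) ℂ, (∀ a b, b < a → M a b = 0) →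
        (∀ a b, b < a → N a b = 0) → ∀ a, (M * N) a a = M a a * N a a := by
      intro M N hM hN a
      rw [Matrix.mul_apply]
      refine Finset.sum_eq_single_of_mem a (Finset.mem_univ a) fun c _ hca => ?_
      rcases lt_or_gt_of_ne hca with hc | hc
      · rw [hM a c hc, zero_mul]
      · rw [hN c a hc, mul_zero]
    rw [weightForm_apply]
    refine Finset.sum_eq_zero fun a _ => ?_
    rw [Ring.lie_def, Matrix.sub_apply, key e f he hf a, key f e hf he a, mul_comm (f a a),
      sub_self, mul_zero]

theorem weightForm_single (μ : Fin m → ℂ) (a : Fin m) :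
    weightForm μ (Matrix.single a a 1) = μ a := by
  simp [weightForm_apply, Matrix.single_apply]

theorem weightForm_single_ne (μ : Fin m → ℂ) {a b : Fin m} (hab : a ≠ b) :
    weightForm μ (Matrix.single a b 1) = 0 := by
  rw [weightForm_apply]
  refine Finset.sum_eq_zero fun c _ => ?_
  rw [Matrix.single_apply, if_neg (fun h => hab (h.1.trans h.2.symm)), mul_zero]

theorem lowerPart_single_of_le {a b : Fin m} (hab : a ≤ b) :
    lowerPart m (Matrix.single a b 1) = 0 := by
  rw [lowerPart_eq_zero_iff]
  intro c d hcd
  rw [Matrix.single_apply, if_neg]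
  rintro ⟨rfl, rfl⟩
  exact hcd.not_ge hab

/-- The matrix unit `E_ba` with `a < b`, as an element of the lower triangular subalgebra. -/
def lowerUnit {a b : Fin m} (hab : a < b) : lowerNil m :=
  ⟨Matrix.single b a 1, fun c d hcd => by
    rw [Matrix.single_apply, if_neg]
    rintro ⟨rfl, rfl⟩
    exact hcd.not_gt hab⟩

/-- The action of `U(gl_m)` on `U(𝔫)`. -/
def inducedRep (μ : Fin m → ℂ) :
    Ugl m →ₐ[ℂ] Module.End ℂ (UniversalEnvelopingAlgebra ℂ (lowerNil m)) :=
  UniversalEnvelopingAlgebra.lift ℂ (glSplitting μ).induced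

theorem inducedRep_E (μ : Fin m → ℂ) (a b : Fin m) :
    inducedRep μ (Ugl.E a b) = (glSplitting μ).inducedAct (Matrix.single a b 1) :=
  UniversalEnvelopingAlgebra.lift_ι_apply ℂ _ _

theorem inducedRep_one_of_mem (μ : Fin m → ℂ) {z : Ugl m} (hz : z ∈ vermaIdeal μ) :
    inducedRep μ z 1 = 0 := by
  induction hz using Submodule.span_induction with
  | mem z hz =>
    rcases hz with ⟨a, b, hab, rfl⟩ | ⟨a, rfl⟩
    · rw [inducedRep_E, TriangularSplitting.inducedAct_one _ _ (lowerPart_single_of_le hab.le),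
        show (glSplitting μ).char _ = 0 from weightForm_single_ne μ hab.ne, map_zero]
    · rw [map_sub, LinearMap.sub_apply, inducedRep_E,
        TriangularSplitting.inducedAct_one _ _ (lowerPart_single_of_le le_rfl),
        show (glSplitting μ).char _ = μ a from weightForm_single μ a, AlgHom.commutes,
        Module.algebraMap_end_apply, Algebra.algebraMap_eq_smul_one, sub_self]
  | zero => rw [map_zero, LinearMap.zero_apply]
  | add y z _ _ hy hz => rw [map_add, LinearMap.add_apply, hy, hz, add_zero]
  | smul u z _ hz => rw [smul_eq_mul, map_mul, Module.End.mul_apply, hz, map_zero]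

/-- The homomorphism of `gl_m`-modules `M_μ → U(𝔫)`. -/
def vermaToU (μ : Fin m → ℂ) : Verma μ →ₗ[ℂ] UniversalEnvelopingAlgebra ℂ (lowerNil m) :=
  ((vermaIdeal μ).restrictScalars ℂ).liftQ
    ((LinearMap.applyₗ (R := ℂ) (1 : UniversalEnvelopingAlgebra ℂ (lowerNil m))) ∘ₗ
      (inducedRep μ).toLinearMap) (fun _ hz => inducedRep_one_of_mem μ hz) ∘ₗ
  (Submodule.Quotient.restrictScalarsEquiv ℂ (vermaIdeal μ)).symm.toLinearMap

theorem vermaToU_mk (μ : Fin m → ℂ) (u : Ugl m) :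
    vermaToU μ (Submodule.Quotient.mk u) = inducedRep μ u 1 := rfl

theorem vermaToU_smul (μ : Fin m → ℂ) (u : Ugl m) (x : Verma μ) :
    vermaToU μ (u • x) = inducedRep μ u (vermaToU μ x) := by
  obtain ⟨z, rfl⟩ := Submodule.Quotient.mk_surjective _ x
  rw [← Submodule.Quotient.mk_smul, vermaToU_mk, vermaToU_mk, smul_eq_mul, map_mul,
    Module.End.mul_apply]

variable {A : Type*} [Ring A] [Algebra ℂ A]

/-- The homomorphism from `gl_m` given by the images `Z_ab` of the matrix units. -/
def IsGlFamily.lieHom {Z : Fin m → Fin m → A} (hZ : IsGlFamily Z) :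
    Matrix (Fin m) (Fin m) ℂ →ₗ⁅ℂ⁆ A where
  toFun M := ∑ a, ∑ b, M a b • Z a b
  map_add' M N := by simp only [Matrix.add_apply, add_smul, Finset.sum_add_distrib]
  map_smul' c M := by
    simp only [Matrix.smul_apply, smul_assoc, Finset.smul_sum, RingHom.id_apply]
  map_lie' {M N} := by
    have h1 : ∀ M N : Matrix (Fin m) (Fin m) ℂ,
        (∑ a, ∑ b, M a b • Z a b) * (∑ c, ∑ d, N c d • Z c d)
          = ∑ a, ∑ b, ∑ c, ∑ d, (M a b * N c d) • (Z a b * Z c d) := by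
      intro M N
      simp only [Finset.sum_mul]
      simp only [Finset.mul_sum, smul_mul_smul_comm]
    have h2 : ∀ f : Fin m → Fin m → Fin m → Fin m → A,
        ∑ c, ∑ d, ∑ a, ∑ b, f a b c d = ∑ a, ∑ b, ∑ c, ∑ d, f a b c d := by
      intro f
      have rot : ∀ g : Fin m → Fin m → Fin m → A,
          ∑ a, ∑ b, ∑ c, g a b c = ∑ b, ∑ c, ∑ a, g a b c := fun g =>
        Finset.sum_comm.trans (Finset.sum_congr rfl fun b _ => Finset.sum_comm)
      exact ((Finset.sum_congr rfl fun a _ => rot _).trans (rot _)).symm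
    rw [Ring.lie_def, Ring.lie_def]
    change ∑ a, ∑ b, (M * N - N * M) a b • Z a b
      = (∑ a, ∑ b, M a b • Z a b) * (∑ c, ∑ d, N c d • Z c d)
        - (∑ c, ∑ d, N c d • Z c d) * (∑ a, ∑ b, M a b • Z a b)
    rw [h1 M N, h1 N M, h2 (fun a b c d => (N c d * M a b) • (Z c d * Z a b))]
    simp only [← Finset.sum_sub_distrib]
    have h3 : ∀ a b c d, (M a b * N c d) • (Z a b * Z c d) - (N c d * M a b) • (Z c d * Z a b)
        = (if b = c then (M a b * N c d) • Z a d else 0)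
          - (if d = a then (M a b * N c d) • Z c b else 0) := by
      intro a b c d
      rw [mul_comm (N c d), ← smul_sub, hZ a b c d, smul_sub, smul_ite, smul_ite, smul_zero]
    simp only [h3, Finset.sum_sub_distrib, Matrix.sub_apply, sub_smul, Matrix.mul_apply,
      Finset.sum_smul, Finset.sum_ite_irrel, Finset.sum_ite_eq, Finset.sum_ite_eq',
      Finset.sum_const_zero, Finset.mem_univ, if_true]
    congr 1
    · exact Finset.sum_congr rfl fun a _ => Finset.sum_comm
    · rw [Finset.sum_comm]
      refine (Finset.sum_congr rfl fun b _ => Finset.sum_comm).trans ?_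
      rw [Finset.sum_comm]
      exact Finset.sum_congr rfl fun c _ => Finset.sum_congr rfl fun b _ =>
        Finset.sum_congr rfl fun a _ => by rw [mul_comm]

theorem IsGlFamily.lieHom_single {Z : Fin m → Fin m → A} (hZ : IsGlFamily Z) (a b : Fin m) :
    hZ.lieHom (Matrix.single a b 1) = Z a b := by
  change ∑ c, ∑ d, (Matrix.single a b (1 : ℂ)) c d • Z c d = Z a b
  simp [Matrix.single_apply, ite_and]

/-- The representation of `U(𝔫)` by right multiplications by the elements `-Z_ba`. -/
def IsGlFamily.opHom {Z : Fin m → Fin m → A} (hZ : IsGlFamily Z) :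
    UniversalEnvelopingAlgebra ℂ (lowerNil m) →ₐ[ℂ] Aᵐᵒᵖ :=
  UniversalEnvelopingAlgebra.lift ℂ
    { toFun := fun y => MulOpposite.op (-hZ.lieHom y)
      map_add' := fun y z => by
        rw [show ((y + z : lowerNil m) : Matrix (Fin m) (Fin m) ℂ) = y + z from rfl,
          map_add, neg_add, MulOpposite.op_add]
      map_smul' := fun c y => by
        rw [show ((c • y : lowerNil m) : Matrix (Fin m) (Fin m) ℂ) = c • y from rfl,
          map_smul, ← smul_neg, MulOpposite.op_smul, RingHom.id_apply]
      map_lie' := fun {y z} => by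
        rw [LieSubalgebra.coe_bracket, LieHom.map_lie, Ring.lie_def, Ring.lie_def,
          ← MulOpposite.op_mul, ← MulOpposite.op_mul, ← MulOpposite.op_sub, neg_mul_neg,
          neg_mul_neg, neg_sub] }

/-- The Verma module is free over `U(𝔫)`: a linear map out of it that turns the action of `𝔫` into
right multiplications can be prescribed on the highest weight vector. -/
theorem Verma.exists_linearMap {Z : Fin m → Fin m → A} (hZ : IsGlFamily Z) (μ : Fin m → ℂ) :
    ∃ Ψ : Verma μ →ₗ[ℂ] A, Ψ (Submodule.Quotient.mk 1) = 1 ∧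
      ∀ a b, a < b → ∀ x, Ψ (Ugl.E b a • x) = -(Ψ x * Z b a) := by
  refine ⟨(MulOpposite.opLinearEquiv ℂ).symm.toLinearMap ∘ₗ hZ.opHom.toLinearMap ∘ₗ vermaToU μ,
    ?_, fun a b hab x => ?_⟩
  · simp only [LinearMap.comp_apply, vermaToU_mk, map_one, AlgHom.toLinearMap_apply,
      Module.End.one_apply]
    rfl
  · have h1 : (glSplitting μ).inducedAct (Matrix.single b a 1) (vermaToU μ x)
        = UniversalEnvelopingAlgebra.ι ℂ (lowerUnit hab) * vermaToU μ x :=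
      (glSplitting μ).inducedAct_incl (lowerUnit hab) _
    have h2 : hZ.opHom (UniversalEnvelopingAlgebra.ι ℂ (lowerUnit hab))
        = MulOpposite.op (-Z b a) := by
      refine (UniversalEnvelopingAlgebra.lift_ι_apply ℂ _ _).trans ?_
      exact congrArg (fun z => MulOpposite.op (-z)) (hZ.lieHom_single b a)
    simp only [LinearMap.comp_apply, vermaToU_smul, inducedRep_E, h1, AlgHom.toLinearMap_apply,
      map_mul, h2]
    exact mul_neg _ _

theorem Ugl.mem_of_E (P : Submodule ℂ (Ugl m)) (one : 1 ∈ P)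
    (E_mul : ∀ a b, ∀ u ∈ P, Ugl.E a b * u ∈ P) (u : Ugl m) : u ∈ P := by
  have key : ∀ (M : Matrix (Fin m) (Fin m) ℂ) (z f : Ugl m),
      z = UniversalEnvelopingAlgebra.ι ℂ M → f ∈ P → z * f ∈ P := by
    intro M z f hz hf
    have h : z = ∑ a, ∑ b, M a b • Ugl.E a b := by
      rw [hz]
      conv_lhs => rw [Matrix.matrix_eq_sum_single M]
      refine (map_sum (UniversalEnvelopingAlgebra.ι ℂ) _ _).trans ?_
      refine Finset.sum_congr rfl fun a _ => ?_
      refine (map_sum (UniversalEnvelopingAlgebra.ι ℂ) _ _).trans ?_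
      refine Finset.sum_congr rfl fun b _ => ?_
      rw [show Matrix.single a b (M a b) = M a b • Matrix.single a b (1 : ℂ) by simp]
      exact map_smul (UniversalEnvelopingAlgebra.ι ℂ) _ _
    rw [h, Finset.sum_mul]
    refine P.sum_mem fun a _ => ?_
    rw [Finset.sum_mul]
    refine P.sum_mem fun b _ => ?_
    rw [smul_mul_assoc]
    exact P.smul_mem _ (E_mul a b f hf)
  exact UniversalEnvelopingAlgebra.induction_ι (P := fun u : Ugl m => u ∈ P) one
    (fun f g => P.add_mem) (fun c f => P.smul_mem c) (fun M f hf => key M _ f rfl hf) u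

theorem Ugl.E_smul_E_smul {V : Type*} [AddCommGroup V] [Module (Ugl m) V] (a b c d : Fin m)
    (x : V) : Ugl.E c d • Ugl.E b a • x = Ugl.E b a • Ugl.E c d • x
      + ((if d = b then Ugl.E c a • x else 0) - (if a = c then Ugl.E b d • x else 0)) := by
  have h := Ugl.isGlFamily (m := m) c d b a
  rw [sub_eq_iff_eq_add'] at h
  rw [← mul_smul, h, add_smul, sub_smul, mul_smul, ite_smul, ite_smul, zero_smul]

/-- The Verma module is generated over `𝔫` by its highest weight vector. -/
theorem Verma.mem_of_lower {μ : Fin m → ℂ} (P : Submodule ℂ (Verma μ))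
    (base : Submodule.Quotient.mk 1 ∈ P)
    (lower : ∀ a b, a < b → ∀ x ∈ P, (Ugl.E b a : Ugl m) • x ∈ P) (x : Verma μ) : x ∈ P := by
  let S : Submodule ℂ (Verma μ) := sInf {T | Submodule.Quotient.mk 1 ∈ T ∧
    ∀ a b, a < b → ∀ x ∈ T, (Ugl.E b a : Ugl m) • x ∈ T}
  have hS1 : Submodule.Quotient.mk 1 ∈ S := Submodule.mem_sInf.2 fun T hT => hT.1
  have hS2 : ∀ a b, a < b → ∀ x ∈ S, (Ugl.E b a : Ugl m) • x ∈ S := fun a b hab x hx =>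
    Submodule.mem_sInf.2 fun T hT => hT.2 a b hab x (Submodule.mem_sInf.1 hx T hT)
  have hmk : ∀ z ∈ vermaIdeal μ, (Submodule.Quotient.mk z : Verma μ) = 0 := fun z hz =>
    (Submodule.Quotient.mk_eq_zero _).2 hz
  have hone : ∀ u : Ugl m, u • (Submodule.Quotient.mk 1 : Verma μ) = Submodule.Quotient.mk u := by
    intro u
    rw [← Submodule.Quotient.mk_smul, smul_eq_mul, mul_one]
  -- the vectors of `S` that all matrix units keep in `S` form a subspace with the same properties
  let T : Submodule ℂ (Verma μ) :=
    { carrier := {x | x ∈ S ∧ ∀ c d, (Ugl.E c d : Ugl m) • x ∈ S}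
      add_mem' := fun hx hy => ⟨S.add_mem hx.1 hy.1, fun c d => by
        rw [smul_add]; exact S.add_mem (hx.2 c d) (hy.2 c d)⟩
      zero_mem' := ⟨S.zero_mem, fun c d => by rw [smul_zero]; exact S.zero_mem⟩
      smul_mem' := fun k x hx => ⟨S.smul_mem k hx.1, fun c d => by
        rw [smul_comm]; exact S.smul_mem k (hx.2 c d)⟩ }
  have hST : S ≤ T := by
    refine sInf_le ⟨⟨hS1, fun c d => ?_⟩, fun a b hab x hx => ⟨hS2 a b hab x hx.1, fun c d => ?_⟩⟩
    · rcases lt_trichotomy c d with h | h | h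
      · rw [hone, hmk _ (Submodule.subset_span (Or.inl ⟨c, d, h, rfl⟩))]
        exact S.zero_mem
      · subst h
        have e := hmk _ (Submodule.subset_span (Or.inr ⟨c, rfl⟩))
        rw [Submodule.Quotient.mk_sub, sub_eq_zero, Algebra.algebraMap_eq_smul_one,
          Submodule.Quotient.mk_smul] at e
        rw [hone, e]
        exact S.smul_mem _ hS1
      · exact hS2 d c h _ hS1
    · rw [Ugl.E_smul_E_smul]
      refine S.add_mem (hS2 a b hab _ (hx.2 c d)) (S.sub_mem ?_ ?_) <;> split_ifs <;>
        first | exact hx.2 _ _ | exact S.zero_mem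
  have hSP : S ≤ P := sInf_le ⟨base, lower⟩
  obtain ⟨u, rfl⟩ := Submodule.Quotient.mk_surjective _ x
  refine hSP ?_
  refine Ugl.mem_of_E ((S.comap ((Submodule.mkQ (vermaIdeal μ)).restrictScalars ℂ))) hS1
    (fun a b u hu => ?_) u
  exact (hST hu).2 a b

end VermaFree

/-! ### The action of the Yangian on coinvariants -/

section HighestWeight

variable {m n : ℕ}

/-- The matrix over power series in `u⁻¹` formed by a family of coefficients. -/
def seriesMatrix {A : Type*} [Ring A] (T : Fin n → Fin n → ℕ → A) :
    Matrix (Fin n) (Fin n) (PowerSeries A) :=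
  Matrix.of fun i j => PowerSeries.mk (T i j)

theorem coeff_mul_seriesMatrix {A : Type*} [Ring A]
    (M : Matrix (Fin n) (Fin n) (PowerSeries A)) (T : Fin n → Fin n → ℕ → A) (i j : Fin n)
    (r : ℕ) : PowerSeries.coeff r ((M * seriesMatrix T) i j)
      = ∑ k, ∑ x ∈ Finset.HasAntidiagonal.antidiagonal r,
          PowerSeries.coeff x.1 (M i k) * T k j x.2 := by
  simp only [Matrix.mul_apply, map_sum, PowerSeries.coeff_mul, seriesMatrix, Matrix.of_apply,
    PowerSeries.coeff_mk]

theorem coeff_seriesMatrix_mul {A : Type*} [Ring A] (T : Fin n → Fin n → ℕ → A)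
    (M : Matrix (Fin n) (Fin n) (PowerSeries A)) (i j : Fin n)
    (r : ℕ) : PowerSeries.coeff r ((seriesMatrix T * M) i j)
      = ∑ k, ∑ x ∈ Finset.HasAntidiagonal.antidiagonal r,
          T i k x.1 * PowerSeries.coeff x.2 (M k j) := by
  simp only [Matrix.mul_apply, map_sum, PowerSeries.coeff_mul, seriesMatrix, Matrix.of_apply,
    PowerSeries.coeff_mk]

theorem constantCoeff_list_prod {A : Type*} [Ring A]
    (L : List (Matrix (Fin n) (Fin n) (PowerSeries A)))
    (h : ∀ M ∈ L, ∀ i j, PowerSeries.coeff 0 (M i j) = if i = j then 1 else 0) (i j : Fin n) :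
    PowerSeries.coeff 0 (L.prod i j) = if i = j then 1 else 0 := by
  have h2 : (PowerSeries.constantCoeff (R := A)).mapMatrix L.prod = 1 := by
    rw [map_list_prod]
    refine List.prod_eq_one fun M hM => ?_
    obtain ⟨M, hM', rfl⟩ := List.mem_map.1 hM
    ext i j : 1
    simpa only [RingHom.mapMatrix_apply, Matrix.map_apply, Matrix.one_apply,
      ← PowerSeries.coeff_zero_eq_constantCoeff_apply] using h M hM' i j
  have := congrFun (congrFun h2 i) j
  simpa only [RingHom.mapMatrix_apply, Matrix.map_apply, Matrix.one_apply,
    ← PowerSeries.coeff_zero_eq_constantCoeff_apply] using this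

variable {θ : ℤˣ} {V H W : Type*} [AddCommGroup V] [Module ℂ V] [Module (Ugl m) V]
  [IsScalarTower ℂ (Ugl m) V] [AddCommGroup H] [Module ℂ H] [AddCommGroup W] [Module ℂ W]

/-- The operators `∑_k q_ak p_bk` of a Weyl family. -/
def weylGl {A : Type*} [Ring A] (Q P : Fin m × Fin n → A) (a b : Fin m) : A :=
  ∑ k, Q (a, k) * P (b, k)

theorem IsWeylFamily.weylGl_isGlFamily {A : Type*} [Ring A] [Algebra ℂ A]
    {Q P : Fin m × Fin n → A} (h : IsWeylFamily θ Q P) : IsGlFamily (weylGl Q P) := by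
  intro a b c d
  have hF := fun k l => h.qp_comm (a, k) (b, k) (c, l) (d, l)
  rw [weylGl, weylGl, Finset.sum_mul_sum, Finset.sum_mul_sum, Finset.sum_comm (s := Finset.univ)
    (f := fun k l => Q (c, k) * P (d, k) * (Q (a, l) * P (b, l)))]
  simp only [← Finset.sum_sub_distrib, hF, Prod.mk.injEq, ite_and]
  simp only [Finset.sum_sub_distrib, Finset.sum_ite_irrel, Finset.sum_ite_eq,
    Finset.sum_ite_eq', Finset.sum_const_zero, Finset.mem_univ, if_true, weylGl]

theorem IsWeylFamily.weylGl_mul {A : Type*} [Ring A] [Algebra ℂ A]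
    {Q P : Fin m × Fin n → A} (h : IsWeylFamily θ Q P) {a b c : Fin m} (hab : a ≠ b)
    (hbc : c ≠ b) (i j : Fin n) :
    sgn θ • (weylGl Q P b c * (Q (a, i) * P (b, j)))
      = (if c = a then sgn θ • (Q (b, i) * P (b, j)) else 0)
        + ∑ k, Q (a, i) * P (c, k) * (Q (b, k) * P (b, j)) := by
  have e := sgn_mul_self θ
  have h1 : ∀ k, sgn θ • (Q (b, k) * P (c, k) * (Q (a, i) * P (b, j)))
      = (if c = a then if k = i then sgn θ • (Q (b, k) * P (b, j)) else 0 else 0)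
        + Q (a, i) * P (c, k) * (Q (b, k) * P (b, j)) := by
    intro k
    have hc := h.qp_comm (a, i) (c, k) (b, k) (b, j)
    simp only [Prod.mk.injEq, hbc, hab.symm, false_and, if_false, sub_zero, sub_eq_zero] at hc
    rw [h.qp_mul_rev (a, i) (b, j) (b, k) (c, k), hc]
    simp only [Prod.mk.injEq, hab, false_and, if_false, smul_zero, sub_zero, smul_add,
      smul_smul, e, one_smul, ite_and, smul_ite]
    rw [add_comm]
  rw [weylGl, Finset.sum_mul, Finset.smul_sum]
  simp only [h1, Finset.sum_add_distrib, Finset.sum_ite_irrel, Finset.sum_ite_eq',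
    Finset.mem_univ, if_true, Finset.sum_const_zero]

/-- The values `B(X_ab v, g)`, coefficient by coefficient, of a bilinear map `B` for which the
strictly lower triangular matrices act on the first argument as minus the operators `Z_ba` on the
second, where `v` is a highest weight vector. -/
theorem genMatrix_pow_succ_smul (μ : Fin m → ℂ) {v : V}
    (hv : ∀ a b : Fin m, a < b → (Ugl.E a b : Ugl m) • v = 0)
    (hv' : ∀ a : Fin m, (Ugl.E a a : Ugl m) • v = μ a • v)
    (B : V →ₗ[ℂ] H →ₗ[ℂ] W) (Z : Fin m → Fin m → Module.End ℂ H)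
    (hB : ∀ a b : Fin m, a < b → ∀ x f, B ((Ugl.E b a : Ugl m) • x) f = -B x (Z b a f))
    (r : ℕ) (a b : Fin m) (g : H) :
    B ((genMatrix θ (Ugl.E (m := m)) ^ (r + 1)) a b • v) g
      = -sgn θ • ((μ b - (b : ℕ)) • B ((genMatrix θ (Ugl.E (m := m)) ^ r) a b • v) g
        + (if a = b then ∑ c, (if c < b then
            B ((genMatrix θ (Ugl.E (m := m)) ^ r) c c • v) g else 0) else 0)
        - ∑ c, (if c < b then
            B ((genMatrix θ (Ugl.E (m := m)) ^ r) a c • v) (Z b c g) else 0)) := by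
  have hG := genMatrix_pow_comm (θ := θ) (Ugl.isGlFamily (m := m)) r
  have h0 : ∀ a b, genMatrix θ (Ugl.E (m := m)) a b = -(sgn θ • Ugl.E b a) := fun _ _ => rfl
  rw [pow_succ, Matrix.mul_apply]
  generalize genMatrix θ (Ugl.E (m := m)) ^ r = G at *
  have h1 : ∀ c, B ((G a c * Ugl.E b c) • v) g
      = (if c = b then μ b • B (G a b • v) g else 0) + -(if c < b then B (G a b • v) g else 0)
        + ((if a = b then if c < b then B (G c c • v) g else 0 else 0)
          + -(if c < b then B (G a c • v) (Z b c g) else 0)) := by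
    intro c
    rcases lt_trichotomy c b with h | h | h
    · have h2 : G a c * Ugl.E b c = Ugl.E b c * G a c - (G a b - if a = b then G c c else 0) := by
        rw [← sub_eq_iff_eq_add'.2 (sub_eq_iff_eq_add.1 (hG b c a c))]
        simp
      rw [h2, sub_smul, sub_smul, mul_smul, map_sub, map_sub, LinearMap.sub_apply,
        LinearMap.sub_apply, hB _ _ h, ite_smul, zero_smul]
      simp only [h, h.ne, if_true, if_false]
      split_ifs
      · abel
      · rw [map_zero, LinearMap.zero_apply]; abel
    · subst h
      have h2 : G a c • μ c • v = μ c • G a c • v := smul_algebra_smul_comm _ _ _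
      simp [mul_smul, hv', h2]
    · simp [mul_smul, hv _ _ h, h.ne', h.not_gt]
  simp only [h0, mul_neg, mul_smul_comm, Finset.sum_neg_distrib, ← Finset.smul_sum, neg_smul,
    map_neg, LinearMap.neg_apply, smul_assoc, map_smul, LinearMap.smul_apply, Finset.sum_smul,
    map_sum, LinearMap.sum_apply, h1]
  congr 2
  have hcard : ∑ c : Fin m, (if c < b then B (G a b • v) g else 0)
      = ((b : ℕ) : ℂ) • B (G a b • v) g := by
    rw [← Finset.sum_filter, Finset.sum_const, Finset.filter_gt_eq_Iio, Fin.card_Iio,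
      Nat.cast_smul_eq_nsmul]
  simp only [Finset.sum_add_distrib, Finset.sum_neg_distrib, Finset.sum_ite_eq', hcard,
    Finset.mem_univ, if_true, sub_smul, Finset.sum_ite_irrel, Finset.sum_const_zero]
  abel

/-- On a highest weight vector the matrix `X(u)` is upper triangular modulo `𝔫`. -/
theorem genMatrix_pow_smul_eq_zero (μ : Fin m → ℂ) {v : V}
    (hv : ∀ a b : Fin m, a < b → (Ugl.E a b : Ugl m) • v = 0)
    (hv' : ∀ a : Fin m, (Ugl.E a a : Ugl m) • v = μ a • v)
    (B : V →ₗ[ℂ] H →ₗ[ℂ] W) (Z : Fin m → Fin m → Module.End ℂ H)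
    (hB : ∀ a b : Fin m, a < b → ∀ x f, B ((Ugl.E b a : Ugl m) • x) f = -B x (Z b a f))
    (r : ℕ) (a b : Fin m) (hab : b < a) (g : H) :
    B ((genMatrix θ (Ugl.E (m := m)) ^ r) a b • v) g = 0 := by
  induction r generalizing b g with
  | zero => rw [pow_zero, Matrix.one_apply_ne hab.ne', zero_smul, map_zero, LinearMap.zero_apply]
  | succ r ih =>
    rw [genMatrix_pow_succ_smul μ hv hv' B Z hB, ih b hab g, if_neg hab.ne', smul_zero,
      Finset.sum_eq_zero, add_zero, sub_zero, smul_zero]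
    intro c _
    split_ifs with h
    · exact ih c (h.trans hab) _
    · rfl

/-- The part of the action of `T_ij(u)` on `v ⊗ f` that comes from the columns `c < k` of `X(u)` is,
in the coinvariants, given by the product of the matrices with the entries
`δ_ij + q_ai p_aj / (u + θ (μ_a - a))` over the indices `a < k` in increasing order. For `k = m` this
is the whole action. The indices start at `0`, so that `-a` is the entry `ρ_a`. -/
theorem sum_genMatrix_pow_smul (μ : Fin m → ℂ) {v : V}
    (hv : ∀ a b : Fin m, a < b → (Ugl.E a b : Ugl m) • v = 0)
    (hv' : ∀ a : Fin m, (Ugl.E a a : Ugl m) • v = μ a • v)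
    (B : V →ₗ[ℂ] H →ₗ[ℂ] W) {Q P : Fin m × Fin n → Module.End ℂ H} (hQP : IsWeylFamily θ Q P)
    (hB : ∀ a b : Fin m, a < b → ∀ x f, B ((Ugl.E b a : Ugl m) • x) f = -B x (weylGl Q P b a f))
    (k : ℕ) (hk : k ≤ m) (i j : Fin n) (r : ℕ) (f : H) :
    ∑ a : Fin m, ∑ c : Fin m, (if (c : ℕ) < k then
        B ((genMatrix θ (Ugl.E (m := m)) ^ r) a c • v) (Q (a, i) (P (c, j) f)) else 0)
      = B v (PowerSeries.coeff (r + 1) (((List.ofFn fun a : Fin m => seriesMatrix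
          (evalT (-(sgn θ * (μ a - (a : ℕ)))) fun i j => Q (a, i) * P (a, j))).take k).prod i j) f)
      := by
  have e := sgn_mul_self θ
  have hrec := genMatrix_pow_succ_smul (θ := θ) μ hv hv' B _ hB
  have hzero := genMatrix_pow_smul_eq_zero (θ := θ) μ hv hv' B _ hB
  induction k generalizing i j r f with
  | zero =>
    simp only [Nat.not_lt_zero, if_false, Finset.sum_const_zero, List.take_zero, List.prod_nil,
      Matrix.one_apply]
    split_ifs
    · rw [PowerSeries.coeff_one, if_neg (Nat.succ_ne_zero r), LinearMap.zero_apply, map_zero]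
    · rw [map_zero, LinearMap.zero_apply, map_zero]
  | succ k ih =>
    have ih := ih (by omega)
    let b : Fin m := ⟨k, hk⟩
    set c0 : ℂ := -(sgn θ * (μ b - (b : ℕ))) with hc0
    set Y := ((List.ofFn fun a : Fin m => seriesMatrix
      (evalT (-(sgn θ * (μ a - (a : ℕ)))) fun i j => Q (a, i) * P (a, j))).take k).prod with hY
    have hprod : ((List.ofFn fun a : Fin m => seriesMatrix
        (evalT (-(sgn θ * (μ a - (a : ℕ)))) fun i j => Q (a, i) * P (a, j))).take (k + 1)).prod
        = Y * seriesMatrix (evalT c0 fun i j => Q (b, i) * P (b, j)) := by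
      rw [List.prod_take_succ _ _ (by simpa using hk), List.getElem_ofFn]
    have hY0 : ∀ i l, PowerSeries.coeff 0 (Y i l) = if i = l then 1 else 0 := by
      refine constantCoeff_list_prod _ fun M hM i j => ?_
      obtain ⟨a, rfl⟩ := (List.mem_ofFn' _ _).1 (List.mem_of_mem_take hM)
      simp only [seriesMatrix, Matrix.of_apply, PowerSeries.coeff_mk, evalT]
    -- the contribution of the column `b`
    let C : ℕ → Fin n → Fin n → H → W := fun r i j f =>
      ∑ a, B ((genMatrix θ (Ugl.E (m := m)) ^ r) a b • v) (Q (a, i) (P (b, j) f))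
    let D : ℕ → Fin n → Fin n → Module.End ℂ H := fun r i j =>
      ∑ l, ∑ x ∈ Finset.HasAntidiagonal.antidiagonal r,
        PowerSeries.coeff x.1 (Y i l) * (c0 ^ x.2 • (Q (b, l) * P (b, j)))
    have hD : ∀ r i j, D (r + 1) i j = c0 • D r i j
        + ∑ l, PowerSeries.coeff (r + 1) (Y i l) * (Q (b, l) * P (b, j)) := by
      intro r i j
      simp only [D, Finset.Nat.sum_antidiagonal_succ', Finset.sum_add_distrib, pow_succ',
        mul_smul, mul_smul_comm, Finset.smul_sum, pow_zero, one_smul]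
      rw [add_comm]
    have hC : ∀ r i j f, C (r + 1) i j f = c0 • C r i j f
        + ∑ l, B v (PowerSeries.coeff (r + 1) (Y i l) (Q (b, l) (P (b, j) f))) := by
      intro r i j f
      simp only [← ih]
      have hkey : ∀ a c : Fin m, c < b → sgn θ • B ((genMatrix θ (Ugl.E (m := m)) ^ r) a c • v)
            (weylGl Q P b c (Q (a, i) (P (b, j) f)))
          = (if c = a then
              sgn θ • B ((genMatrix θ (Ugl.E (m := m)) ^ r) a c • v) (Q (b, i) (P (b, j) f)) else 0)
            + ∑ l, B ((genMatrix θ (Ugl.E (m := m)) ^ r) a c • v)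
                (Q (a, i) (P (c, l) (Q (b, l) (P (b, j) f)))) := by
        intro a c hcb
        rcases eq_or_ne a b with rfl | hab
        · simp only [hzero r _ c hcb, smul_zero, ite_self, Finset.sum_const_zero, add_zero]
        · have h := LinearMap.congr_fun (hQP.weylGl_mul hab hcb.ne i j) f
          have h := congrArg (B ((genMatrix θ (Ugl.E (m := m)) ^ r) a c • v)) h
          simp only [LinearMap.smul_apply, LinearMap.add_apply, Module.End.mul_apply,
            LinearMap.sum_apply, map_smul, map_add, map_sum] at h
          rw [h]
          split_ifs
          · simp only [LinearMap.smul_apply, Module.End.mul_apply, map_smul]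
          · rw [LinearMap.zero_apply, map_zero]
      have hkey2 : ∀ a c : Fin m, (if c < b then
            sgn θ • B ((genMatrix θ (Ugl.E (m := m)) ^ r) a c • v)
            (weylGl Q P b c (Q (a, i) (P (b, j) f))) else 0)
          = (if c = a then if c < b then
              sgn θ • B ((genMatrix θ (Ugl.E (m := m)) ^ r) a c • v) (Q (b, i) (P (b, j) f))
              else 0 else 0)
            + ∑ l, if (c : ℕ) < k then B ((genMatrix θ (Ugl.E (m := m)) ^ r) a c • v)
                (Q (a, i) (P (c, l) (Q (b, l) (P (b, j) f)))) else 0 := by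
        intro a c
        have hbk : (c : ℕ) < k ↔ c < b := Iff.rfl
        simp only [hbk]
        by_cases hcb : c < b
        · simp only [hcb, if_true, hkey a c hcb]
        · simp only [hcb, if_false, ite_self, Finset.sum_const_zero, add_zero]
      have hrec2 : ∀ a, B ((genMatrix θ (Ugl.E (m := m)) ^ (r + 1)) a b • v)
            (Q (a, i) (P (b, j) f))
          = c0 • B ((genMatrix θ (Ugl.E (m := m)) ^ r) a b • v) (Q (a, i) (P (b, j) f))
            - (if a = b then ∑ c, (if c < b then sgn θ •
                B ((genMatrix θ (Ugl.E (m := m)) ^ r) c c • v) (Q (a, i) (P (b, j) f)) else 0)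
                else 0)
            + ∑ c, if c < b then sgn θ • B ((genMatrix θ (Ugl.E (m := m)) ^ r) a c • v)
              (weylGl Q P b c (Q (a, i) (P (b, j) f))) else 0 := by
        intro a
        rw [hrec, smul_sub, smul_add, smul_smul, hc0]
        simp only [neg_smul, neg_mul]
        simp only [smul_ite, smul_zero, Finset.smul_sum]
        abel
      simp only [C, hrec2, hkey2, Finset.sum_add_distrib, Finset.sum_sub_distrib,
        Finset.sum_ite_eq', Finset.mem_univ, if_true, ← Finset.smul_sum]
      have h4 : ∑ a : Fin m, ∑ c : Fin m, ∑ l, (if (c : ℕ) < k then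
            B ((genMatrix θ (Ugl.E (m := m)) ^ r) a c • v)
                (Q (a, i) (P (c, l) (Q (b, l) (P (b, j) f)))) else 0)
          = ∑ l, ∑ a : Fin m, ∑ c : Fin m, if (c : ℕ) < k then
            B ((genMatrix θ (Ugl.E (m := m)) ^ r) a c • v)
                (Q (a, i) (P (c, l) (Q (b, l) (P (b, j) f)))) else 0 :=
        (Finset.sum_congr rfl fun a _ => Finset.sum_comm).trans Finset.sum_comm
      rw [h4]
      abel
    have hCD : ∀ r i j f, C r i j f = B v (D r i j f) := by
      intro r i j f
      induction r with
      | zero =>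
        have h1 : C 0 i j f = B v (Q (b, i) (P (b, j) f)) := by
          refine (Finset.sum_eq_single_of_mem b (Finset.mem_univ b) fun a _ ha => ?_).trans ?_
          · rw [pow_zero, Matrix.one_apply_ne ha, zero_smul, map_zero, LinearMap.zero_apply]
          · rw [pow_zero, Matrix.one_apply_eq, one_smul]
        have h2 : D 0 i j = Q (b, i) * P (b, j) := by
          simp only [D, Finset.Nat.antidiagonal_zero, Finset.sum_singleton, hY0, pow_zero, one_smul,
            ite_mul, one_mul, zero_mul, Finset.sum_ite_eq, Finset.mem_univ, if_true]
        rw [h1, h2, Module.End.mul_apply]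
      | succ r ih2 =>
        rw [hC, hD, ih2]
        simp only [LinearMap.add_apply, map_add, LinearMap.smul_apply, map_smul,
          LinearMap.sum_apply, map_sum, Module.End.mul_apply]
    have hsplit : ∀ a : Fin m, ∑ c : Fin m, (if (c : ℕ) < k + 1 then
        B ((genMatrix θ (Ugl.E (m := m)) ^ r) a c • v) (Q (a, i) (P (c, j) f)) else 0)
        = ∑ c : Fin m, (if (c : ℕ) < k then
        B ((genMatrix θ (Ugl.E (m := m)) ^ r) a c • v) (Q (a, i) (P (c, j) f)) else 0)
        + B ((genMatrix θ (Ugl.E (m := m)) ^ r) a b • v) (Q (a, i) (P (b, j) f)) := by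
      intro a
      have h : ∀ c : Fin m, (if (c : ℕ) < k + 1 then
          B ((genMatrix θ (Ugl.E (m := m)) ^ r) a c • v) (Q (a, i) (P (c, j) f)) else 0)
          = (if (c : ℕ) < k then
            B ((genMatrix θ (Ugl.E (m := m)) ^ r) a c • v) (Q (a, i) (P (c, j) f)) else 0)
          + if c = b then
            B ((genMatrix θ (Ugl.E (m := m)) ^ r) a c • v) (Q (a, i) (P (c, j) f)) else 0 := by
        intro c
        have hcb : c = b ↔ (c : ℕ) = k := Fin.ext_iff
        simp only [hcb]
        rcases lt_trichotomy (c : ℕ) k with h | h | h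
        · rw [if_pos (by omega), if_pos h, if_neg h.ne, add_zero]
        · rw [if_pos (by omega), if_neg (by omega), if_pos h, zero_add]
        · rw [if_neg (by omega), if_neg (by omega), if_neg h.ne', add_zero]
      simp only [h, Finset.sum_add_distrib, Finset.sum_ite_eq', Finset.mem_univ, if_true]
    have hlast : PowerSeries.coeff (r + 1) ((Y * seriesMatrix
        (evalT c0 fun i j => Q (b, i) * P (b, j))) i j)
        = PowerSeries.coeff (r + 1) (Y i j) + D r i j := by
      rw [coeff_mul_seriesMatrix]
      simp only [Finset.Nat.sum_antidiagonal_succ', evalT, Finset.sum_add_distrib, mul_ite, mul_one,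
        mul_zero, Finset.sum_ite_eq', Finset.mem_univ, if_true, D]
    rw [hprod, hlast, LinearMap.add_apply, map_add, ← hCD, ← ih]
    simp only [hsplit, Finset.sum_add_distrib]
    rfl

end HighestWeight

/-! ### Coinvariants of `M_μ ⊗ H` -/

section Coinvariants

variable (θ : ℤˣ) (p q n : ℕ) (δ : Fin (p + q) → ℤˣ)

/-- The operator on `H` by which the coordinate `q_ci` acts after the twist by `ϖ`. -/
def opQ (c : Fin (p + q) × Fin n) : Module.End ℂ (HAlg θ (Fin (p + q) × Fin n)) :=
  HDAlg.act θ (varpi θ p q n δ (coordQ θ p q n c))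

/-- The operator on `H` by which the coordinate `p_ci` acts after the twist by `ϖ`. -/
def opP (c : Fin (p + q) × Fin n) : Module.End ℂ (HAlg θ (Fin (p + q) × Fin n)) :=
  HDAlg.act θ (varpi θ p q n δ (coordP θ p q n c))

theorem op_isWeylFamily : IsWeylFamily θ (opQ θ p q n δ) (opP θ p q n δ) :=
  ((coord_isWeylFamily θ p q n).map (varpi θ p q n δ)).map (HDAlg.act θ)

variable (V : Type) [AddCommGroup V] [Module ℂ V] [Module (Ugl (p + q)) V]
  [IsScalarTower ℂ (Ugl (p + q)) V]

theorem bimodRep_tmul (u : Ugl (p + q)) (y : HDAlg θ (Fin (p + q) × Fin n)) (x : V)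
    (f : HAlg θ (Fin (p + q) × Fin n)) :
    bimodRep θ p q n δ V (u ⊗ₜ y) (x ⊗ₜ f)
      = (u • x) ⊗ₜ (HDAlg.act θ (varpi θ p q n δ y) f) := rfl

theorem glAction_tmul (a b : Fin (p + q)) (x : V) (f : HAlg θ (Fin (p + q) × Fin n)) :
    bimodRep θ p q n δ V (glElement θ p q n a b) (x ⊗ₜ f)
      = ((Ugl.E a b : Ugl (p + q)) • x) ⊗ₜ f
        + x ⊗ₜ (HDAlg.act θ (varpi θ p q n δ (zeta θ p q n a b)) f) := by
  rw [glElement, map_add, LinearMap.add_apply, leftE, bimodRep_tmul, bimodRep_tmul, map_one,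
    map_one, one_smul, Module.End.one_apply]

theorem act_zeta (a b : Fin (p + q)) :
    HDAlg.act θ (varpi θ p q n δ (zeta θ p q n a b))
      = (if a = b then algebraMap ℂ _ (sgn θ * n / 2) else 0)
        + weylGl (opQ θ p q n δ) (opP θ p q n δ) a b := by
  simp only [zeta, map_add, map_sum, map_mul, weylGl, opQ, opP]
  congr 1
  split_ifs
  · rw [AlgHom.commutes, AlgHom.commutes]
  · rw [map_zero, map_zero]

theorem genMatrix_leftE_pow (r : ℕ) (a b : Fin (p + q)) :
    (genMatrix θ (leftE θ p q n) ^ r) a b = (genMatrix θ Ugl.E ^ r) a b ⊗ₜ[ℂ] 1 := by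
  have h : genMatrix θ (leftE θ p q n) = (Algebra.TensorProduct.includeLeft (R := ℂ) (S := ℂ)
      (A := Ugl (p + q)) (B := HDAlg θ (Fin (p + q) × Fin n))).mapMatrix
        (genMatrix θ Ugl.E) := by
    ext a b
    simp only [genMatrix, Matrix.of_apply, AlgHom.mapMatrix_apply, Matrix.map_apply, map_neg,
      map_smul, leftE, Algebra.TensorProduct.includeLeft_apply]
  rw [h, ← map_pow]
  rfl

theorem bimodRep_alpha_T_tmul (i j : Fin n) (r : ℕ) (x : V)
    (f : HAlg θ (Fin (p + q) × Fin n)) :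
    bimodRep θ p q n δ V (alpha θ p q n (Yangian.T n i j (r + 1))) (x ⊗ₜ f)
      = ∑ a, ∑ b, ((genMatrix θ (Ugl.E (m := p + q)) ^ r) a b • x)
          ⊗ₜ (opQ θ p q n δ (a, i) (opP θ p q n δ (b, j) f)) := by
  have h : alpha θ p q n (Yangian.T n i j (r + 1)) = ∑ a, ∑ b,
      (genMatrix θ (leftE θ p q n) ^ r) a b
        * ((1 ⊗ₜ coordQ θ p q n (a, i)) * (1 ⊗ₜ coordP θ p q n (b, j))) :=
    Yangian.lift_T _ i j (r + 1)
  simp only [h, genMatrix_leftE_pow, Algebra.TensorProduct.tmul_mul_tmul, mul_one, one_mul, map_sum,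
    LinearMap.sum_apply, bimodRep_tmul, map_mul, Module.End.mul_apply, opQ, opP]

/-- The subspace `𝔫 · (V ⊗ H)`, as a subspace of the tensor product. -/
def nilSub : Submodule ℂ (V ⊗[ℂ] HAlg θ (Fin (p + q) × Fin n)) :=
  ⨆ (a : Fin (p + q)) (b : Fin (p + q)) (_ : a < b),
    LinearMap.range (bimodRep θ p q n δ V (glElement θ p q n b a))

theorem glElement_mem_nilSub {a b : Fin (p + q)} (hab : a < b)
    (w : V ⊗[ℂ] HAlg θ (Fin (p + q) × Fin n)) :
    bimodRep θ p q n δ V (glElement θ p q n b a) w ∈ nilSub θ p q n δ V :=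
  Submodule.mem_iSup_of_mem a (Submodule.mem_iSup_of_mem b (Submodule.mem_iSup_of_mem hab ⟨w, rfl⟩))

/-- The bilinear map from `V × H` to the coinvariants of `V ⊗ H`. -/
def coinvMk : V →ₗ[ℂ] HAlg θ (Fin (p + q) × Fin n) →ₗ[ℂ]
    (V ⊗[ℂ] HAlg θ (Fin (p + q) × Fin n)) ⧸ nilSub θ p q n δ V :=
  (TensorProduct.mk ℂ V _).compr₂ (nilSub θ p q n δ V).mkQ

theorem coinvMk_lower {a b : Fin (p + q)} (hab : a < b) (x : V)
    (f : HAlg θ (Fin (p + q) × Fin n)) :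
    coinvMk θ p q n δ V ((Ugl.E b a : Ugl (p + q)) • x) f
      = -coinvMk θ p q n δ V x (weylGl (opQ θ p q n δ) (opP θ p q n δ) b a f) := by
  rw [eq_neg_iff_add_eq_zero]
  have h := glElement_mem_nilSub θ p q n δ V hab (x ⊗ₜ f)
  rw [glAction_tmul, act_zeta, if_neg hab.ne', zero_add] at h
  exact (Submodule.Quotient.mk_eq_zero _).2 h

variable (μ : Fin (p + q) → ℂ)

/-- The map from `H` to the coinvariants of `M_μ ⊗ H` given by the highest weight vector. -/
def coinvMap : HAlg θ (Fin (p + q) × Fin n) →ₗ[ℂ]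
    (Verma μ ⊗[ℂ] HAlg θ (Fin (p + q) × Fin n)) ⧸ nilSub θ p q n δ (Verma μ) :=
  coinvMk θ p q n δ (Verma μ) (Submodule.Quotient.mk 1)

theorem coinvMap_surjective : Function.Surjective (coinvMap θ p q n δ μ) := by
  let R := LinearMap.range (coinvMap θ p q n δ μ)
  let P : Submodule ℂ (Verma μ) := ⨅ f, R.comap ((coinvMk θ p q n δ (Verma μ)).flip f)
  have hP : ∀ x f, coinvMk θ p q n δ (Verma μ) x f ∈ R := by
    intro x f
    have hx : x ∈ P := by
      refine Verma.mem_of_lower P ?_ ?_ x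
      · exact (Submodule.mem_iInf _).2 fun f => ⟨f, rfl⟩
      · intro a b hab x hx
        refine (Submodule.mem_iInf _).2 fun f => ?_
        have h := (Submodule.mem_iInf _).1 hx (weylGl (opQ θ p q n δ) (opP θ p q n δ) b a f)
        rw [Submodule.mem_comap, LinearMap.flip_apply] at h ⊢
        rw [coinvMk_lower θ p q n δ _ hab]
        exact R.neg_mem h
    exact (Submodule.mem_iInf _).1 hx f
  intro w
  obtain ⟨w, rfl⟩ := Submodule.mkQ_surjective _ w
  change (nilSub θ p q n δ (Verma μ)).mkQ w ∈ R
  induction w using TensorProduct.induction_on with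
  | zero => rw [map_zero]; exact R.zero_mem
  | tmul x f => exact hP x f
  | add x y hx hy => rw [map_add]; exact R.add_mem hx hy

theorem coinvMap_injective : Function.Injective (coinvMap θ p q n δ μ) := by
  obtain ⟨Ψ, h1, h2⟩ := Verma.exists_linearMap (op_isWeylFamily θ p q n δ).weylGl_isGlFamily μ
  let F : Verma μ ⊗[ℂ] HAlg θ (Fin (p + q) × Fin n) →ₗ[ℂ] HAlg θ (Fin (p + q) × Fin n) :=
    TensorProduct.lift Ψ
  have hF : nilSub θ p q n δ (Verma μ) ≤ LinearMap.ker F := by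
    refine iSup_le fun a => iSup_le fun b => iSup_le fun hab => ?_
    rintro _ ⟨w, rfl⟩
    rw [LinearMap.mem_ker]
    induction w using TensorProduct.induction_on with
    | zero => rw [map_zero, map_zero]
    | tmul x f =>
      rw [glAction_tmul, act_zeta, if_neg hab.ne', zero_add, map_add, TensorProduct.lift.tmul,
        TensorProduct.lift.tmul, h2 a b hab, LinearMap.neg_apply, Module.End.mul_apply,
        neg_add_cancel]
    | add x y hx hy => rw [map_add, map_add, hx, hy, add_zero]
  refine Function.LeftInverse.injective (g := (nilSub θ p q n δ (Verma μ)).liftQ F hF) fun f => ?_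
  have h3 : (nilSub θ p q n δ (Verma μ)).liftQ F hF (coinvMap θ p q n δ μ f)
      = Ψ (Submodule.Quotient.mk 1) f := rfl
  rw [h3, h1, Module.End.one_apply]

theorem Verma.E_smul_mk_one {m : ℕ} (μ : Fin m → ℂ) {a b : Fin m} (hab : a < b) :
    (Ugl.E a b : Ugl m) • (Submodule.Quotient.mk 1 : Verma μ) = 0 := by
  rw [← Submodule.Quotient.mk_smul, smul_eq_mul, mul_one]
  exact (Submodule.Quotient.mk_eq_zero _).2 (Submodule.subset_span (Or.inl ⟨a, b, hab, rfl⟩))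

theorem Verma.E_self_smul_mk_one {m : ℕ} (μ : Fin m → ℂ) (a : Fin m) :
    (Ugl.E a a : Ugl m) • (Submodule.Quotient.mk 1 : Verma μ)
      = μ a • (Submodule.Quotient.mk 1 : Verma μ) := by
  have e := (Submodule.Quotient.mk_eq_zero (vermaIdeal μ)).2
    (Submodule.subset_span (Or.inr ⟨a, rfl⟩))
  rw [Submodule.Quotient.mk_sub, sub_eq_zero, Algebra.algebraMap_eq_smul_one,
    Submodule.Quotient.mk_smul] at e
  rw [← Submodule.Quotient.mk_smul, smul_eq_mul, mul_one, e]

/-- The product, in increasing order of `a`, of the matrices with the entries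
`δ_ij + q_ai p_aj / (u + θ (μ_a + ρ_a))`. -/
def opProd : Matrix (Fin n) (Fin n)
    (PowerSeries (Module.End ℂ (HAlg θ (Fin (p + q) × Fin n)))) :=
  (List.ofFn fun a : Fin (p + q) => seriesMatrix (evalT (-(sgn θ * (μ a + rho a)))
    fun i j => opQ θ p q n δ (a, i) * opP θ p q n δ (a, j))).prod

theorem mkQ_bimodRep_alpha_T (i j : Fin n) (r : ℕ) (f : HAlg θ (Fin (p + q) × Fin n)) :
    (nilSub θ p q n δ (Verma μ)).mkQ (bimodRep θ p q n δ (Verma μ)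
        (alpha θ p q n (Yangian.T n i j r)) (Submodule.Quotient.mk 1 ⊗ₜ f))
      = coinvMap θ p q n δ μ (PowerSeries.coeff r (opProd θ p q n δ μ i j) f) := by
  rcases r with _ | r
  · have h : PowerSeries.coeff 0 (opProd θ p q n δ μ i j) = if i = j then 1 else 0 := by
      refine constantCoeff_list_prod _ (fun M hM i j => ?_) i j
      obtain ⟨a, rfl⟩ := (List.mem_ofFn' _ _).1 hM
      simp only [seriesMatrix, Matrix.of_apply, PowerSeries.coeff_mk, evalT]
    rw [h, (Yangian.isYangianFamily n).zero i j]
    split_ifs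
    · rw [map_one, map_one, Module.End.one_apply, Module.End.one_apply]
      rfl
    · rw [map_zero, map_zero, LinearMap.zero_apply, LinearMap.zero_apply, map_zero, map_zero]
  · have h := sum_genMatrix_pow_smul (θ := θ) μ (v := (Submodule.Quotient.mk 1 : Verma μ))
      (fun a b => Verma.E_smul_mk_one μ) (Verma.E_self_smul_mk_one μ)
      (coinvMk θ p q n δ (Verma μ)) (op_isWeylFamily θ p q n δ)
      (fun a b hab x f => coinvMk_lower θ p q n δ _ hab x f) (p + q) le_rfl i j r f
    rw [List.take_of_length_le (by simp)] at h
    simp only [Fin.is_lt, if_true, sub_eq_add_neg] at h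
    rw [bimodRep_alpha_T_tmul]
    simp only [map_sum]
    exact h

theorem mkQ_glElement_self (c : Fin (p + q)) (f : HAlg θ (Fin (p + q) × Fin n)) :
    (nilSub θ p q n δ (Verma μ)).mkQ (bimodRep θ p q n δ (Verma μ)
        (glElement θ p q n c c) (Submodule.Quotient.mk 1 ⊗ₜ f))
      = coinvMap θ p q n δ μ ((μ c + sgn θ * n / 2) • f
          + weylGl (opQ θ p q n δ) (opP θ p q n δ) c c f) := by
  rw [glAction_tmul, Verma.E_self_smul_mk_one, act_zeta, if_pos rfl, LinearMap.add_apply,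
    Module.algebraMap_end_apply, add_smul, add_assoc, map_add, map_add, TensorProduct.smul_tmul]
  rfl

end Coinvariants

/-! ### Rows of the algebra `H` -/

section Rows

variable {θ : ℤˣ} {A B : Type}

/-- The embedding of the algebra `H` on the variables `x_i` as the row of index `a`. -/
def rowHom (θ : ℤˣ) (a : A) : HAlg θ B →ₐ[ℂ] HAlg θ (A × B) :=
  HAlg.lift θ (fun i => HAlg.x θ (a, i)) fun _ _ => HAlg.x_mul_x θ _ _

@[simp] theorem rowHom_x (a : A) (i : B) : rowHom θ a (HAlg.x θ i) = HAlg.x θ (a, i) :=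
  HAlg.lift_x θ _ _ i

/-- The span of the variables in the row of index `a`. -/
def rowSpan (θ : ℤˣ) (B : Type) (a : A) : Submodule ℂ (HAlg θ (A × B)) :=
  Submodule.span ℂ (Set.range fun i : B => HAlg.x θ (a, i))

theorem map_degree_rowHom (a : A) (N : ℕ) :
    (HAlg.degree θ B N).map (rowHom θ a).toLinearMap = rowSpan θ B a ^ N := by
  rw [HAlg.degree, Submodule.map_pow, Submodule.map_span, ← Set.range_comp]
  congr 3
  funext i
  exact rowHom_x a i

/-- The product of the subspaces of degree `N a` in the row `a`, for `a` in the list `L`. -/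
def rowDegree (θ : ℤˣ) (B : Type) (L : List A) (N : A → ℕ) : Submodule ℂ (HAlg θ (A × B)) :=
  (L.map fun a => rowSpan θ B a ^ N a).prod

/-- The subalgebra generated by the rows with index in the list `L`. -/
def rowAlg (θ : ℤˣ) (B : Type) (L : List A) : Subalgebra ℂ (HAlg θ (A × B)) :=
  Algebra.adjoin ℂ {y | ∃ a ∈ L, ∃ i : B, y = HAlg.x θ (a, i)}

theorem rowDegree_le_rowAlg (L : List A) (N : A → ℕ) :
    rowDegree θ B L N ≤ Subalgebra.toSubmodule (rowAlg θ B L) := by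
  have h : ∀ L' : List A, (∀ a ∈ L', a ∈ L) →
      rowDegree θ B L' N ≤ Subalgebra.toSubmodule (rowAlg θ B L) := by
    intro L' hL'
    induction L' with
    | nil => exact Submodule.one_le.2 (Subalgebra.one_mem _)
    | cons a L' ih =>
      have h1 : rowSpan θ B a ≤ Subalgebra.toSubmodule (rowAlg θ B L) := by
        refine Submodule.span_le.2 ?_
        rintro _ ⟨i, rfl⟩
        exact Algebra.subset_adjoin ⟨a, hL' a List.mem_cons_self, i, rfl⟩
      have h2 : ∀ k : ℕ, rowSpan θ B a ^ k ≤ Subalgebra.toSubmodule (rowAlg θ B L) := by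
        intro k
        induction k with
        | zero => rw [pow_zero]; exact Submodule.one_le.2 (Subalgebra.one_mem _)
        | succ k ihk =>
          rw [pow_succ]
          exact Submodule.mul_le.2 fun x hx y hy => Subalgebra.mul_mem _ (ihk hx) (h1 hy)
      rw [rowDegree, List.map_cons, List.prod_cons]
      exact Submodule.mul_le.2 fun x hx y hy => Subalgebra.mul_mem _ (h2 _ hx)
        (ih (fun b hb => hL' b (List.mem_cons_of_mem _ hb)) hy)
  exact h L fun _ h => h

theorem rowAlg_induction {L : List A} {P : HAlg θ (A × B) → Prop} (one : P 1)
    (add : ∀ f g, P f → P g → P (f + g)) (smul : ∀ (c : ℂ) f, P f → P (c • f))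
    (x_mul : ∀ a ∈ L, ∀ i f, P f → P (HAlg.x θ (a, i) * f)) {f : HAlg θ (A × B)}
    (hf : f ∈ rowAlg θ B L) : P f := by
  suffices h : ∀ w ∈ rowAlg θ B L, ∀ f, P f → P (w * f) by
    simpa using h f hf 1 one
  intro w hw
  induction hw using Algebra.adjoin_induction with
  | mem x hx => obtain ⟨a, ha, i, rfl⟩ := hx; exact x_mul a ha i
  | algebraMap r =>
    intro f hf
    rw [← Algebra.smul_def]
    exact smul r f hf
  | add x y _ _ hx hy => intro f hf; rw [add_mul]; exact add _ _ (hx f hf) (hy f hf)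
  | mul x y _ _ hx hy => intro f hf; rw [mul_assoc]; exact hx _ (hy f hf)

/-- The parity automorphism `x_i ↦ θ x_i`. -/
def parity (θ : ℤˣ) (B : Type) : HAlg θ B →ₐ[ℂ] HAlg θ B :=
  HAlg.lift θ (fun i => sgn θ • HAlg.x θ i) fun i j => by
    rw [smul_mul_smul_comm, smul_mul_smul_comm, HAlg.x_mul_x, smul_comm]

theorem parity_x_mul (i : B) (f : HAlg θ B) :
    parity θ B (HAlg.x θ i * f) = sgn θ • (HAlg.x θ i * parity θ B f) := by
  rw [map_mul, parity, HAlg.lift_x, smul_mul_assoc]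

theorem HAlg.algebraMap_injective {I : Type} : Function.Injective (algebraMap ℂ (HAlg θ I)) := by
  let φ : HAlg θ I →ₐ[ℂ] ℂ := HAlg.lift θ (fun _ => 0) fun _ _ => by simp
  exact Function.LeftInverse.injective (g := φ) fun c => φ.commutes c

variable [DecidableEq A]

/-- The operators by which the variables act on the tensor product of the row of index `a` with
the algebra of all rows, when the other rows act on the second factor. -/
def splitVar (θ : ℤˣ) (a : A) (c : A × B) : Module.End ℂ (HAlg θ B ⊗[ℂ] HAlg θ (A × B)) :=
  if c.1 = a then TensorProduct.map (HAlg.mulX θ c.2) LinearMap.id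
  else TensorProduct.map (parity θ B).toLinearMap (HAlg.mulX θ c)

theorem splitVar_mul (a : A) (c c' : A × B) :
    splitVar θ a c * splitVar θ a c' = sgn θ • (splitVar θ a c' * splitVar θ a c) := by
  have e := sgn_mul_self θ
  refine TensorProduct.ext' fun k h => ?_
  simp only [splitVar]
  split_ifs <;>
    simp only [Module.End.mul_apply, LinearMap.smul_apply, TensorProduct.map_tmul,
      LinearMap.id_apply, AlgHom.toLinearMap_apply, HAlg.mulX, LinearMap.mulLeft_apply,
      parity_x_mul, ← mul_assoc]
  · rw [HAlg.x_mul_x θ c.2 c'.2, smul_mul_assoc, TensorProduct.smul_tmul']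
  · rw [TensorProduct.smul_tmul', smul_smul, e, one_smul]
  · rw [TensorProduct.smul_tmul']
  · rw [HAlg.x_mul_x θ c c', smul_mul_assoc, TensorProduct.tmul_smul]

/-- The algebra `H` acting on the tensor product of the row of index `a` with itself. -/
def splitAct (θ : ℤˣ) (a : A) :
    HAlg θ (A × B) →ₐ[ℂ] Module.End ℂ (HAlg θ B ⊗[ℂ] HAlg θ (A × B)) :=
  HAlg.lift θ (splitVar θ a) (splitVar_mul a)

theorem splitAct_rowHom (a : A) (f k : HAlg θ B) (h : HAlg θ (A × B)) :
    splitAct θ a (rowHom θ a f) (k ⊗ₜ h) = (f * k) ⊗ₜ h := by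
  induction f using HAlg.induction with
  | one => rw [map_one, map_one, one_mul, Module.End.one_apply]
  | add f g hf hg =>
    rw [map_add, map_add, LinearMap.add_apply, hf, hg, add_mul, TensorProduct.add_tmul]
  | smul c f hf =>
    rw [map_smul, map_smul, LinearMap.smul_apply, hf, smul_mul_assoc, TensorProduct.smul_tmul']
  | x_mul i f hf =>
    rw [map_mul, map_mul, Module.End.mul_apply, hf, rowHom_x, splitAct, HAlg.lift_x, splitVar,
      if_pos rfl, TensorProduct.map_tmul, mul_assoc]
    rfl

theorem splitAct_rowAlg {L : List A} {a : A} (ha : a ∉ L) {g : HAlg θ (A × B)}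
    (hg : g ∈ rowAlg θ B L) :
    splitAct θ a g (1 ⊗ₜ 1) = 1 ⊗ₜ g := by
  refine rowAlg_induction (P := fun g => splitAct θ a g (1 ⊗ₜ 1) = 1 ⊗ₜ g) ?_ ?_ ?_ ?_ hg
  · rw [map_one, Module.End.one_apply]
  · intro f g hf hg
    rw [map_add, LinearMap.add_apply, hf, hg, TensorProduct.tmul_add]
  · intro c f hf
    rw [map_smul, LinearMap.smul_apply, hf, TensorProduct.tmul_smul]
  · intro b hb i f hf
    rw [map_mul, Module.End.mul_apply, hf, splitAct, HAlg.lift_x, splitVar,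
      if_neg (fun h : b = a => ha (h ▸ hb)), TensorProduct.map_tmul, AlgHom.toLinearMap_apply,
      map_one]
    rfl

/-- The products of a row with the other rows form a tensor product. -/
theorem splitAct_rowHom_mul {L : List A} {a : A} (ha : a ∉ L) (f : HAlg θ B)
    {g : HAlg θ (A × B)} (hg : g ∈ rowAlg θ B L) :
    splitAct θ a (rowHom θ a f * g) (1 ⊗ₜ 1) = f ⊗ₜ g := by
  rw [map_mul, Module.End.mul_apply, splitAct_rowAlg ha hg, splitAct_rowHom, mul_one]

variable [DecidableEq B]

theorem der_rowAlg {L : List A} {a : A} (ha : a ∉ L) (i : B) {g : HAlg θ (A × B)}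
    (hg : g ∈ rowAlg θ B L) : HAlg.der θ (a, i) g = 0 := by
  refine rowAlg_induction (P := fun g => HAlg.der θ (a, i) g = 0) (HAlg.der_one θ _)
    (fun f g hf hg => by rw [map_add, hf, hg, add_zero])
    (fun c f hf => by rw [map_smul, hf, smul_zero]) (fun b hb j f hf => ?_) hg
  rw [HAlg.der_x_mul, hf, mul_zero, smul_zero, add_zero, if_neg]
  rintro ⟨⟩
  exact ha hb

theorem der_rowHom_mul {a : A} {g : HAlg θ (A × B)} (hg : ∀ i, HAlg.der θ (a, i) g = 0) (i : B)
    (f : HAlg θ B) :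
    HAlg.der θ (a, i) (rowHom θ a f * g) = rowHom θ a (HAlg.der θ i f) * g := by
  induction f using HAlg.induction with
  | one => rw [map_one, one_mul, hg, HAlg.der_one, map_zero, zero_mul]
  | add f g hf hg => simp only [map_add, add_mul, hf, hg]
  | smul c f hf => simp only [map_smul, smul_mul_assoc, hf]
  | x_mul j f hf =>
    rw [map_mul (rowHom θ a), rowHom_x, mul_assoc, HAlg.der_x_mul, HAlg.der_x_mul, hf, map_add,
      map_smul, map_mul, rowHom_x, add_mul, smul_mul_assoc, mul_assoc]
    congr 1
    simp only [Prod.mk.injEq, true_and]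
    split_ifs
    · rfl
    · rw [map_zero, zero_mul]

/-- The operators `x_i ∂_j` for `ε = 1` and `-θ ∂_i x_j` for `ε = -1`. -/
def glOp (θ : ℤˣ) {I R : Type*} [Ring R] [Algebra ℂ R] (ε : ℤˣ) (x d : I → R) (i j : I) : R :=
  if ε = 1 then x i * d j else -(sgn θ • (d i * x j))

/-- The operators `glOp` in the row of index `a`. -/
def rowOp (θ : ℤˣ) (ε : ℤˣ) (a : A) (i j : B) : Module.End ℂ (HAlg θ (A × B)) :=
  glOp θ ε (fun i => HAlg.mulX θ (a, i)) (fun i => HAlg.der θ (a, i)) i j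

theorem rowOp_rowHom_mul (ε : ℤˣ) {a : A} {g : HAlg θ (A × B)}
    (hg : ∀ i, HAlg.der θ (a, i) g = 0) (i j : B) (f : HAlg θ B) :
    rowOp θ ε a i j (rowHom θ a f * g)
      = rowHom θ a (glOp θ ε (HAlg.mulX θ) (HAlg.der θ) i j f) * g := by
  have hx : ∀ i f, HAlg.mulX θ (a, i) (rowHom θ a f * g) = rowHom θ a (HAlg.mulX θ i f) * g := by
    intro i f
    simp only [HAlg.mulX, LinearMap.mulLeft_apply, map_mul, rowHom_x, mul_assoc]
  rw [rowOp, glOp, glOp]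
  split_ifs
  · rw [Module.End.mul_apply, der_rowHom_mul hg, hx, Module.End.mul_apply]
  · rw [LinearMap.neg_apply, LinearMap.smul_apply, Module.End.mul_apply, hx, der_rowHom_mul hg,
      LinearMap.neg_apply, LinearMap.smul_apply, Module.End.mul_apply, map_neg, map_smul, neg_mul,
      smul_mul_assoc]

/-- The bilinear operators in a row commute with the multiplication by the variables in the other
rows. -/
theorem rowOp_commute (ε : ℤˣ) {a b : A} (hab : a ≠ b) (i j k : B) :
    Commute (rowOp θ ε a i j) (HAlg.mulX θ (b, k)) := by
  have e := sgn_mul_self θ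
  have h := HAlg.isWeylFamily (I := A × B) θ
  have h1 : ∀ i, HAlg.der θ (a, i) * HAlg.mulX θ (b, k)
      = sgn θ • (HAlg.mulX θ (b, k) * HAlg.der θ (a, i)) := by
    intro i
    rw [h.dx, if_neg (fun hh => hab (congrArg Prod.fst hh)), add_zero]
  have h2 := fun i => h.xx (a, i) (b, k)
  have key : ∀ y z : Module.End ℂ (HAlg θ (A × B)),
      y * HAlg.mulX θ (b, k) = sgn θ • (HAlg.mulX θ (b, k) * y) →
      z * HAlg.mulX θ (b, k) = sgn θ • (HAlg.mulX θ (b, k) * z) →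
      Commute (y * z) (HAlg.mulX θ (b, k)) := by
    intro y z hy hz
    rw [Commute, SemiconjBy, mul_assoc, hz, mul_smul_comm, ← mul_assoc, hy, smul_mul_assoc,
      smul_smul, e, one_smul, mul_assoc]
  rw [rowOp, glOp]
  split_ifs
  · exact key _ _ (h2 i) (h1 j)
  · exact ((key _ _ (h1 i) (h2 j)).smul_left _).neg_left

theorem rowOp_commute_rowHom (ε : ℤˣ) {a b : A} (hab : a ≠ b) (i j : B) (f : HAlg θ B) :
    Commute (rowOp θ ε a i j) (LinearMap.mulLeft ℂ (rowHom θ b f)) := by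
  induction f using HAlg.induction with
  | one => rw [map_one, LinearMap.mulLeft_one]; exact Commute.one_right _
  | add f g hf hg =>
    rw [map_add, show LinearMap.mulLeft ℂ (rowHom θ b f + rowHom θ b g)
      = LinearMap.mulLeft ℂ (rowHom θ b f) + LinearMap.mulLeft ℂ (rowHom θ b g) from
      LinearMap.ext fun v => add_mul _ _ v]
    exact hf.add_right hg
  | smul c f hf =>
    rw [map_smul, show LinearMap.mulLeft ℂ (c • rowHom θ b f)
      = c • LinearMap.mulLeft ℂ (rowHom θ b f) from LinearMap.ext fun v => smul_mul_assoc c _ v]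
    exact hf.smul_right c
  | x_mul k f hf =>
    rw [map_mul, LinearMap.mulLeft_mul, rowHom_x]
    exact (rowOp_commute ε hab i j k).mul_right hf

end Rows

/-! ### The tensor product of the modules `Ψ` inside `H` -/

section TensorEmbedding

variable {θ : ℤˣ} {n : ℕ}

/-- The inclusion of `Ψ_z^{εN}` into the algebra `H(ℂ^n)`. -/
theorem psi_exists_inclusion (θ : ℤˣ) (n : ℕ) (z : ℂ) (ε : ℤˣ) (N : ℕ) :
    ∃ ι : psi θ n z ε N →ₗ[ℂ] HAlg θ (Fin n), Function.Injective ι ∧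
      LinearMap.range ι = HAlg.degree θ (Fin n) N ∧ ∀ i j r t,
        ι ((psi θ n z ε N).action (Yangian.T n i j r) t)
          = evalT (-(sgn θ * z)) (glOp θ ε (HAlg.mulX θ) (HAlg.der θ)) i j r (ι t) := by
  by_cases hε : ε = 1
  · have h : psi θ n z ε N = (phi θ n z).sub (HAlg.degree θ (Fin n) N) (phi_stable θ n z N) :=
      if_pos hε
    have h2 : (glOp θ ε (HAlg.mulX θ) (HAlg.der θ) :
        Fin n → Fin n → Module.End ℂ (HAlg θ (Fin n)))
        = fun i j => HAlg.mulX θ i * HAlg.der θ j := by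
      funext i j; exact if_pos hε
    rw [h, h2]
    refine ⟨(HAlg.degree θ (Fin n) N).subtype, Subtype.val_injective,
      Submodule.range_subtype _, fun i j r t => ?_⟩
    have e := Yangian.lift_T (evalT_isYangianFamily (-(sgn θ * z)) (phi_isGlFamily θ n)) i j r
    exact LinearMap.congr_fun e t.1
  · have h : psi θ n z ε N
        = (phiTilde θ n z).sub (HAlg.degree θ (Fin n) N) (phiTilde_stable θ n z N) := if_neg hε
    have h2 : (glOp θ ε (HAlg.mulX θ) (HAlg.der θ) :
        Fin n → Fin n → Module.End ℂ (HAlg θ (Fin n)))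
        = fun i j => -(sgn θ • (HAlg.der θ i * HAlg.mulX θ j)) := by
      funext i j; exact if_neg hε
    rw [h, h2]
    refine ⟨(HAlg.degree θ (Fin n) N).subtype, Subtype.val_injective,
      Submodule.range_subtype _, fun i j r t => ?_⟩
    have e := Yangian.lift_T (evalT_isYangianFamily (-(sgn θ * z)) (phiTilde_isGlFamily θ n)) i j r
    exact LinearMap.congr_fun e t.1

theorem range_mul'_comp_map {R S T : Type*} [Ring R] [Algebra ℂ R] [AddCommGroup S] [Module ℂ S]
    [AddCommGroup T] [Module ℂ T] (f : S →ₗ[ℂ] R) (g : T →ₗ[ℂ] R) :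
    LinearMap.range (LinearMap.mul' ℂ R ∘ₗ TensorProduct.map f g)
      = LinearMap.range f * LinearMap.range g := by
  rw [LinearMap.range_comp, TensorProduct.range_map, Submodule.map_map₂, Submodule.mul_eq_map₂]
  rfl

theorem evalT_rowOp_rowHom_mul {A : Type} [DecidableEq A] (ε : ℤˣ) (c : ℂ) {a : A}
    {g : HAlg θ (A × Fin n)} (hg : ∀ i, HAlg.der θ (a, i) g = 0) (i j : Fin n) (r : ℕ)
    (f : HAlg θ (Fin n)) :
    evalT c (rowOp θ ε a) i j r (rowHom θ a f * g)
      = rowHom θ a (evalT c (glOp θ ε (HAlg.mulX θ) (HAlg.der θ)) i j r f) * g := by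
  rcases r with _ | r
  · simp only [evalT]
    split_ifs
    · rw [Module.End.one_apply, Module.End.one_apply]
    · rw [LinearMap.zero_apply, LinearMap.zero_apply, map_zero, zero_mul]
  · simp only [evalT, LinearMap.smul_apply, map_smul, smul_mul_assoc, rowOp_rowHom_mul ε hg]

theorem commute_coeff_list_prod {R : Type*} [Ring R] {y : R}
    (L : List (Matrix (Fin n) (Fin n) (PowerSeries R)))
    (h : ∀ M ∈ L, ∀ i j r, Commute (PowerSeries.coeff r (M i j)) y) (i j : Fin n) (r : ℕ) :
    Commute (PowerSeries.coeff r (L.prod i j)) y := by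
  induction L generalizing i j r with
  | nil =>
    rw [List.prod_nil, Matrix.one_apply]
    split_ifs
    · rw [PowerSeries.coeff_one]
      split_ifs
      · exact Commute.one_left y
      · exact Commute.zero_left y
    · rw [map_zero]; exact Commute.zero_left y
  | cons M L ih =>
    rw [List.prod_cons, Matrix.mul_apply, map_sum]
    refine Commute.sum_left _ _ _ fun k _ => ?_
    rw [PowerSeries.coeff_mul]
    exact Commute.sum_left _ _ _ fun x _ => (h M List.mem_cons_self i k x.1).mul_left
      (ih (fun M' hM' => h M' (List.mem_cons_of_mem _ hM')) k j x.2)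

theorem YangianModule.tensor_action_T (M M' : YangianModule n) (i j : Fin n) (r : ℕ) (s : M)
    (t : M') : (M.tensor M').action (Yangian.T n i j r) (s ⊗ₜ[ℂ] t : M ⊗[ℂ] M')
      = (∑ k, ∑ x ∈ Finset.HasAntidiagonal.antidiagonal r,
          M.action (Yangian.T n i k x.1) s ⊗ₜ[ℂ] M'.action (Yangian.T n k j x.2) t :
            M ⊗[ℂ] M') := by
  have e : Yangian.comul n (Yangian.T n i j r) = _ :=
    Yangian.lift_T (Yangian.comul_family n) i j r
  let Φ : Yangian n ⊗[ℂ] Yangian n →ₐ[ℂ] Module.End ℂ (M ⊗[ℂ] M') :=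
    (Module.endTensorEndAlgHom (R := ℂ) (S := ℂ) (A := ℂ)).comp
      (Algebra.TensorProduct.map M.action M'.action)
  have e2 : Φ (Yangian.comul n (Yangian.T n i j r)) (s ⊗ₜ[ℂ] t)
      = ∑ k, ∑ x ∈ Finset.HasAntidiagonal.antidiagonal r,
          M.action (Yangian.T n i k x.1) s ⊗ₜ[ℂ] M'.action (Yangian.T n k j x.2) t := by
    rw [e]
    simp only [map_sum, LinearMap.sum_apply]
    rfl
  exact e2

/-- The tensor product of modules `Ψ` embeds into `H`, one factor for each row, in such a way that
the action of the Yangian becomes the product of the evaluation actions on the rows. -/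
theorem exists_tensorList_embedding {A : Type} [DecidableEq A] (z : A → ℂ) (ε : A → ℤˣ)
    (N : A → ℕ) (L : List A) (hL : L.Nodup) :
    ∃ F : YangianModule.tensorList (L.map fun a => psi θ n (z a) (ε a) (N a))
        →ₗ[ℂ] HAlg θ (A × Fin n), Function.Injective F ∧
      LinearMap.range F = rowDegree θ (Fin n) L N ∧ ∀ i j r t,
        F ((YangianModule.tensorList (L.map fun a => psi θ n (z a) (ε a) (N a))).action
            (Yangian.T n i j r) t)
          = PowerSeries.coeff r ((L.map fun a => seriesMatrix
              (evalT (-(sgn θ * z a)) (rowOp θ (ε a) a))).prod i j) (F t) := by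
  induction L with
  | nil =>
    refine ⟨Algebra.linearMap ℂ (HAlg θ (A × Fin n)), HAlg.algebraMap_injective,
      Submodule.one_eq_range.symm, fun i j r t => ?_⟩
    have e : ∀ t : ℂ, (YangianModule.trivial n).action (Yangian.T n i j r) t
        = (if r = 0 then (if i = j then 1 else 0) else 0 : ℂ) * t := fun t =>
      congrArg (· * t) (Yangian.lift_T _ i j r)
    have e2 : ∀ t : ℂ, algebraMap ℂ (HAlg θ (A × Fin n))
          ((if r = 0 then (if i = j then 1 else 0) else 0 : ℂ) * t)
        = PowerSeries.coeff r ((1 : Matrix (Fin n) (Fin n)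
            (PowerSeries (Module.End ℂ (HAlg θ (A × Fin n))))) i j) (algebraMap ℂ _ t) := by
      intro t
      rw [Matrix.one_apply]
      by_cases hr : r = 0 <;> by_cases hij : i = j <;>
        simp [hr, hij, PowerSeries.coeff_one]
    exact (congrArg (algebraMap ℂ (HAlg θ (A × Fin n))) (e t)).trans (e2 t)
  | cons a L ih =>
    obtain ⟨F, hF1, hF2, hF3⟩ := ih hL.of_cons
    obtain ⟨ι, hι1, hι2, hι3⟩ := psi_exists_inclusion θ n (z a) (ε a) (N a)
    have haL : a ∉ L := (List.nodup_cons.1 hL).1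
    have hmem : ∀ t, F t ∈ rowAlg θ (Fin n) L := fun t =>
      rowDegree_le_rowAlg L N (hF2 ▸ LinearMap.mem_range_self F t)
    let G : (psi θ n (z a) (ε a) (N a)) ⊗[ℂ]
        (YangianModule.tensorList (L.map fun a => psi θ n (z a) (ε a) (N a)))
        →ₗ[ℂ] HAlg θ (A × Fin n) :=
      LinearMap.mul' ℂ _ ∘ₗ TensorProduct.map ((rowHom θ a).toLinearMap ∘ₗ ι) F
    have hG : ∀ s t, G (s ⊗ₜ t) = rowHom θ a (ι s) * F t := fun _ _ => rfl
    refine ⟨G, ?_, ?_, fun i j r t => ?_⟩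
    · have h1 : Function.Injective (TensorProduct.map ι F) :=
        TensorProduct.map_injective_of_flat_flat _ _ hι1 hF1
      have h2 : ((LinearMap.applyₗ (R := ℂ) (1 ⊗ₜ 1 : HAlg θ (Fin n) ⊗[ℂ] HAlg θ (A × Fin n)))
          ∘ₗ (splitAct θ a).toLinearMap) ∘ₗ G = TensorProduct.map ι F := by
        refine TensorProduct.ext' fun s t => ?_
        exact splitAct_rowHom_mul haL (ι s) (hmem t)
      rw [← h2, LinearMap.coe_comp] at h1
      exact h1.of_comp
    · refine (range_mul'_comp_map _ _).trans ?_
      rw [LinearMap.range_comp, hι2, map_degree_rowHom, hF2]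
      rfl
    · have h1 : ∀ (s : psi θ n (z a) (ε a) (N a))
          (t : YangianModule.tensorList (L.map fun a => psi θ n (z a) (ε a) (N a))),
          G ((YangianModule.tensor (psi θ n (z a) (ε a) (N a))
              (YangianModule.tensorList (L.map fun a => psi θ n (z a) (ε a) (N a)))).action
              (Yangian.T n i j r) (s ⊗ₜ[ℂ] t : _ ⊗[ℂ] _))
            = PowerSeries.coeff r (((a :: L).map fun a => seriesMatrix
              (evalT (-(sgn θ * z a)) (rowOp θ (ε a) a))).prod i j) (G (s ⊗ₜ t)) := by
        intro s t
        rw [YangianModule.tensor_action_T, List.map_cons, List.prod_cons, coeff_seriesMatrix_mul,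
          LinearMap.sum_apply, map_sum]
        refine Finset.sum_congr rfl fun k _ => ?_
        rw [LinearMap.sum_apply, map_sum]
        refine Finset.sum_congr rfl fun x _ => ?_
        rw [hG, hG, hι3, hF3, Module.End.mul_apply]
        have hc := commute_coeff_list_prod (y := LinearMap.mulLeft ℂ (rowHom θ a (ι s)))
          (L.map fun a => seriesMatrix (evalT (-(sgn θ * z a)) (rowOp θ (ε a) a)))
          (fun M hM i j r => by
            obtain ⟨b, hb, rfl⟩ := List.mem_map.1 hM
            have hba : b ≠ a := fun h => haL (h ▸ hb)
            simp only [seriesMatrix, Matrix.of_apply, PowerSeries.coeff_mk]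
            rcases r with _ | r
            · simp only [evalT]
              split_ifs
              · exact Commute.one_left _
              · exact Commute.zero_left _
            · exact (rowOp_commute_rowHom (ε b) hba i j (ι s)).smul_left _) k j x.2
        have hc2 := LinearMap.congr_fun hc.eq (F t)
        simp only [Module.End.mul_apply, LinearMap.mulLeft_apply] at hc2
        rw [hc2, evalT_rowOp_rowHom_mul (ε a) _ (fun l => ?_)]
        rw [← hF3]
        exact der_rowAlg haL l (hmem _)
      change (psi θ n (z a) (ε a) (N a)) ⊗[ℂ]
        (YangianModule.tensorList (L.map fun a => psi θ n (z a) (ε a) (N a))) at t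
      induction t using TensorProduct.induction_on with
      | zero => exact (congrArg G (map_zero _)).trans ((map_zero G).trans
          ((congrArg _ (map_zero G)).trans (map_zero _)).symm)
      | tmul s t => exact h1 s t
      | add s t hs ht =>
        refine (congrArg G (map_add _ s t)).trans ((map_add G _ _).trans ?_)
        refine (congrArg₂ (· + ·) hs ht).trans ?_
        exact ((congrArg _ (map_add G s t)).trans (map_add _ _ _)).symm

end TensorEmbedding

/-! ### Joint eigenspaces of the Euler operators -/

section Euler

variable {θ : ℤˣ} {m n : ℕ}

/-- The Euler operator `∑_i x_ai ∂_ai` of the row of index `a`. -/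
def euler (θ : ℤˣ) (n : ℕ) (a : Fin m) : Module.End ℂ (HAlg θ (Fin m × Fin n)) :=
  weylGl (HAlg.mulX θ) (HAlg.der θ) a a

theorem euler_commute (a b : Fin m) : Commute (euler θ n a) (euler θ n b) := by
  have h := (HAlg.isWeylFamily (I := Fin m × Fin n) θ).weylGl_isGlFamily a a b b
  rw [Commute, SemiconjBy, ← sub_eq_zero]
  refine h.trans ?_
  by_cases hab : a = b
  · subst hab; simp
  · rw [if_neg hab, if_neg (Ne.symm hab), sub_zero]

theorem euler_one (a : Fin m) : euler θ n a 1 = 0 := by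
  simp only [euler, weylGl, LinearMap.sum_apply, Module.End.mul_apply, HAlg.der_one, map_zero,
    Finset.sum_const_zero]

theorem euler_x_mul (a b : Fin m) (k : Fin n) (f : HAlg θ (Fin m × Fin n)) :
    euler θ n a (HAlg.x θ (b, k) * f)
      = HAlg.x θ (b, k) * euler θ n a f + if a = b then HAlg.x θ (b, k) * f else 0 := by
  have e := sgn_mul_self θ
  have h1 : ∀ i, HAlg.x θ (a, i) * HAlg.der θ (a, i) (HAlg.x θ (b, k) * f)
      = HAlg.x θ (b, k) * (HAlg.x θ (a, i) * HAlg.der θ (a, i) f)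
        + if a = b then if i = k then HAlg.x θ (a, i) * f else 0 else 0 := by
    intro i
    rw [HAlg.der_x_mul, mul_add, mul_smul_comm, ← mul_assoc, HAlg.x_mul_x θ (a, i) (b, k),
      smul_mul_assoc, smul_smul, e, one_smul, mul_assoc, add_comm]
    simp only [Prod.mk.injEq, ite_and, mul_ite, mul_zero]
  have h2 : ∀ g, euler θ n a g = ∑ i, HAlg.x θ (a, i) * HAlg.der θ (a, i) g := fun g =>
    LinearMap.sum_apply _ _ _
  rw [h2, h2]
  simp only [h1, Finset.sum_add_distrib, ← Finset.mul_sum, Finset.sum_ite_irrel,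
    Finset.sum_ite_eq', Finset.mem_univ, if_true, Finset.sum_const_zero]
  congr 1
  split_ifs with hab
  · rw [hab]
  · rfl

theorem rowSpan_pow_mul_le_eigenspace (a b : Fin m) (k : ℕ) (c : ℂ)
    {S : Submodule ℂ (HAlg θ (Fin m × Fin n))}
    (hS : S ≤ Module.End.eigenspace (euler θ n a) c) :
    rowSpan θ (Fin n) b ^ k * S
      ≤ Module.End.eigenspace (euler θ n a) (c + ((if a = b then k else 0 : ℕ) : ℂ)) := by
  induction k with
  | zero => simpa using hS
  | succ k ih =>
    rw [pow_succ', mul_assoc]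
    refine Submodule.mul_le.2 fun y hy f hf => ?_
    have hf := Module.End.mem_eigenspace_iff.1 (ih hf)
    induction hy using Submodule.span_induction with
    | mem y hy =>
      obtain ⟨i, rfl⟩ := hy
      refine Module.End.mem_eigenspace_iff.2 ?_
      rw [euler_x_mul, hf]
      split_ifs
      · rw [mul_smul_comm, Nat.cast_succ, ← add_assoc, add_smul (c + (k : ℂ)), one_smul]
      · rw [mul_smul_comm, add_zero]
    | zero => rw [zero_mul]; exact Submodule.zero_mem _
    | add y z _ _ hy hz => rw [add_mul]; exact Submodule.add_mem _ hy hz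
    | smul t y _ hy => rw [smul_mul_assoc]; exact Submodule.smul_mem _ t hy

theorem rowDegree_le_eigenspace (a : Fin m) (N : Fin m → ℕ) :
    rowDegree θ (Fin n) (List.finRange m) N ≤ Module.End.eigenspace (euler θ n a) (N a : ℂ) := by
  have h : ∀ L : List (Fin m), rowDegree θ (Fin n) L N ≤ Module.End.eigenspace (euler θ n a)
      (((L.map fun b => if a = b then N b else 0).sum : ℕ) : ℂ) := by
    intro L
    induction L with
    | nil =>
      refine Submodule.one_le.2 (Module.End.mem_eigenspace_iff.2 ?_)
      rw [euler_one, List.map_nil, List.sum_nil, Nat.cast_zero, zero_smul]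
    | cons b L ih =>
      rw [List.map_cons, List.sum_cons, add_comm, Nat.cast_add]
      exact rowSpan_pow_mul_le_eigenspace a b (N b) _ ih
  have h2 := h (List.finRange m)
  rwa [← Fin.sum_univ_def, Finset.sum_ite_eq, if_pos (Finset.mem_univ a)] at h2

theorem rowSpan_commute {A B : Type} (a b : A) :
    Commute (rowSpan θ B a) (rowSpan θ B b) := by
  have h : ∀ a b : A, rowSpan θ B a * rowSpan θ B b ≤ rowSpan θ B b * rowSpan θ B a := by
    intro a b
    rw [rowSpan, rowSpan, Submodule.span_mul_span, Submodule.span_le]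
    rintro _ ⟨_, ⟨i, rfl⟩, _, ⟨j, rfl⟩, rfl⟩
    simp only [HAlg.x_mul_x θ (a, i) (b, j)]
    exact Submodule.smul_mem _ _ (Submodule.mul_mem_mul (Submodule.subset_span ⟨j, rfl⟩)
      (Submodule.subset_span ⟨i, rfl⟩))
  exact le_antisymm (h a b) (h b a)

theorem rowSpan_mul_rowDegree {A B : Type} [DecidableEq A] (a : A) (N : A → ℕ) (L : List A)
    (hL : L.Nodup) (ha : a ∈ L) :
    rowSpan θ B a * rowDegree θ B L N
      = rowDegree θ B L (Function.update N a (N a + 1)) := by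
  induction L with
  | nil => exact absurd ha List.not_mem_nil
  | cons b L ih =>
    have h1 : ∀ N, rowDegree θ B (b :: L) N = rowSpan θ B b ^ N b * rowDegree θ B L N :=
      fun _ => rfl
    rw [h1, h1]
    by_cases hab : a = b
    · subst hab
      have h2 : rowDegree θ B L (Function.update N a (N a + 1)) = rowDegree θ B L N := by
        refine congrArg List.prod (List.map_congr_left fun c hc => ?_)
        have hca : c ≠ a := fun h => (List.nodup_cons.1 hL).1 (h ▸ hc)
        rw [Function.update_of_ne hca]
      rw [Function.update_self, h2, pow_succ', mul_assoc]
    · rw [Function.update_of_ne (Ne.symm hab), ← mul_assoc,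
        ((rowSpan_commute a b).pow_right (N b)).eq, mul_assoc,
        ih hL.of_cons (List.mem_of_ne_of_mem hab ha)]

theorem iSup_rowDegree :
    ⨆ N, rowDegree θ (Fin n) (List.finRange m) N = ⊤ := by
  rw [eq_top_iff]
  intro f _
  induction f using HAlg.induction with
  | one =>
    refine Submodule.mem_iSup_of_mem (fun _ => 0) ?_
    have h : rowDegree θ (Fin n) (List.finRange m) (fun _ => 0) = 1 :=
      List.prod_eq_one fun S hS => by
        obtain ⟨a, -, rfl⟩ := List.mem_map.1 hS
        exact pow_zero _
    rw [h]
    exact Submodule.one_le.1 le_rfl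
  | add f g hf hg => exact Submodule.add_mem _ (hf trivial) (hg trivial)
  | smul c f hf => exact Submodule.smul_mem _ c (hf trivial)
  | x_mul c f hf =>
    obtain ⟨a, i⟩ := c
    refine Submodule.iSup_induction (fun N => rowDegree θ (Fin n) (List.finRange m) N)
      (motive := fun f => HAlg.x θ (a, i) * f ∈ ⨆ N, rowDegree θ (Fin n) (List.finRange m) N)
      (hf trivial) (fun N f hf => ?_) ?_ (fun f g hf hg => ?_)
    · refine Submodule.mem_iSup_of_mem (Function.update N a (N a + 1)) ?_
      rw [← rowSpan_mul_rowDegree a N _ (List.nodup_finRange m) (List.mem_finRange a)]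
      exact Submodule.mul_mem_mul (Submodule.subset_span ⟨i, rfl⟩) hf
    · rw [mul_zero]; exact Submodule.zero_mem _
    · rw [mul_add]; exact Submodule.add_mem _ hf hg

theorem iInf_eigenspace_euler (N : Fin m → ℕ) :
    ⨅ a, Module.End.eigenspace (euler θ n a) (N a : ℂ)
      = rowDegree θ (Fin n) (List.finRange m) N := by
  refine le_antisymm (fun f hf => ?_) (le_iInf fun a => rowDegree_le_eigenspace a N)
  have hind := Module.End.independent_iInf_maxGenEigenspace_of_forall_mapsTo (euler (m := m) θ n)
    fun a b φ => Module.End.mapsTo_maxGenEigenspace_of_comm (euler_commute b a) φ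
  have hle : ⨅ a, Module.End.eigenspace (euler θ n a) (N a : ℂ)
      ≤ ⨅ a, (euler θ n a).maxGenEigenspace (N a : ℂ) :=
    iInf_mono fun a => (euler θ n a).genEigenspace_le_maximal _ _
  have hD : ∀ N : Fin m → ℕ, rowDegree θ (Fin n) (List.finRange m) N
      ≤ ⨅ a, (euler θ n a).maxGenEigenspace (N a : ℂ) := fun N =>
    le_iInf fun a => (rowDegree_le_eigenspace a N).trans
      ((euler θ n a).genEigenspace_le_maximal _ _)
  have htop : f ∈ ⨆ N, rowDegree θ (Fin n) (List.finRange m) N := by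
    rw [iSup_rowDegree]; exact Submodule.mem_top
  rw [iSup_split_single _ N] at htop
  obtain ⟨d, hd, g, hg, rfl⟩ := Submodule.mem_sup.1 htop
  have hg2 : g ∈ ⨆ χ : Fin m → ℂ, ⨆ _ : χ ≠ fun a => (N a : ℂ),
      ⨅ a, (euler θ n a).maxGenEigenspace (χ a) := by
    refine (iSup₂_le fun N' hN' => ?_ : (⨆ N', ⨆ _ : N' ≠ N,
      rowDegree θ (Fin n) (List.finRange m) N') ≤ _) hg
    refine (hD N').trans (le_iSup₂_of_le (fun a => (N' a : ℂ)) ?_ le_rfl)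
    exact fun h => hN' (funext fun a => Nat.cast_injective (congrFun h a))
  have hg1 : g ∈ ⨅ a, (euler θ n a).maxGenEigenspace (N a : ℂ) := by
    have := Submodule.sub_mem _ (hle hf) (hD N hd)
    rwa [add_sub_cancel_left] at this
  have h0 := Submodule.disjoint_def.1 (hind fun a => (N a : ℂ)) g hg1 hg2
  rw [h0, add_zero]
  exact hd

end Euler

/-! ### The isomorphism -/

section Isomorphism

variable (θ : ℤˣ) (p q n : ℕ) (δ : Fin (p + q) → ℤˣ)

theorem YangianModule.isIsomorphic_of_T {n : ℕ} {M N : YangianModule n} (e : M ≃ₗ[ℂ] N)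
    (h : ∀ i j r v, e (M.action (Yangian.T n i j r) v) = N.action (Yangian.T n i j r) (e v)) :
    M.IsIsomorphic N := by
  let S : Subalgebra ℂ (Yangian n) :=
    { carrier := {y | ∀ v, e (M.action y v) = N.action y (e v)}
      mul_mem' := fun {a b} ha hb v => by
        rw [map_mul, map_mul, Module.End.mul_apply, Module.End.mul_apply, ha, hb]
      add_mem' := fun {a b} ha hb v => by
        rw [map_add, map_add, LinearMap.add_apply, LinearMap.add_apply, map_add, ha, hb]
      algebraMap_mem' := fun c v => by
        rw [AlgHom.commutes, AlgHom.commutes, Module.algebraMap_end_apply,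
          Module.algebraMap_end_apply, map_smul] }
  exact ⟨e, fun y => Yangian.mem_of_T S (fun i j r => h i j r) y⟩

/-- The sign that tells whether `q_ai p_aj` acts in the row `a` as `x_i ∂_j` or as `-θ ∂_i x_j`. -/
def rowSign (a : Fin (p + q)) : ℤˣ := if (a : ℕ) < p then -δ a else δ a

theorem opQ_mul_opP (a : Fin (p + q)) (i j : Fin n) :
    opQ θ p q n δ (a, i) * opP θ p q n δ (a, j) = rowOp θ (rowSign p q δ a) a i j := by
  have e := sgn_mul_self θ
  have hx : ∀ c, HDAlg.act θ (varpi θ p q n δ (HDAlg.x θ c))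
      = if δ c.1 = -1 then -sgn θ • HAlg.der θ c else HAlg.mulX θ c := by
    intro c
    rw [varpi, HDAlg.lift_x]
    split_ifs
    · rw [map_smul, HDAlg.act, HDAlg.lift_d]
    · rw [HDAlg.act, HDAlg.lift_x]
  have hd : ∀ c, HDAlg.act θ (varpi θ p q n δ (HDAlg.d θ c))
      = if δ c.1 = -1 then HAlg.mulX θ c else HAlg.der θ c := by
    intro c
    rw [varpi, HDAlg.lift_d]
    split_ifs
    · rw [map_smul, HDAlg.act, HDAlg.lift_x, one_smul]
    · rw [HDAlg.act, HDAlg.lift_d]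
  simp only [opQ, opP, coordQ, coordP, rowOp, glOp, rowSign]
  rcases Int.units_eq_one_or (δ a) with h | h <;> by_cases hp : (a : ℕ) < p <;>
    simp [hp, h, hx, hd, smul_smul, e]
  refine LinearMap.ext fun v => ?_
  simp only [Module.End.mul_apply, LinearMap.neg_apply, LinearMap.smul_apply, map_neg, map_smul]

theorem weylGl_op_self (a : Fin (p + q)) :
    weylGl (opQ θ p q n δ) (opP θ p q n δ) a a
      = if rowSign p q δ a = 1 then euler θ n a
        else -(euler θ n a + algebraMap ℂ _ (sgn θ * n)) := by
  have e := sgn_mul_self θ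
  have h : ∀ k : Fin n, HAlg.der θ (a, k) * HAlg.mulX θ (a, k)
      = sgn θ • (HAlg.mulX θ (a, k) * HAlg.der θ (a, k)) + 1 := by
    intro k
    rw [(HAlg.isWeylFamily (I := Fin (p + q) × Fin n) θ).dx, if_pos rfl]
  simp only [weylGl, opQ_mul_opP, euler, rowOp, glOp]
  split_ifs
  · rfl
  · simp only [h, smul_add, smul_smul, e, one_smul, Finset.sum_neg_distrib,
      Finset.sum_add_distrib, Finset.sum_const, Finset.card_univ, Fintype.card_fin]
    rw [Algebra.algebraMap_eq_smul_one, mul_comm, mul_smul, Nat.cast_smul_eq_nsmul]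

variable (μ : Fin (p + q) → ℂ)

/-- The bijection from `H` to the coinvariants of `E_δ(M_μ)`. -/
def coinvEmb : HAlg θ (Fin (p + q) × Fin n) →ₗ[ℂ] coinvariants θ p q n δ (Verma μ) :=
  coinvMap θ p q n δ μ

theorem coinvEmb_injective : Function.Injective (coinvEmb θ p q n δ μ) :=
  coinvMap_injective θ p q n δ μ

theorem coinvEmb_surjective : Function.Surjective (coinvEmb θ p q n δ μ) :=
  coinvMap_surjective θ p q n δ μ

theorem coinvEmb_action (i j : Fin n) (r : ℕ) (f : HAlg θ (Fin (p + q) × Fin n)) :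
    (coinvariants θ p q n δ (Verma μ)).action (Yangian.T n i j r) (coinvEmb θ p q n δ μ f)
      = coinvEmb θ p q n δ μ (PowerSeries.coeff r (opProd θ p q n δ μ i j) f) :=
  mkQ_bimodRep_alpha_T θ p q n δ μ i j r f

theorem coinvEmb_cartan (c : Fin (p + q)) (f : HAlg θ (Fin (p + q) × Fin n)) :
    cartanAction θ p q n δ (Verma μ) c (coinvEmb θ p q n δ μ f)
      = coinvEmb θ p q n δ μ ((μ c + sgn θ * n / 2) • f
          + weylGl (opQ θ p q n δ) (opP θ p q n δ) c c f) :=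
  mkQ_glElement_self θ p q n δ μ c f

theorem opProd_eq : opProd θ p q n δ μ
    = ((List.finRange (p + q)).map fun a => seriesMatrix (evalT (-(sgn θ * (μ a + rho a)))
        (rowOp θ (rowSign p q δ a) a))).prod := by
  rw [opProd, List.ofFn_eq_map]
  simp only [opQ_mul_opP]

theorem coinvEmb_mem_weightSpace (κ : Fin (p + q) → ℂ) (ν : Fin (p + q) → ℕ)
    (hν : ∀ a, κ a = if rowSign p q δ a = 1 then μ a + ν a + sgn θ * n / 2
      else μ a - ν a - sgn θ * n / 2) (f : HAlg θ (Fin (p + q) × Fin n)) :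
    coinvEmb θ p q n δ μ f ∈ weightSpace θ p q n δ (Verma μ) κ
      ↔ f ∈ rowDegree θ (Fin n) (List.finRange (p + q)) ν := by
  rw [← iInf_eigenspace_euler, weightSpace, Submodule.mem_iInf, Submodule.mem_iInf]
  refine forall_congr' fun a => ?_
  rw [Module.End.mem_eigenspace_iff, Module.End.mem_eigenspace_iff, coinvEmb_cartan, ← map_smul,
    (coinvEmb_injective θ p q n δ μ).eq_iff, weylGl_op_self, hν]
  split_ifs
  · rw [← sub_eq_zero, ← sub_eq_zero (b := (ν a : ℂ) • f)]
    have h : (μ a + sgn θ * n / 2) • f + euler θ n a f - (μ a + ν a + sgn θ * n / 2) • f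
        = euler θ n a f - (ν a : ℂ) • f := by
      module
    rw [h]
  · rw [← sub_eq_zero, ← sub_eq_zero (b := (ν a : ℂ) • f), LinearMap.neg_apply,
      LinearMap.add_apply, Module.algebraMap_end_apply]
    have h : (μ a + sgn θ * n / 2) • f + -(euler θ n a f + (sgn θ * n) • f)
        - (μ a - ν a - sgn θ * n / 2) • f = -(euler θ n a f - (ν a : ℂ) • f) := by
      module
    rw [h, neg_eq_zero]

/-- The weight spaces of the coinvariants of `E_δ(M_μ)` are tensor products of modules `Ψ`, for
every weight `μ` and every sequence of signs `δ`. -/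
theorem weightModule_isIsomorphic (κ : Fin (p + q) → ℂ) (ν : Fin (p + q) → ℕ)
    (hν : ∀ a, κ a = if rowSign p q δ a = 1 then μ a + ν a + sgn θ * n / 2
      else μ a - ν a - sgn θ * n / 2) :
    (weightModule θ p q n δ (Verma μ) κ).IsIsomorphic
      (YangianModule.tensorList (List.ofFn fun a : Fin (p + q) =>
        psi θ n (μ a + rho a) (rowSign p q δ a) (ν a))) := by
  rw [List.ofFn_eq_map]
  obtain ⟨F, hF1, hF2, hF3⟩ := exists_tensorList_embedding (θ := θ) (n := n)
    (fun a : Fin (p + q) => μ a + rho a) (rowSign p q δ) ν (List.finRange (p + q))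
    (List.nodup_finRange _)
  let M := YangianModule.tensorList ((List.finRange (p + q)).map fun a : Fin (p + q) =>
        psi θ n (μ a + rho a) (rowSign p q δ a) (ν a))
  let W := weightSpace θ p q n δ (Verma μ) κ
  have hW : ∀ f, coinvEmb θ p q n δ μ f ∈ W ↔ f ∈ LinearMap.range F := fun f => by
    rw [hF2]; exact coinvEmb_mem_weightSpace θ p q n δ μ κ ν hν f
  let G : M →ₗ[ℂ] W := (coinvEmb θ p q n δ μ ∘ₗ F).codRestrict W
    fun t => (hW _).2 (LinearMap.mem_range_self F t)
  have hG : Function.Bijective G := by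
    constructor
    · intro s t hst
      exact hF1 (coinvEmb_injective θ p q n δ μ (congrArg Subtype.val hst))
    · rintro ⟨w, hw⟩
      obtain ⟨f, rfl⟩ := coinvEmb_surjective θ p q n δ μ w
      obtain ⟨t, rfl⟩ := (hW f).1 hw
      exact ⟨t, rfl⟩
  let e : M ≃ₗ[ℂ] weightModule θ p q n δ (Verma μ) κ := LinearEquiv.ofBijective G hG
  have he : ∀ i j r t, e (M.action (Yangian.T n i j r) t)
      = (weightModule θ p q n δ (Verma μ) κ).action (Yangian.T n i j r) (e t) := by
    intro i j r t
    refine Subtype.ext ?_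
    refine (congrArg (coinvEmb θ p q n δ μ) (hF3 i j r t)).trans ?_
    rw [← opProd_eq]
    exact (coinvEmb_action θ p q n δ μ i j r (F t)).symm
  refine YangianModule.isIsomorphic_of_T e.symm fun i j r v => ?_
  rw [LinearEquiv.symm_apply_eq, he, LinearEquiv.apply_symm_apply]

end Isomorphism

end RatYangian

end

theorem proposition3p4 (θ : ℤˣ) (n p q : ℕ) (σ : Equiv.Perm (Fin (p + q)))
    (μ lam : Fin (p + q) → ℂ) (hμ : IsGeneric μ) (ν : Fin (p + q) → ℕ)
    (hν : ∀ a : Fin (p + q), (ν a : ℂ) =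
      if (a : ℕ) < p then -lam a + μ a - sgn θ * n / 2
      else lam a - μ a - sgn θ * n / 2)
    (δ : Fin (p + q) → ℤˣ) (hδ : δ = permSign σ (fun _ => 1)) :
    (weightModule θ p q n δ (Verma (shifted σ μ)) (shifted σ lam)).IsIsomorphic
      (YangianModule.tensorList (List.ofFn fun a : Fin (p + q) =>
        psi θ n (μ (σ⁻¹ a) + rho (σ⁻¹ a)) (if (a : ℕ) < p then -δ a else δ a)
          (ν (σ⁻¹ a)))) := by
  have hsign : ∀ a, rowSign p q δ a = if ((σ⁻¹ a : Fin (p + q)) : ℕ) < p then -1 else 1 := by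
    intro a
    rw [hδ]
    simp only [rowSign, permSign, barSign]
    split_ifs <;> simp
  have h := weightModule_isIsomorphic θ p q n δ (shifted σ μ) (shifted σ lam)
    (fun a => ν (σ⁻¹ a)) fun a => by
      rw [hsign, hν]
      simp only [shifted]
      split_ifs with h1 h2
      · exact absurd h2 (by decide)
      · ring
      · ring
      · contradiction
  have hrho : ∀ a, shifted σ μ a + rho a = μ (σ⁻¹ a) + rho (σ⁻¹ a) := fun a => by
    rw [shifted, sub_add_cancel]
  simp only [hrho] at h
  exact h
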